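/- Consider quantum circuits whose elementary gates are the 1-qubit Hadamard gate and the 3-qubit Toffoli gate. A circuit $C$ for $n$-bit inputs acts on $S\ge\max(n,1)$ qubits and consists of gates with unitaries $U_1,\dots,U_T$ (each being its gate on that gate's qubits and the identity on the others). On input $x\in\{0,1\}^n$ it starts in the basis state $|i_0\rangle=|x\rangle|0^{S-n}\rangle$, its final state is $|\psi_x\rangle=U_T\cdots U_1|i_0\rangle$, and its acceptance probability on $x$ is $\sum_{i\in\{0,1\}^S:\,i_1=1}|\langle i|\psi_x\rangle|^2$, the probability that measuring the first qubit gives $1$. A uniform polynomial-size family is a sequence $(C_n)_{n\ge 0}$ of such circuits, $C_n$ for inputs of length $n$, with at most $p(n)$ gates for some polynomial $p$, such that a classical Turing machine, given $n$ in unary and $j$ in binary, outputs in polynomial time the $j$-th gate of $C_n$ with the numbers of its wires (or reports that there is no such gate). $\mathbf{BQP}$ is the class of languages $L\subseteq\{0,1\}^*$ for which there is such a family whose acceptance probability on $x$ (using the circuit $C_{|x|}$) is at least $2/3$ if $x\in L$ and at most $1/3$ if $x\notin L$. $\mathbf{PSPACE}$ is the class of languages decided by a deterministic Turing machine in polynomial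 space. "Computable exactly in polynomial space" means that a deterministic Turing machine using space polynomial in its input length always halts and outputs integers $m$ and $e\ge 0$, in binary, such that the value equals $m/\sqrt2^{\,e}$ (for amplitudes) or $m/2^{e}$ (for probabilities). Then: 1. For every such circuit $C$, every $x\in\{0,1\}^n$ and every $i_T\in\{0,1\}^S$, $$\langle i_T|\psi_x\rangle=\sum_{i_1,\dots,i_{T-1}\in\{0,1\}^S}\ \prod_{j=1}^{T}\langle i_j|U_j|i_{j-1}\rangle$$ (for $T=0$ the right-hand side is read as $1$ if $i_T=i_0$ and $0$ otherwise; equivalently, for all $T$, one sums over all sequences of basis states of length $T+1$ that start with $|x\rangle|0^{S-n}\rangle$ and end with $i_T$). 2. The amplitude $\langle i_T|\psi_x\rangle$ is computable exactly in polynomial space from a description of $C$ together with $x$ and $i_T$. 3. The acceptance probability of $C$ on $x$ is computable exactly in polynomial space from a description of $C$ together with $x$. 4. For every uniform polynomial-size family $(C_n)_{n\ge 0}$, the acceptance probability of $C_{|x|}$ on $x$ is computable exactly in polynomial space from $x$ alone. 5. $\mathbf{BQP}\subseteq\mathbf{PSPACE}$. -/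

import Mathlib

open Turing Computability

/-! ### Quantum circuits over the gate set {Hadamard, Toffoli} -/

/-- An elementary gate together with the wires (out of `S` qubits) on which it acts: a Hadamard
gate on qubit `k`, or a Toffoli gate with controls `a`, `b` and target `c`. -/
inductive QGate (S : ℕ) : Type
  | had (k : Fin S) : QGate S
  | toffoli (a b c : Fin S) (hab : a ≠ b) (hac : a ≠ c) (hbc : b ≠ c) : QGate S

/-- The `2 × 2` Hadamard matrix. -/
noncomputable def hadamardMatrix : Matrix Bool Bool ℂ :=
  fun i j => if i && j then -(1 / (Real.sqrt 2 : ℂ)) else 1 / (Real.sqrt 2 : ℂ)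

/-- The `8 × 8` Toffoli matrix, `|a, b, c⟩ ↦ |a, b, c ⊕ ab⟩`. -/
def toffoliMatrix : Matrix (Bool × Bool × Bool) (Bool × Bool × Bool) ℂ :=
  fun i j => if i = (j.1, j.2.1, xor j.2.2 (j.1 && j.2.1)) then 1 else 0

/-- The matrix, in the computational basis of `S` qubits, that applies the gate to its own qubits
and the identity to all other qubits. The entry at `i`, `j` is `⟨i|U|j⟩`. -/
noncomputable def QGate.matrix {S : ℕ} : QGate S → Matrix (Fin S → Bool) (Fin S → Bool) ℂ
  | .had k => fun i j =>
      if ∀ l, l ≠ k → i l = j l then hadamardMatrix (i k) (j k) else 0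
  | .toffoli a b c _ _ _ => fun i j =>
      if ∀ l, l ≠ a → l ≠ b → l ≠ c → i l = j l then
        toffoliMatrix (i a, i b, i c) (j a, j b, j c) else 0

/-- A quantum circuit for inputs of `n` bits. It acts on `width ≥ n` qubits (at least one, so that
there is a first qubit to measure); the first `n` carry the input and the others are workspace,
initially `|0⟩`. The gates are listed in the order in which they are applied. -/
structure QCircuit (n : ℕ) where
  width : ℕ
  width_pos : 0 < width
  input_le : n ≤ width
  gates : List (QGate width)

namespace QCircuit

variable {n : ℕ}

/-- The label of the starting basis state `|x⟩|0…0⟩`. -/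
def initIndex (C : QCircuit n) (x : Fin n → Bool) : Fin C.width → Bool :=
  fun l => if h : (l : ℕ) < n then x ⟨l, h⟩ else false

/-- The unitary `U_T ⋯ U_2 U_1` of the circuit. -/
noncomputable def unitary (C : QCircuit n) :
    Matrix (Fin C.width → Bool) (Fin C.width → Bool) ℂ :=
  ((C.gates.map QGate.matrix).reverse).prod

/-- The final state `|ψ_x⟩ = U_T ⋯ U_1 |x, 0…0⟩`, as the vector of its amplitudes. -/
noncomputable def finalState (C : QCircuit n) (x : Fin n → Bool) : (Fin C.width → Bool) → ℂ :=
  C.unitary.mulVec (Pi.single (C.initIndex x) 1)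

/-- The probability that measuring the first qubit of the final state gives `1`. -/
noncomputable def acceptProb (C : QCircuit n) (x : Fin n → Bool) : ℝ :=
  ∑ i : Fin C.width → Bool, if i ⟨0, C.width_pos⟩ = true then ‖C.finalState x i‖ ^ 2 else 0

/-- The sum over all sequences of basis states `i_0, i_1, …, i_T` with `i_0 = |x, 0…0⟩` and
`i_T = i` of the products `∏_j ⟨i_j|U_j|i_{j-1}⟩`. -/
noncomputable def pathSum (C : QCircuit n) (x : Fin n → Bool) (i : Fin C.width → Bool) : ℂ :=
  ∑ p : Fin (C.gates.length + 1) → (Fin C.width → Bool),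
    if p 0 = C.initIndex x ∧ p (Fin.last C.gates.length) = i then
      ∏ j : Fin C.gates.length, (C.gates.get j).matrix (p j.succ) (p j.castSucc)
    else 0

end QCircuit

/-! ### Descriptions as strings over Mathlib's standard machine alphabet -/

/-- Bits as symbols of the alphabet. -/
def encBits (l : List Bool) : List Γ' := l.map Γ'.bit

/-- A natural number in binary, followed by a comma. -/
def encNat (k : ℕ) : List Γ' := encBits (encodeNat k) ++ [Γ'.comma]

/-- A gate: its type and the numbers of its wires. -/
def QGate.enc {S : ℕ} : QGate S → List Γ'
  | .had k => Γ'.bit false :: encNat k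
  | .toffoli a b c _ _ _ => Γ'.bit true :: (encNat a ++ encNat b ++ encNat c)

/-- A circuit: the number of qubits in binary, and the list of its gates. -/
def QCircuit.enc {n : ℕ} (C : QCircuit n) : List Γ' :=
  encNat C.width ++ C.gates.flatMap QGate.enc

/-- A circuit together with a classical input. -/
structure CircuitInput where
  n : ℕ
  circuit : QCircuit n
  x : Fin n → Bool

/-- The string consisting of the input and the circuit. -/
def CircuitInput.enc (a : CircuitInput) : List Γ' :=
  encBits (List.ofFn a.x) ++ Γ'.comma :: a.circuit.enc

/-- A circuit together with a classical input and a basis state of all its qubits. -/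
structure AmplitudeInput where
  n : ℕ
  circuit : QCircuit n
  x : Fin n → Bool
  i : Fin circuit.width → Bool

/-- The string consisting of the basis state, the input and the circuit. -/
def AmplitudeInput.enc (a : AmplitudeInput) : List Γ' :=
  encBits (List.ofFn a.i) ++ Γ'.comma :: (encBits (List.ofFn a.x) ++ Γ'.comma :: a.circuit.enc)

/-- An integer (sign and absolute value, in binary) and a natural number (in binary). -/
def encIntNat (z : ℤ × ℕ) : List Γ' :=
  Γ'.bit (decide (z.1 < 0)) :: (encNat z.1.natAbs ++ encNat z.2)

/-- The pair `(n, j)` with `n` in unary and `j` in binary. -/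
def encUnaryBinary (a : ℕ × ℕ) : List Γ' :=
  encBits (List.replicate a.1 true) ++ Γ'.comma :: encBits (encodeNat a.2)

/-! ### Polynomial space -/

/-- The space used by a configuration of a (multi-stack) Turing machine: the number of symbols
stored, input and output included. -/
def cfgSpace (tm : FinTM2) (c : tm.Cfg) : ℕ :=
  letI := tm.kFin
  ∑ k : tm.K, (Turing.TM2.Cfg.stk c k).length

/-- A deterministic Turing machine that, on every input, halts with the value of `f` as its output,
and whose configurations during the computation all use space at most polynomial in the length of
the input. Only finitely many symbols can ever be pushed, since the program and its set of internal
states are finite. -/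
structure TM2ComputableInPolySpace {α β αΓ βΓ : Type} (ea : α → List αΓ) (eb : β → List βΓ)
    (f : α → β) extends TM2Computable ea eb f where
  space : Polynomial ℕ
  space_le : ∀ (a : α) (c : tm.Cfg),
    StateTransition.Reaches tm.step (initList tm ((ea a).map inputAlphabet.invFun)) c →
      cfgSpace tm c ≤ space.eval (ea a).length

/-- The complex-valued function `f` can be computed exactly in polynomial space: some machine
working in polynomial space outputs, for every `a`, an integer `m` and a natural number `e` with
`f a = m / β ^ e`. -/
def ExactInPolySpace {α αΓ : Type} (β : ℝ) (ea : α → List αΓ) (f : α → ℂ) : Prop :=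
  ∃ g : α → ℤ × ℕ, Nonempty (TM2ComputableInPolySpace ea encIntNat g) ∧
    ∀ a, f a = ((((g a).1 : ℝ) / β ^ (g a).2 : ℝ) : ℂ)

open scoped Classical in
/-- The languages decided by a deterministic Turing machine in polynomial space. -/
def PSPACE : Set (Language Bool) :=
  {L | Nonempty (TM2ComputableInPolySpace (fun w : List Bool => w) encodeBool
    (fun w : List Bool => decide (w ∈ L)))}

/-! ### Bounded-error quantum polynomial time -/

/-- A family of circuits, one for each input length, of polynomial size, such that a Turing machine
running in polynomial time outputs, given `n` in unary and `j` in binary, the `j`-th gate of the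
`n`-th circuit with its wires (the empty string if there is no such gate). -/
def IsUniformPolySize (C : ∀ n : ℕ, QCircuit n) : Prop :=
  (∃ p : Polynomial ℕ, ∀ n, (C n).gates.length ≤ p.eval n) ∧
  Nonempty (TM2ComputableInPolyTime encUnaryBinary (fun s : List Γ' => s)
    (fun a : ℕ × ℕ => ((C a.1).gates[a.2]?).elim [] QGate.enc))

/-- The languages decided with error probability at most `1/3` on every input by a uniform family
of polynomial-size quantum circuits, the answer being read off from the first qubit. -/
def BQP : Set (Language Bool) :=
  {L | ∃ C : ∀ n : ℕ, QCircuit n, IsUniformPolySize C ∧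
    ∀ w : List Bool,
      (w ∈ L → 2 / 3 ≤ (C w.length).acceptProb w.get) ∧
      (w ∉ L → (C w.length).acceptProb w.get ≤ 1 / 3)}

/-! An amplitude is an entry of the product of the gate matrices, and writing out the matrix
multiplication gives the sum over paths (`sum_paths`). Few paths matter: at a given basis state the
column of a Toffoli gate has one nonzero entry, that of a Hadamard gate has two, which are ±1/√2
(`sum_mul_toffoli`, `sum_mul_had`). With h Hadamard gates the relevant paths are indexed by h bits,
the new values of the qubits acted on, and each contributes ±1/√2^h, or 0 if it ends in the wrong
state. So the amplitude is an integer divided by √2^h (`pathRec_eq`). The integer is found by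
letting a binary counter run up to 2^h and following one path per value: exponential time, but only
one path, the counter and the partial sum are in memory.

The gates are real and symmetric. Hence, with U the circuit, P the projection to the value 1 of the
first qubit and b the start state, the acceptance probability is ⟨b|Uᵀ P U|b⟩. This is again one sum
over paths, for the list consisting of the gates, the projection and the gates in reverse order; its
denominator is √2^(2h) = 2^h (`acceptProb_eq_pathCount`). For a uniform family the gate list is
produced first, by running the generating machine for j = 0, 1, … as a subroutine; its polynomial
time bounds its space (`ps_of_polyTime`, `ps_wireLists`). A language in BQP is decided by comparing
the exact probability with 1/2.

Most of the work concerns the machine model. Structured stack programs with a semantics `Run` that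
records the space are compiled to `TM2` machines (`Run.boundedReach`,
`nonempty_tm2ComputableInPolySpace`). All values are binary trees, serialized on stack `A`. A
function is in `PS` if some program turns the tree of the argument into the tree of the value in
polynomial space and leaves the contents of stack `B` as they were, so that `B` serves as a call
stack. The class is closed under composition, pairing, case distinction, and loops of any length
whose intermediate values stay small (`PS.loop`). Folds, binary arithmetic and exponentially long
sums (`PS.sum`) follow, and membership of the actual algorithm is then mostly a matter of
`fun_prop`. -/

/-! ### Structured programs over finitely many stacks -/

namespace StackProg

/-- Structured programs operating on stacks. `pop k f` pops a symbol and continues with the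
program that `f` assigns to it; `loop k exits f` repeatedly pops a symbol `o` and runs `f o`, until
`exits o`. -/
inductive Cmd {K : Type} (Γ : K → Type) : Type
  | skip : Cmd Γ
  | push (k : K) (s : Γ k) : Cmd Γ
  | seq (c d : Cmd Γ) : Cmd Γ
  | pop (k : K) (f : Option (Γ k) → Cmd Γ) : Cmd Γ
  | loop (k : K) (exits : Option (Γ k) → Bool) (f : Option (Γ k) → Cmd Γ) : Cmd Γ

infixr:60 " ;; " => Cmd.seq

variable {K : Type} {Γ : K → Type}

/-- The total number of symbols on the stacks. -/
def size [Fintype K] (S : ∀ k, List (Γ k)) : ℕ := ∑ k, (S k).length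

/-- `Run c S S' B`: the program `c` leads from the stacks `S` to the stacks `S'`, and on the way
there are never more than `B` symbols on the stacks. -/
inductive Run [Fintype K] [DecidableEq K] :
    Cmd Γ → (∀ k, List (Γ k)) → (∀ k, List (Γ k)) → ℕ → Prop
  | skip {S B} : size S ≤ B → Run .skip S S B
  | push {k s S B} : size S + 1 ≤ B → Run (.push k s) S (Function.update S k (s :: S k)) B
  | seq {c d S S' S'' B} : Run c S S' B → Run d S' S'' B → Run (.seq c d) S S'' B
  | pop {k f S S' B} : size S ≤ B →
      Run (f (S k).head?) (Function.update S k (S k).tail) S' B → Run (.pop k f) S S' B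
  | loop_exit {k exits f S B} : exits (S k).head? = true → size S ≤ B →
      Run (.loop k exits f) S (Function.update S k (S k).tail) B
  | loop_step {k exits f S S' S'' B} : exits (S k).head? = false → size S ≤ B →
      Run (f (S k).head?) (Function.update S k (S k).tail) S' B →
      Run (.loop k exits f) S' S'' B → Run (.loop k exits f) S S'' B

theorem size_update [Fintype K] [DecidableEq K] (S : ∀ k, List (Γ k)) (k : K) (l : List (Γ k)) :
    size (Function.update S k l) + (S k).length = size S + l.length := by
  unfold size
  rw [← Finset.add_sum_erase _ _ (Finset.mem_univ k),
    ← Finset.add_sum_erase (a := k) _ (fun k => (S k).length) (Finset.mem_univ k)]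
  have : ∑ x ∈ Finset.univ.erase k, (Function.update S k l x).length =
      ∑ x ∈ Finset.univ.erase k, (S x).length :=
    Finset.sum_congr rfl fun x hx => by
      rw [Function.update_of_ne (Finset.ne_of_mem_erase hx)]
  rw [this, Function.update_self]
  omega

theorem size_update_tail [Fintype K] [DecidableEq K] (S : ∀ k, List (Γ k)) (k : K) :
    size (Function.update S k (S k).tail) ≤ size S := by
  have := size_update S k (S k).tail
  simp only [List.length_tail] at this
  omega

/-- Both ends of a run lie within its bound. Output sizes are obtained from this: a program that
fits into polynomial space cannot have a longer result. -/
theorem Run.size_le [Fintype K] [DecidableEq K] {c : Cmd Γ} {S S' : ∀ k, List (Γ k)} {B : ℕ}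
    (h : Run c S S' B) : size S ≤ B ∧ size S' ≤ B := by
  induction h with
  | skip h => exact ⟨h, h⟩
  | @push k s S B h =>
    have := size_update S k (s :: S k)
    simp only [List.length_cons] at this
    constructor <;> omega
  | seq _ _ h₁ h₂ => exact ⟨h₁.1, h₂.2⟩
  | pop h _ h' => exact ⟨h, h'.2⟩
  | @loop_exit k exits f S B _ h => exact ⟨h, (size_update_tail S k).trans h⟩
  | loop_step _ h _ _ _ h' => exact ⟨h, h'.2⟩

theorem Run.mono [Fintype K] [DecidableEq K] {c : Cmd Γ} {S S' : ∀ k, List (Γ k)} {B B' : ℕ}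
    (h : Run c S S' B) (hB : B ≤ B') : Run c S S' B' := by
  induction h with
  | skip h => exact .skip (h.trans hB)
  | push h => exact .push (h.trans hB)
  | seq _ _ h₁ h₂ => exact .seq (h₁ hB) (h₂ hB)
  | pop h _ h' => exact .pop (h.trans hB) (h' hB)
  | loop_exit h₁ h => exact .loop_exit h₁ (h.trans hB)
  | loop_step h₁ h _ _ h₂ h₃ => exact .loop_step h₁ (h.trans hB) (h₂ hB) (h₃ hB)

/-! ### Compilation to `TM2` machines -/

/-- The labels of a program. -/
def Lab : Cmd Γ → Type
  | .skip => Unit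
  | .push _ _ => Unit
  | .seq c d => Lab c ⊕ Lab d
  | .pop _ f => Option (Σ o, Lab (f o))
  | .loop _ _ f => Option (Σ o, Lab (f o))

theorem Lab.finite [∀ k, Finite (Γ k)] : ∀ c : Cmd Γ, Finite (Lab c)
  | .skip => inferInstanceAs (Finite Unit)
  | .push _ _ => inferInstanceAs (Finite Unit)
  | .seq c d =>
    haveI := Lab.finite c
    haveI := Lab.finite d
    inferInstanceAs (Finite (Lab c ⊕ Lab d))
  | .pop _ f =>
    haveI := fun o => Lab.finite (f o)
    inferInstanceAs (Finite (Option (Σ o, Lab (f o))))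
  | .loop _ _ f =>
    haveI := fun o => Lab.finite (f o)
    inferInstanceAs (Finite (Option (Σ o, Lab (f o))))

/-- The label at which a program starts. -/
def entry : (c : Cmd Γ) → Lab c
  | .skip => ()
  | .push _ _ => ()
  | .seq c _ => Sum.inl (entry c)
  | .pop _ _ => (none : Option _)
  | .loop _ _ _ => (none : Option _)

/-- The internal states of the compiled machine: the symbol popped last. -/
abbrev Var (Γ : K → Type) : Type := Option (Σ k, Option (Γ k))

/-- The symbol popped from stack `k`. -/
def Var.get [DecidableEq K] (k : K) : Var Γ → Option (Γ k)
  | none => none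
  | some ⟨k', o⟩ => if h : k' = k then h ▸ o else none

@[simp] theorem Var.get_some [DecidableEq K] (k : K) (o : Option (Γ k)) :
    Var.get k (some ⟨k, o⟩) = o := by
  simp [Var.get]

/-- The code of a program, embedded by `emb` into the labels of a machine, that jumps to `exit`
when it has finished. -/
def code [DecidableEq K] {Λ : Type} : (c : Cmd Γ) → (emb : Lab c → Λ) → (exit : Λ) → Lab c →
    TM2.Stmt Γ Λ (Var Γ)
  | .skip, _, exit, _ => .goto fun _ => exit
  | .push k s, _, exit, _ => .push k (fun _ => s) (.goto fun _ => exit)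
  | .seq c d, emb, _, Sum.inl l =>
    code c (fun l => emb (Sum.inl l)) (emb (Sum.inr (entry d))) l
  | .seq _ d, emb, exit, Sum.inr l => code d (fun l => emb (Sum.inr l)) exit l
  | .pop k _, emb, _, none =>
    .pop k (fun _ o => some ⟨k, o⟩) (.goto fun v => emb (some ⟨v.get k, entry _⟩))
  | .pop _ _, emb, exit, some ⟨o, l⟩ => code _ (fun l => emb (some ⟨o, l⟩)) exit l
  | .loop k exits _, emb, exit, none =>
    .pop k (fun _ o => some ⟨k, o⟩) (.goto fun v =>
      if exits (v.get k) then exit else emb (some ⟨v.get k, entry _⟩))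
  | .loop _ _ _, emb, _, some ⟨o, l⟩ => code _ (fun l => emb (some ⟨o, l⟩)) (emb none) l

/-- A computation of a machine from one configuration to another during which, up to the last
step, there are never more than `B` symbols on the stacks. -/
def BoundedReach [Fintype K] [DecidableEq K] {Λ σ : Type} (m : Λ → TM2.Stmt Γ Λ σ) (B : ℕ) :
    TM2.Cfg Γ Λ σ → TM2.Cfg Γ Λ σ → Prop :=
  Relation.ReflTransGen fun a b => b ∈ TM2.step m a ∧ size a.stk ≤ B

/-- Induction on the run. The embedding of the labels and the exit are arbitrary, so that the
statement applies to parts of a program: the first half of a sequence exits to the entry of the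
second, a loop body exits to the head `none` of its loop. The internal state at the end does not
matter, since it is inspected only right after a pop. -/
theorem Run.boundedReach [Fintype K] [DecidableEq K] {Λ : Type} {m : Λ → TM2.Stmt Γ Λ (Var Γ)}
    {c : Cmd Γ} {S S' : ∀ k, List (Γ k)} {B : ℕ} (h : Run c S S' B) (emb : Lab c → Λ) (exit : Λ)
    (hm : ∀ l, m (emb l) = code c emb exit l) (v : Var Γ) :
    ∃ v', BoundedReach m B ⟨some (emb (entry c)), v, S⟩ ⟨some exit, v', S'⟩ := by
  induction h generalizing exit v with
  | skip h =>
    exact ⟨v, .single ⟨by have := hm (); simp_all [entry, code], h⟩⟩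
  | push h =>
    exact ⟨v, .single ⟨by have := hm (); simp_all [entry, code], (Nat.le_succ _).trans h⟩⟩
  | @seq c d _ _ _ _ _ _ h₁ h₂ =>
    obtain ⟨v₁, h₁⟩ := h₁ (fun l => emb (Sum.inl l)) (emb (Sum.inr (entry d)))
      (fun l => hm (Sum.inl l)) v
    obtain ⟨v₂, h₂⟩ := h₂ (fun l => emb (Sum.inr l)) exit (fun l => hm (Sum.inr l)) v₁
    exact ⟨v₂, h₁.trans h₂⟩
  | @pop k f S _ _ h _ h' =>
    have hm' := hm none
    obtain ⟨v', h'⟩ := h' (fun l => emb (some ⟨_, l⟩)) exit (fun l => hm (some ⟨_, l⟩))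
      (some ⟨k, (S k).head?⟩)
    exact ⟨v', .head ⟨by simp [hm', entry, code]; rw [Var.get_some], h⟩ h'⟩
  | @loop_exit k exits f S B hs h =>
    have hm' := hm none
    exact ⟨some ⟨k, (S k).head?⟩, .single ⟨by simp [hm', entry, code, hs], h⟩⟩
  | @loop_step k exits f S _ _ _ hs h _ _ h₁ h₂ =>
    obtain ⟨v₁, h₁⟩ := h₁ (fun l => emb (some ⟨_, l⟩)) (emb none) (fun l => hm (some ⟨_, l⟩))
      (some ⟨k, (S k).head?⟩)
    obtain ⟨v₂, h₂⟩ := h₂ emb exit hm v₁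
    have hm' := hm none
    exact ⟨v₂, .head ⟨by simp [hm', entry, code, hs]; rw [Var.get_some], h⟩ (h₁.trans h₂)⟩

/-- The machine is deterministic, so whatever it reaches from `a` lies on the bounded computation
from `a` to the halting configuration `b`. -/
theorem BoundedReach.size_le [Fintype K] [DecidableEq K] {Λ σ : Type}
    {m : Λ → TM2.Stmt Γ Λ σ} {B : ℕ} {a b c : TM2.Cfg Γ Λ σ} (h : BoundedReach m B a b)
    (hb : TM2.step m b = none) (hB : size b.stk ≤ B)
    (hc : StateTransition.Reaches (TM2.step m) a c) : size c.stk ≤ B := by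
  induction h using Relation.ReflTransGen.head_induction_on with
  | refl =>
    rcases hc.cases_head with rfl | ⟨d, hd, -⟩
    · exact hB
    · rw [hb] at hd; cases hd
  | @head a a' haa' _ ih =>
    rcases hc.cases_head with rfl | ⟨d, hd, hdc⟩
    · exact haa'.2
    · exact ih (by rwa [Option.mem_unique haa'.1 hd])

theorem evalsTo_of_reaches {α : Type} {f : α → Option α} {a b : α}
    (h : StateTransition.Reaches f a b) : Nonempty (StateTransition.EvalsTo f a (some b)) := by
  induction h using Relation.ReflTransGen.head_induction_on with
  | refl => exact ⟨.refl _ _⟩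
  | @head a a' haa' _ ih =>
    obtain ⟨n, hn⟩ := ih
    refine ⟨⟨n + 1, ?_⟩⟩
    rw [Function.iterate_succ_apply, ← hn]
    exact congrArg _ haa'

/-- The code of the machine that runs a program and then halts. -/
def machineCode [DecidableEq K] (c : Cmd Γ) : Option (Lab c) → TM2.Stmt Γ (Option (Lab c)) (Var Γ)
  -- `haltList` demands the initial internal state, so the symbol popped last is forgotten before
  -- halting.
  | none => .load (fun _ => none) .halt
  | some l => code c some none l

/-- The `TM2` machine that runs a program and then halts. -/
noncomputable def Cmd.machine [Fintype K] [DecidableEq K] [∀ k, Fintype (Γ k)] (c : Cmd Γ)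
    (k₀ k₁ : K) : FinTM2 where
  K := K
  k₀ := k₀
  k₁ := k₁
  Γ := Γ
  Λ := Option (Lab c)
  main := some (entry c)
  ΛFin := haveI := Lab.finite c; Fintype.ofFinite _
  σ := Var Γ
  initialState := none
  m := machineCode c

theorem Run.machine_reach [Fintype K] [DecidableEq K] {c : Cmd Γ} {S S' : ∀ k, List (Γ k)} {B : ℕ}
    (h : Run c S S' B) :
    BoundedReach (machineCode c) B ⟨some (some (entry c)), none, S⟩ ⟨none, none, S'⟩ := by
  obtain ⟨v, hv⟩ := h.boundedReach (m := machineCode c) some none (fun l => rfl) none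
  exact hv.tail ⟨rfl, h.size_le.2⟩

/-- `initList` and `haltList` place their word by a cast along `k = k₀`; this brings them into the
form used for runs. -/
theorem dite_eq_update [DecidableEq K] (k₀ : K) (s : List (Γ k₀)) :
    (fun k => if h : k = k₀ then (by rw [h]; exact s) else []) =
      Function.update (fun k => ([] : List (Γ k))) k₀ s := by
  funext k
  by_cases hk : k = k₀
  · subst hk; simp
  · simp [hk]

/-- A function is computable in polynomial space if a stack program computes it whose runs do not
need more than polynomially many symbols on the stacks. -/
theorem nonempty_tm2ComputableInPolySpace [Fintype K] [DecidableEq K] [∀ k, Fintype (Γ k)]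
    {α β αΓ βΓ : Type} (ea : α → List αΓ) (eb : β → List βΓ) (f : α → β) (c : Cmd Γ) (k₀ k₁ : K)
    (e₀ : Γ k₀ ≃ αΓ) (e₁ : Γ k₁ ≃ βΓ) (p : Polynomial ℕ)
    (h : ∀ a, Run c (Function.update (fun _ => []) k₀ ((ea a).map e₀.symm))
      (Function.update (fun _ => []) k₁ ((eb (f a)).map e₁.symm)) (p.eval (ea a).length)) :
    Nonempty (TM2ComputableInPolySpace ea eb f) := by
  have hi : ∀ a, initList (c.machine k₀ k₁) ((ea a).map e₀.symm) =
      TM2.Cfg.mk (some (some (entry c))) none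
        (Function.update (fun _ => []) k₀ ((ea a).map e₀.symm)) := fun a =>
    congrArg (TM2.Cfg.mk (Γ := Γ) (σ := Var Γ) (some (some (entry c))) none)
      (dite_eq_update k₀ ((ea a).map e₀.symm))
  have ho : ∀ a, haltList (c.machine k₀ k₁) ((eb (f a)).map e₁.symm) =
      TM2.Cfg.mk none none
        (Function.update (fun _ => []) k₁ ((eb (f a)).map e₁.symm)) := fun a =>
    congrArg (TM2.Cfg.mk (Γ := Γ) (Λ := Option (Lab c)) (σ := Var Γ) none none)
      (dite_eq_update k₁ ((eb (f a)).map e₁.symm))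
  have hout : ∀ a, Nonempty (TM2Outputs (c.machine k₀ k₁) ((ea a).map e₀.symm)
      (some ((eb (f a)).map e₁.symm))) := by
    intro a
    unfold TM2Outputs
    rw [hi, Option.map_some, ho]
    exact evalsTo_of_reaches (Relation.ReflTransGen.mono (fun _ _ h => h.1) _ _ (h a).machine_reach)
  refine ⟨{ tm := c.machine k₀ k₁, inputAlphabet := e₀, outputAlphabet := e₁,
            outputsFun := fun a => Classical.choice (hout a), space := p, space_le := ?_ }⟩
  intro a d hd
  have hd' : StateTransition.Reaches (TM2.step (machineCode c))
      (initList (c.machine k₀ k₁) ((ea a).map e₀.symm)) d := hd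
  rw [hi] at hd'
  exact (h a).machine_reach.size_le rfl (h a).size_le.2 hd'

end StackProg

namespace StackProg

/-! ### Binary trees on stacks -/

/-- Binary trees, the universal data type. -/
inductive Tr : Type
  | nil : Tr
  | node (l r : Tr) : Tr

/-- The symbols on the working stacks. -/
inductive Symb : Type
  | nil
  | node
  | mark
  deriving DecidableEq

instance Symb.fintype : Fintype Symb :=
  ⟨{.nil, .node, .mark}, fun x => by cases x <;> decide⟩

/-- The prefix code of a tree. -/
def Tr.ser : Tr → List Symb
  | .nil => [Symb.nil]
  | .node l r => Symb.node :: (l.ser ++ r.ser)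

/-- This is what allows marks to separate several saved trees on one stack. -/
theorem Tr.mark_notMem_ser : ∀ t : Tr, Symb.mark ∉ t.ser
  | .nil => by simp [ser]
  | .node l r => by simp [ser, mark_notMem_ser l, mark_notMem_ser r]

theorem Tr.ser_length_pos (t : Tr) : 0 < t.ser.length := by
  cases t <;> simp [ser]

/-- The left subtree. -/
def Tr.left : Tr → Tr
  | .nil => .nil
  | .node l _ => l

/-- The right subtree. -/
def Tr.right : Tr → Tr
  | .nil => .nil
  | .node _ r => r

/-- Whether the tree is not just a leaf. -/
def Tr.isNode : Tr → Bool
  | .nil => false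
  | .node _ _ => true

/-- The four working stacks. -/
inductive Base : Type
  | A
  | B
  | C
  | D
  deriving DecidableEq

instance Base.fintype : Fintype Base :=
  ⟨{.A, .B, .C, .D}, fun x => by cases x <;> decide⟩

/-- The stacks: the working stacks, and further ones indexed by `X`. -/
inductive Stk (X : Type) : Type
  | base (i : Base) : Stk X
  | ext (x : X) : Stk X
  deriving DecidableEq, Fintype

variable {X : Type}

/-- The alphabets of the stacks. -/
@[reducible] def Alph (G : X → Type) : Stk X → Type
  | .base _ => Symb
  | .ext x => G x

instance Alph.fintype (G : X → Type) [∀ x, Fintype (G x)] : ∀ k, Fintype (Alph G k)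
  | .base _ => inferInstanceAs (Fintype Symb)
  | .ext x => inferInstanceAs (Fintype (G x))

/-- The contents of the working stacks. -/
def bs (a b c d : List Symb) : Base → List Symb
  | .A => a
  | .B => b
  | .C => c
  | .D => d

variable {G : X → Type}

/-- The contents of all stacks. -/
def mk (s : Base → List Symb) (e : ∀ x, List (G x)) : ∀ k, List (Alph G k)
  | .base i => s i
  | .ext x => e x

@[simp] theorem mk_base (s : Base → List Symb) (e : ∀ x, List (G x)) (i : Base) :
    mk s e (.base i) = s i := rfl

@[simp] theorem mk_ext (s : Base → List Symb) (e : ∀ x, List (G x)) (x : X) :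
    mk s e (.ext x) = e x := rfl

section

variable (a b c d l : List Symb)

@[simp] theorem bs_A : bs a b c d .A = a := rfl
@[simp] theorem bs_B : bs a b c d .B = b := rfl
@[simp] theorem bs_C : bs a b c d .C = c := rfl
@[simp] theorem bs_D : bs a b c d .D = d := rfl

@[simp] theorem update_bs_A : Function.update (bs a b c d) .A l = bs l b c d := by
  funext i; cases i <;> rfl
@[simp] theorem update_bs_B : Function.update (bs a b c d) .B l = bs a l c d := by
  funext i; cases i <;> rfl
@[simp] theorem update_bs_C : Function.update (bs a b c d) .C l = bs a b l d := by
  funext i; cases i <;> rfl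
@[simp] theorem update_bs_D : Function.update (bs a b c d) .D l = bs a b c l := by
  funext i; cases i <;> rfl

end

section

variable [DecidableEq X]

@[simp] theorem update_mk_base (s : Base → List Symb) (e : ∀ x, List (G x)) (i : Base)
    (l : List Symb) :
    Function.update (mk s e) (.base i) l = mk (Function.update s i l) e := by
  funext k
  cases k with
  | base j =>
    by_cases h : j = i
    · subst h; simp
    · rw [Function.update_of_ne (by simpa using h), mk_base, mk_base, Function.update_of_ne h]
  | ext x => rw [Function.update_of_ne (by simp)]; rfl

@[simp] theorem update_mk_ext (s : Base → List Symb) (e : ∀ x, List (G x)) (x : X)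
    (l : List (G x)) :
    Function.update (mk s e) (.ext x) l = mk s (Function.update e x l) := by
  funext k
  cases k with
  | base j => rw [Function.update_of_ne (by simp)]; rfl
  | ext y =>
    by_cases h : y = x
    · subst h; simp
    · rw [Function.update_of_ne (by simpa using h), mk_ext, mk_ext, Function.update_of_ne h]

end

variable [Fintype X]

@[simp] theorem size_mk (a b c d : List Symb) (e : ∀ x, List (G x)) :
    size (mk (bs a b c d) e) =
      a.length + b.length + c.length + d.length + ∑ x, (e x).length := by
  have h : ∀ f : Stk X → ℕ, ∑ k, f k = ∑ i : Base, f (.base i) + ∑ x, f (.ext x) := by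
    intro f
    refine Eq.trans (Fintype.sum_equiv ⟨Sum.elim Stk.base Stk.ext, fun k => match k with
      | .base i => .inl i
      | .ext x => .inr x, ?_, ?_⟩ (fun k => f (Sum.elim Stk.base Stk.ext k)) _
        fun _ => rfl).symm (Fintype.sum_sum_type _)
    · rintro (_ | _) <;> rfl
    · rintro (_ | _) <;> rfl
  have hB : (Finset.univ : Finset Base) = {.A, .B, .C, .D} := rfl
  rw [size, h, hB]
  simp [Nat.add_assoc]

/-! ### Moving symbols between stacks -/

/-- Move symbols from stack `i` to stack `j`, up to the end or to a mark, which is removed. -/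
def mv (G : X → Type) (i j : Base) : Cmd (Alph G) :=
  .loop (.base i) (fun o => o = none || o = some Symb.mark) fun o => o.elim .skip fun x => .push (Stk.base j) x

/-- Move symbols from stack `i` to stacks `j` and `k`. -/
def mv₂ (G : X → Type) (i j k : Base) : Cmd (Alph G) :=
  .loop (.base i) (fun o => o = none || o = some Symb.mark) fun o =>
    o.elim .skip fun x => .push (Stk.base j) x ;; .push (Stk.base k) x

/-- Remove all symbols from stack `i`. -/
def clear (G : X → Type) (i : Base) : Cmd (Alph G) :=
  .loop (.base i) (fun o => o = none) fun _ => .skip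

variable [DecidableEq X]

theorem run_push (i : Base) (x : Symb) {s : Base → List Symb} (e : ∀ x, List (G x)) {B : ℕ}
    (hB : size (mk s e) + 1 ≤ B) :
    Run (.push (.base i) x) (mk s e) (mk (Function.update s i (x :: s i)) e) B := by
  simpa using Run.push (k := (.base i : Stk X)) (s := x) (S := mk s e) hB

theorem run_pop (i : Base) {f : Option Symb → Cmd (Alph G)} {s : Base → List Symb}
    {e : ∀ x, List (G x)} {S' : ∀ k, List (Alph G k)} {B : ℕ} (hB : size (mk s e) ≤ B)
    (h : Run (f (s i).head?) (mk (Function.update s i (s i).tail) e) S' B) :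
    Run (.pop (.base i) f) (mk s e) S' B :=
  Run.pop hB (by simpa using h)

theorem run_loop_exit (i : Base) {exits : Option Symb → Bool} {f : Option Symb → Cmd (Alph G)}
    {s : Base → List Symb} {e : ∀ x, List (G x)} {B : ℕ} (hs : exits (s i).head? = true)
    (hB : size (mk s e) ≤ B) :
    Run (.loop (.base i) exits f) (mk s e) (mk (Function.update s i (s i).tail) e) B := by
  simpa using Run.loop_exit (k := (.base i : Stk X)) (f := f) (S := mk s e) hs hB

theorem run_loop_step (i : Base) {exits : Option Symb → Bool} {f : Option Symb → Cmd (Alph G)}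
    {s : Base → List Symb} {e : ∀ x, List (G x)} {S' S'' : ∀ k, List (Alph G k)} {B : ℕ}
    (hs : exits (s i).head? = false) (hB : size (mk s e) ≤ B)
    (h : Run (f (s i).head?) (mk (Function.update s i (s i).tail) e) S' B)
    (h' : Run (.loop (.base i) exits f) S' S'' B) :
    Run (.loop (.base i) exits f) (mk s e) S'' B :=
  Run.loop_step hs hB (by simpa using h) h'

/-- Each symbol is popped before it is pushed, so the initial size is already a bound. The word
arrives reversed. What follows it must be empty or begin with a mark, which is consumed. -/
theorem run_mv {i j : Base} (hij : i ≠ j) (w t : List Symb) (hw : Symb.mark ∉ w)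
    (ht : t.head? = none ∨ t.head? = some .mark) {s : Base → List Symb} (hs : s i = w ++ t)
    (e : ∀ x, List (G x)) {B : ℕ} (hB : size (mk s e) ≤ B) :
    Run (mv G i j) (mk s e)
      (mk (Function.update (Function.update s i t.tail) j (w.reverse ++ s j)) e) B := by
  unfold mv
  induction w generalizing s with
  | nil =>
    have h : Function.update (Function.update s i t.tail) j ([].reverse ++ s j) =
        Function.update s i (s i).tail := by
      rw [Function.update_eq_self_iff.2 (by simp [Function.update_of_ne hij.symm]), hs]
      rfl
    rw [h]
    exact run_loop_exit i (by simpa [hs] using ht) hB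
  | cons x w ih =>
    simp only [List.mem_cons, not_or] at hw
    have hsz := size_update (mk s e) (.base i) (w ++ t)
    simp only [update_mk_base, mk_base, hs, List.cons_append, List.length_cons] at hsz
    have hsz' := size_update (mk (Function.update s i (w ++ t)) e) (.base j) (x :: s j)
    simp only [update_mk_base, mk_base, Function.update_of_ne hij.symm, List.length_cons] at hsz'
    refine run_loop_step i (S' := mk (Function.update (Function.update s i (w ++ t)) j
      (x :: s j)) e) (by simpa [hs] using Ne.symm hw.1) hB ?_ ?_
    · have := run_push j x (s := Function.update s i (w ++ t)) e (B := B) (by omega)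
      simpa [hs, Function.update_of_ne hij.symm] using this
    · have := ih hw.2 (s := Function.update (Function.update s i (w ++ t)) j (x :: s j))
        (by rw [Function.update_of_ne hij, Function.update_self]) (by omega)
      have h : Function.update (Function.update (Function.update (Function.update s i (w ++ t)) j
          (x :: s j)) i t.tail) j (w.reverse ++ (x :: s j)) =
          Function.update (Function.update s i t.tail) j ((x :: w).reverse ++ s j) := by
        funext k
        by_cases hj : k = j
        · subst hj; simp
        · by_cases hi : k = i
          · subst hi; simp [Function.update_of_ne hij]
          · simp [Function.update_of_ne hi, Function.update_of_ne hj]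
      rwa [Function.update_self, h] at this

theorem run_clear {i : Base} {s : Base → List Symb} (e : ∀ x, List (G x)) {B : ℕ}
    (hB : size (mk s e) ≤ B) :
    Run (clear G i) (mk s e) (mk (Function.update s i []) e) B := by
  unfold clear
  generalize hw : s i = w
  induction w generalizing s with
  | nil => simpa [hw] using run_loop_exit i (by simp [hw]) hB
  | cons x w ih =>
    have hsz := size_update_tail (mk s e) (.base i)
    simp only [update_mk_base, mk_base, hw, List.tail_cons] at hsz
    refine run_loop_step i (S' := mk (Function.update s i w) e) (by simp [hw]) hB ?_ ?_
    · simpa [hw] using Run.skip (S := mk (Function.update s i w) e) (B := B) (by omega)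
    · simpa using ih (s := Function.update s i w) (by omega) (by simp)

theorem run_mv₂_CAB (w a b : List Symb) (hw : Symb.mark ∉ w) (d : List Symb)
    (e : ∀ x, List (G x)) {B : ℕ} (hB : size (mk (bs a b w d) e) + w.length ≤ B) :
    Run (mv₂ G .C .A .B) (mk (bs a b w d) e)
      (mk (bs (w.reverse ++ a) (w.reverse ++ b) [] d) e) B := by
  unfold mv₂
  induction w generalizing a b with
  | nil => simpa using run_loop_exit .C (s := bs a b [] d) (by simp) (by omega)
  | cons x w ih =>
    simp only [List.mem_cons, not_or] at hw
    simp only [size_mk, List.length_cons] at hB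
    refine run_loop_step .C (S' := mk (bs (x :: a) (x :: b) w d) e)
      (by simpa using Ne.symm hw.1) (by simp; omega) ?_ ?_
    · have h₁ := run_push .A x (s := bs a b w d) e (B := B) (by simp; omega)
      have h₂ := run_push .B x (s := bs (x :: a) b w d) e (B := B) (by simp; omega)
      simp only [update_bs_A, update_bs_B, bs_A, bs_B] at h₁ h₂
      simpa using h₁.seq h₂
    · simpa using ih (x :: a) (x :: b) hw.2 (by simp; omega)

/-- Put a copy of stack `A` onto stack `B`, below a mark. -/
def save (G : X → Type) : Cmd (Alph G) :=
  mv G .A .C ;; .push (.base .B) .mark ;; mv₂ G .C .A .B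

/-- The detour through `C` reverses the word, and copying it to `A` and `B` reverses it again. The
two copies and the mark account for the bound. -/
theorem run_save (w b : List Symb) (hw : Symb.mark ∉ w) (e : ∀ x, List (G x)) {B : ℕ}
    (hB : 2 * w.length + b.length + ∑ x, (e x).length + 1 ≤ B) :
    Run (save G) (mk (bs w b [] []) e) (mk (bs w (w ++ .mark :: b) [] []) e) B := by
  have h₁ := run_mv (j := .C) (i := .A) (by decide) w [] hw (.inl rfl)
    (s := bs w b [] []) (by simp) e (B := B) (by simp; omega)
  have h₂ := run_push .B .mark (s := bs [] b w.reverse []) e (B := B) (by simp; omega)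
  have h₃ := run_mv₂_CAB w.reverse [] (.mark :: b) (by simpa using hw) [] e (B := B)
    (by simp; omega)
  simp only [bs_B, bs_C, List.tail_nil, update_bs_A, update_bs_B, update_bs_C,
    List.append_nil, List.reverse_reverse] at h₁ h₂ h₃
  exact h₁.seq (h₂.seq h₃)

/-- Move the topmost entry of stack `B` to stack `A`. -/
def restore (G : X → Type) : Cmd (Alph G) := mv G .B .D ;; mv G .D .A

theorem run_restore (w a b c : List Symb) (hw : Symb.mark ∉ w) (e : ∀ x, List (G x)) {B : ℕ}
    (hB : a.length + w.length + b.length + c.length + ∑ x, (e x).length + 1 ≤ B) :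
    Run (restore G) (mk (bs a (w ++ .mark :: b) c []) e) (mk (bs (w ++ a) b c []) e) B := by
  have h₁ := run_mv (j := .D) (i := .B) (by decide) w (.mark :: b) hw (.inr rfl)
    (s := bs a (w ++ .mark :: b) c []) (by simp) e (B := B) (by simp; omega)
  have h₂ := run_mv (j := .A) (i := .D) (by decide) w.reverse [] (by simpa using hw) (.inl rfl)
    (s := bs a b c w.reverse) (by simp) e (B := B) (by simp; omega)
  simp only [bs_A, bs_D, List.tail_nil, List.tail_cons, update_bs_A, update_bs_B, update_bs_D,
    List.append_nil, List.reverse_reverse] at h₁ h₂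
  exact h₁.seq h₂

/-- Exchange stack `A` with the topmost entry of stack `B`. -/
def swap (G : X → Type) : Cmd (Alph G) :=
  mv G .A .C ;; restore G ;; .push (.base .B) .mark ;; mv G .C .B

theorem run_swap (w v b : List Symb) (hw : Symb.mark ∉ w) (hv : Symb.mark ∉ v)
    (e : ∀ x, List (G x)) {B : ℕ}
    (hB : v.length + w.length + b.length + ∑ x, (e x).length + 1 ≤ B) :
    Run (swap G) (mk (bs v (w ++ .mark :: b) [] []) e)
      (mk (bs w (v ++ .mark :: b) [] []) e) B := by
  have h₁ := run_mv (j := .C) (i := .A) (by decide) v [] hv (.inl rfl)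
    (s := bs v (w ++ .mark :: b) [] []) (by simp) e (B := B) (by simp; omega)
  have h₂ := run_restore w [] b v.reverse hw e (B := B) (by simp; omega)
  have h₃ := run_push .B .mark (s := bs w b v.reverse []) e (B := B) (by simp; omega)
  have h₄ := run_mv (j := .B) (i := .C) (by decide) v.reverse [] (by simpa using hv) (.inl rfl)
    (s := bs w (.mark :: b) v.reverse []) (by simp) e (B := B) (by simp; omega)
  simp only [bs_B, bs_C, List.tail_nil, update_bs_A, update_bs_B, update_bs_C,
    List.append_nil, List.reverse_reverse] at h₁ h₂ h₃ h₄
  exact h₁.seq (h₂.seq (h₃.seq h₄))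

/-! ### Splitting off a serialized tree -/

/-- Move as many trees from stack `A` to stack `D` as there are symbols on stack `C`. -/
def parse (G : X → Type) : Cmd (Alph G) :=
  .loop (.base .C) (fun o => o = none) fun _ => .pop (.base .A) fun o =>
    if o = some Symb.node then
      .push (.base .D) .node ;; .push (.base .C) .mark ;; .push (.base .C) .mark
    else .push (.base .D) .nil

/-- Stack `C` holds one mark for each tree still to be read: a node uses up one mark and adds two,
for its subtrees. The claim has continuation form, starting from what remains of the loop after the
tree, so that the induction can chain the two subtrees. -/
theorem run_parse_tree (t : Tr) (a b c d : List Symb) (e : ∀ x, List (G x)) {B : ℕ}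
    (hB : 2 * t.ser.length + a.length + b.length + c.length + d.length + ∑ x, (e x).length ≤ B)
    {S' : ∀ k, List (Alph G k)}
    (h : Run (parse G) (mk (bs a b c (t.ser.reverse ++ d)) e) S' B) :
    Run (parse G) (mk (bs (t.ser ++ a) b (.mark :: c) d) e) S' B := by
  unfold parse at h ⊢
  induction t generalizing a c d with
  | nil =>
    simp only [Tr.ser, List.length_cons, List.length_nil, List.reverse_cons, List.reverse_nil,
      List.nil_append, List.cons_append] at hB h ⊢
    refine run_loop_step .C (by simp) (by simp; omega) ?_ h
    simp only [bs_C, List.tail_cons, update_bs_C]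
    refine run_pop .A (by simp; omega) ?_
    simpa using run_push .D .nil (s := bs a b c d) e (B := B) (by simp; omega)
  | node l r hl hr =>
    simp only [Tr.ser, List.length_cons, List.length_append, List.reverse_cons,
      List.reverse_append, List.append_assoc, List.cons_append, List.nil_append] at hB h ⊢
    have := l.ser_length_pos
    refine run_loop_step .C (S' := mk (bs (l.ser ++ (r.ser ++ a)) b (.mark :: .mark :: c)
      (.node :: d)) e) (by simp) (by simp; omega) ?_ ?_
    · simp only [bs_C, List.tail_cons, update_bs_C]
      refine run_pop .A (by simp; omega) ?_
      have h₁ := run_push .D .node (s := bs (l.ser ++ (r.ser ++ a)) b c d) e (B := B)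
        (by simp; omega)
      have h₂ := run_push .C .mark (s := bs (l.ser ++ (r.ser ++ a)) b c (.node :: d)) e (B := B)
        (by simp; omega)
      have h₃ := run_push .C .mark (s := bs (l.ser ++ (r.ser ++ a)) b (.mark :: c) (.node :: d))
        e (B := B) (by simp; omega)
      simp only [bs_C, bs_D, update_bs_C, update_bs_D] at h₁ h₂ h₃
      simpa using h₁.seq (h₂.seq h₃)
    · refine hl _ _ _ (by simp; omega) (hr _ _ _ (by simp; omega) h)

theorem run_parse (t : Tr) (a b : List Symb) (e : ∀ x, List (G x)) {B : ℕ}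
    (hB : 2 * t.ser.length + a.length + b.length + ∑ x, (e x).length ≤ B) :
    Run (parse G) (mk (bs (t.ser ++ a) b [.mark] []) e)
      (mk (bs a b [] t.ser.reverse) e) B := by
  refine run_parse_tree t a b [] [] e (by simpa using hB) ?_
  unfold parse
  simpa using run_loop_exit .C (s := bs a b [] t.ser.reverse) (by simp) (by simp; omega)

end StackProg

namespace StackProg

/-! ### Functions computable by stack programs in polynomial space -/

/-- Types whose elements are represented by binary trees. -/
class Data (α : Type) where
  enc : α → Tr

export Data (enc)

/-- Finitely many stacks in addition to the working stacks, with their alphabets. -/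
structure Ext where
  X : Type
  [dec : DecidableEq X]
  [fin : Fintype X]
  G : X → Type

attribute [instance] Ext.dec Ext.fin

/-- The size of the representation. -/
def sz {α : Type} [Data α] (a : α) : ℕ := (enc a).ser.length

variable {X : Type} [DecidableEq X] [Fintype X] {G : X → Type} {E : Ext}

/-- The stacks when the only data are the tree `t` and the saved data `b`. -/
def st (G : X → Type) (t : Tr) (b : List Symb) : ∀ k, List (Alph G k) :=
  mk (bs t.ser b [] []) fun _ => []

/-- The functions computable by stack programs in polynomial space. -/
@[fun_prop]
def PS (E : Ext) {α β : Type} [Data α] [Data β] (f : α → β) : Prop :=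
  ∃ (c : Cmd (Alph E.G)) (p : Polynomial ℕ), ∀ a b,
    Run c (st E.G (enc a) b) (st E.G (enc (f a)) b) (p.eval (sz a) + b.length)

theorem eval_mono (p : Polynomial ℕ) {m n : ℕ} (h : m ≤ n) : p.eval m ≤ p.eval n := by
  induction p using Polynomial.induction_on' with
  | add p q hp hq => simpa using Nat.add_le_add hp hq
  | monomial k a => simpa using Nat.mul_le_mul_left a (Nat.pow_le_pow_left h k)

variable {α β γ δ : Type} [Data α] [Data β] [Data γ] [Data δ]

theorem sz_pos (a : α) : 0 < sz a := Tr.ser_length_pos _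

omit [DecidableEq X] in
theorem size_st (t : Tr) (b : List Symb) : size (st G t b) = t.ser.length + b.length := by
  simp [st]

theorem PS.size_le {f : α → β} (hf : PS E f) : ∃ p : Polynomial ℕ, ∀ a, sz (f a) ≤ p.eval (sz a) := by
  obtain ⟨c, p, h⟩ := hf
  refine ⟨p, fun a => ?_⟩
  have := (h a []).size_le.2
  rw [size_st] at this
  simpa [sz] using this

theorem PS.of_enc_eq {f : α → β} (h : ∀ a, enc (f a) = enc a) : PS E f := by
  refine ⟨.skip, Polynomial.X, fun a b => ?_⟩
  rw [h]
  exact .skip (by simp [size_st, sz])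

/-- Values matter only through their trees. Operations on structured types thereby reduce to
operations on trees, such as `Tr.left` for the first projection. -/
theorem PS.congr {f : α → β} {g : α → γ} (hf : PS E f) (h : ∀ a, enc (f a) = enc (g a)) :
    PS E g := by
  obtain ⟨c, p, hc⟩ := hf
  exact ⟨c, p, fun a b => h a ▸ hc a b⟩

@[fun_prop]
theorem PS.id : PS E (fun a : α => a) := .of_enc_eq fun _ => rfl

-- The intermediate value has polynomial size, so the bound for `g` is composed with the size bound
-- for `f`.
@[fun_prop]
theorem PS.comp {g : β → γ} {f : α → β} (hg : PS E g) (hf : PS E f) : PS E (fun a => g (f a)) := by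
  obtain ⟨q, hq⟩ := hf.size_le
  obtain ⟨c, p, hc⟩ := hf
  obtain ⟨d, r, hd⟩ := hg
  refine ⟨c ;; d, p + r.comp q, fun a b => .seq ((hc a b).mono ?_) ((hd (f a) b).mono ?_)⟩
  · simp
  · simp only [Polynomial.eval_add, Polynomial.eval_comp]
    have := eval_mono r (hq a)
    omega

/-- Push a word onto stack `A`. -/
def pushAll (G : X → Type) : List Symb → Cmd (Alph G)
  | [] => .skip
  | s :: w => pushAll G w ;; .push (.base .A) s

theorem run_pushAll (w a b c d : List Symb) (e : ∀ x, List (G x)) {B : ℕ}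
    (hB : w.length + a.length + b.length + c.length + d.length + ∑ x, (e x).length ≤ B) :
    Run (pushAll G w) (mk (bs a b c d) e) (mk (bs (w ++ a) b c d) e) B := by
  induction w with
  | nil => exact .skip (by simpa using hB)
  | cons s w ih =>
    simp only [List.length_cons] at hB
    refine (ih (by omega)).seq ?_
    simpa using run_push .A s (s := bs (w ++ a) b c d) e (B := B) (by simp; omega)

@[fun_prop]
theorem PS.const (y : β) : PS E (fun _ : α => y) := by
  refine ⟨clear E.G .A ;; pushAll E.G (enc y).ser, Polynomial.X + Polynomial.C (sz y), fun a b => ?_⟩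
  have h₁ := run_clear (G := E.G) (i := .A) (s := bs (enc a).ser b [] []) (fun _ => [])
    (B := sz a + sz y + b.length) (by simp [sz])
  have h₂ := run_pushAll (G := E.G) (enc y).ser [] b [] [] (fun _ => [])
    (B := sz a + sz y + b.length) (by simp [sz])
  rw [update_bs_A] at h₁
  rw [List.append_nil] at h₂
  simpa [st, sz, add_assoc, add_comm, add_left_comm] using h₁.seq h₂

/-- The program for pairs of functions. -/
def pairCmd (c d : Cmd (Alph G)) : Cmd (Alph G) :=
  save G ;; c ;; swap G ;; d ;; restore G ;; .push (.base .A) .node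

instance Tr.data : Data Tr := ⟨fun t => t⟩

/-- The argument is kept on `B` while `f` is computed; then argument and result change places, and
`g` is computed. This is why `PS` quantifies over the contents of `B`: both subprograms run above a
saved word. -/
theorem PS.node {f g : α → Tr} (hf : PS E f) (hg : PS E g) :
    PS E (fun a => Tr.node (f a) (g a)) := by
  obtain ⟨p, hp⟩ := hf.size_le
  obtain ⟨q, hq⟩ := hg.size_le
  obtain ⟨c, p', hc⟩ := hf
  obtain ⟨d, q', hd⟩ := hg
  refine ⟨pairCmd c d, 2 * Polynomial.X + p + q + p' + q' + 2, fun a b => ?_⟩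
  specialize hp a
  specialize hq a
  simp only [Polynomial.eval_add, Polynomial.eval_mul, Polynomial.eval_ofNat, Polynomial.eval_X]
  set B := 2 * sz a + p.eval (sz a) + q.eval (sz a) + p'.eval (sz a) + q'.eval (sz a) + 2 + b.length
    with hB
  have hm := fun t => Tr.mark_notMem_ser t
  have hsa : (enc a).ser.length = sz a := rfl
  have hsf : (f a).ser.length = sz (f a) := rfl
  have hsg : (g a).ser.length = sz (g a) := rfl
  have h₁ := run_save (G := E.G) (enc a).ser b (hm _) (fun _ => []) (B := B)
    (by simp; omega)
  have h₂ := (hc a ((enc a).ser ++ .mark :: b)).mono (B' := B)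
    (by simp; omega)
  have h₃ := run_swap (G := E.G) (enc a).ser (f a).ser b (hm _) (hm _) (fun _ => []) (B := B)
    (by simp; omega)
  have h₄ := (hd a ((f a).ser ++ .mark :: b)).mono (B' := B)
    (by simp; omega)
  have h₅ := run_restore (G := E.G) (f a).ser (g a).ser b [] (hm _) (fun _ => []) (B := B)
    (by simp; omega)
  have h₆ := run_push (G := E.G) .A .node (s := bs ((f a).ser ++ (g a).ser) b [] []) (fun _ => [])
    (B := B) (by simp; omega)
  simp only [update_bs_A, bs_A] at h₆
  exact h₁.seq (h₂.seq (h₃.seq (h₄.seq (h₅.seq h₆))))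

/-- The program that splits a tree, and moves the left subtree to stack `D`. -/
def splitCmd (G : X → Type) (c : Cmd (Alph G)) : Cmd (Alph G) :=
  .pop (.base .A) fun o =>
    if o = some Symb.node then .push (.base .C) .mark ;; parse G ;; c
    else .push (.base .A) .nil

theorem run_split_nil (c : Cmd (Alph G)) (b : List Symb) {B : ℕ} (hB : 1 + b.length ≤ B) :
    Run (splitCmd G c) (st G .nil b) (st G .nil b) B := by
  refine run_pop .A (by simpa [Tr.ser] using hB) ?_
  simpa [Tr.ser, st] using run_push (G := G) .A .nil (s := bs [] b [] []) (fun _ => []) (B := B)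
    (by simp; omega)

theorem run_split_node {c : Cmd (Alph G)} (l r : Tr) (b : List Symb) {B : ℕ}
    (hB : 2 * l.ser.length + r.ser.length + b.length + 1 ≤ B) {S' : ∀ k, List (Alph G k)}
    (h : Run c (mk (bs r.ser b [] l.ser.reverse) fun _ => []) S' B) :
    Run (splitCmd G c) (st G (.node l r) b) S' B := by
  refine run_pop .A (by simp [Tr.ser]; omega) ?_
  have h₁ := run_push (G := G) .C .mark (s := bs (l.ser ++ r.ser) b [] []) (fun _ => []) (B := B)
    (by simp; omega)
  have h₂ := run_parse (G := G) l r.ser b (fun _ => []) (B := B) (by simp; omega)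
  rw [update_bs_C] at h₁
  simpa [Tr.ser] using h₁.seq (h₂.seq h)

/-- After parsing, the right subtree is on `A` and the left one, reversed, on `D`. The former is
discarded and the latter moved back. -/
theorem PS.left : PS E Tr.left := by
  refine ⟨splitCmd E.G (clear E.G .A ;; mv E.G .D .A), 2 * Polynomial.X + 1, fun t b => ?_⟩
  simp only [Polynomial.eval_add, Polynomial.eval_mul, Polynomial.eval_ofNat, Polynomial.eval_X,
    Polynomial.eval_one]
  cases t with
  | nil => exact run_split_nil _ _ (by omega)
  | node l r =>
    have hs : sz (Tr.node l r) = l.ser.length + r.ser.length + 1 := by simp [sz, enc, Tr.ser]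
    refine run_split_node _ _ _ (by omega) ?_
    have h₁ := run_clear (G := E.G) (i := .A) (s := bs r.ser b [] l.ser.reverse) (fun _ => [])
      (B := 2 * sz (Tr.node l r) + 1 + b.length) (by simp; omega)
    have h₂ := run_mv (G := E.G) (i := .D) (j := .A) (by decide) l.ser.reverse []
      (by simpa using Tr.mark_notMem_ser l) (.inl rfl) (s := bs [] b [] l.ser.reverse) (by simp)
      (fun _ => []) (B := 2 * sz (Tr.node l r) + 1 + b.length) (by simp; omega)
    simp only [bs_A, List.tail_nil, update_bs_A, update_bs_D, List.append_nil,
      List.reverse_reverse] at h₁ h₂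
    exact h₁.seq h₂

theorem PS.right : PS E Tr.right := by
  refine ⟨splitCmd E.G (clear E.G .D), 2 * Polynomial.X + 1, fun t b => ?_⟩
  simp only [Polynomial.eval_add, Polynomial.eval_mul, Polynomial.eval_ofNat, Polynomial.eval_X,
    Polynomial.eval_one]
  cases t with
  | nil => exact run_split_nil _ _ (by omega)
  | node l r =>
    have hs : sz (Tr.node l r) = l.ser.length + r.ser.length + 1 := by simp [sz, enc, Tr.ser]
    refine run_split_node _ _ _ (by omega) ?_
    have h₁ := run_clear (G := E.G) (i := .D) (s := bs r.ser b [] l.ser.reverse) (fun _ => [])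
      (B := 2 * sz (Tr.node l r) + 1 + b.length) (by simp; omega)
    rwa [update_bs_D] at h₁

instance Bool.data : Data Bool := ⟨fun b => cond b (.node .nil .nil) .nil⟩

theorem enc_true : enc true = .node .nil .nil := rfl
theorem enc_false : enc false = .nil := rfl

/-- The program for a case distinction. -/
def condCmd (c d₁ d₀ : Cmd (Alph G)) : Cmd (Alph G) :=
  save G ;; c ;; .pop (.base .A) fun o =>
    if o = some Symb.node then clear G .A ;; restore G ;; d₁ else restore G ;; d₀

@[fun_prop]
theorem PS.bcond {c : α → Bool} {f g : α → β} (hc : PS E c) (hf : PS E f) (hg : PS E g) :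
    PS E (fun a => cond (c a) (f a) (g a)) := by
  obtain ⟨c', p, hc⟩ := hc
  obtain ⟨d₁, p₁, hf⟩ := hf
  obtain ⟨d₀, p₀, hg⟩ := hg
  refine ⟨condCmd c' d₁ d₀, 2 * Polynomial.X + p + p₁ + p₀ + 6, fun a b => ?_⟩
  simp only [Polynomial.eval_add, Polynomial.eval_mul, Polynomial.eval_ofNat, Polynomial.eval_X]
  set B := 2 * sz a + p.eval (sz a) + p₁.eval (sz a) + p₀.eval (sz a) + 6 + b.length with hB
  have hm := fun t => Tr.mark_notMem_ser t
  have hsa : (enc a).ser.length = sz a := rfl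
  have h₁ := run_save (G := E.G) (enc a).ser b (hm _) (fun _ => []) (B := B)
    (by simp; omega)
  have h₂ := (hc a ((enc a).ser ++ .mark :: b)).mono (B' := B) (by simp; omega)
  have h₃ := run_restore (G := E.G) (enc a).ser [] b [] (hm _) (fun _ => []) (B := B)
    (by simp; omega)
  rw [List.append_nil] at h₃
  refine h₁.seq (h₂.seq ?_)
  cases c a with
  | true =>
    refine run_pop .A (by simp [enc_true, Tr.ser]; omega) ?_
    -- The code of `true` has three symbols; the first has been popped, and the other two are
    -- cleared.
    have h₄ := run_clear (G := E.G) (i := .A)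
      (s := bs [.nil, .nil] ((enc a).ser ++ .mark :: b) [] []) (fun _ => [])
      (B := B) (by simp; omega)
    have h₅ := (hf a b).mono (B' := B) (by omega)
    rw [update_bs_A] at h₄
    simpa [enc_true, Tr.ser] using h₄.seq (h₃.seq h₅)
  | false =>
    refine run_pop .A (by simp [enc_false, Tr.ser]; omega) ?_
    have h₅ := (hg a b).mono (B' := B) (by omega)
    simpa [enc_false, Tr.ser] using h₃.seq h₅

theorem PS.isNode : PS E Tr.isNode := by
  refine ⟨.pop (.base .A) fun o => if o = some Symb.node then
    clear E.G .A ;; pushAll E.G (enc true).ser else .push (.base .A) .nil,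
    Polynomial.X + 3, fun t b => ?_⟩
  simp only [Polynomial.eval_add, Polynomial.eval_ofNat, Polynomial.eval_X]
  have hs : t.ser.length = sz t := rfl
  refine run_pop .A (by simp [enc, sz]) ?_
  cases t with
  | nil =>
    simpa [Tr.ser, enc, Tr.isNode, st] using run_push (G := E.G) .A .nil (s := bs [] b [] [])
      (fun _ => []) (B := sz Tr.nil + 3 + b.length) (by simp)
  | node l r =>
    simp only [Tr.ser, List.length_cons, List.length_append] at hs
    have h₁ := run_clear (G := E.G) (i := .A) (s := bs (l.ser ++ r.ser) b [] []) (fun _ => [])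
      (B := sz (Tr.node l r) + 3 + b.length) (by simp; omega)
    have h₂ := run_pushAll (G := E.G) (enc true).ser [] b [] [] (fun _ => [])
      (B := sz (Tr.node l r) + 3 + b.length) (by simp [enc_true, Tr.ser])
    simp only [update_bs_A, List.append_nil] at h₁ h₂
    simpa [Tr.ser, enc, Tr.isNode, st] using h₁.seq h₂

instance Prod.data : Data (α × β) := ⟨fun x => .node (enc x.1) (enc x.2)⟩

theorem enc_prod (a : α) (b : β) : enc (a, b) = .node (enc a) (enc b) := rfl

/-! ### Loops with bounded values and unbounded length -/

/-- `DW step N a a'`: iterating `step` from `a`, as long as the flag that it returns is set, leads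
to `a'`, and the size of the values does not exceed `N`. -/
inductive DW (step : α → Bool × α) (N : ℕ) : α → α → Prop
  | exits {a a'} : sz a ≤ N → step a = (false, a') → DW step N a a'
  | next {a a₁ a'} : sz a ≤ N → step a = (true, a₁) → DW step N a₁ a' → DW step N a a'

/-- The program for a loop. -/
def loopCmd (c : Cmd (Alph G)) : Cmd (Alph G) :=
  .loop (.base .C) (fun o => o = none) fun _ => c ;; .pop (.base .A) fun _ => .pop (.base .A) fun o =>
    if o = some Symb.node then
      .pop (.base .A) fun _ => .pop (.base .A) fun _ => .push (.base .C) .mark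
    else .skip

/-- A mark on `C` requests another round; it is popped first, so that the body finds `C` empty. The
result of the body begins with `node` and the code of the flag: two pops strip `node`, `nil` if the
flag is false, and four strip `node`, `node`, `nil`, `nil` if it is true, whereupon a new mark is
pushed. The number of rounds does not enter the bound. -/
theorem run_loopCmd {step : α → Bool × α} {c : Cmd (Alph G)} {p : Polynomial ℕ}
    (hc : ∀ a b, Run c (st G (enc a) b) (st G (enc (step a)) b) (p.eval (sz a) + b.length))
    {N : ℕ} {a a' : α} (h : DW step N a a') (b : List Symb) :
    Run (loopCmd c) (mk (bs (enc a).ser b [.mark] []) fun _ => []) (st G (enc a') b)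
      (p.eval N + N + b.length + 1) := by
  unfold loopCmd
  induction h with
  | @exits a a' ha hs =>
    have hsa : (enc a).ser.length = sz a := rfl
    have h₁ := hc a b
    have h₁' := h₁.size_le.2
    have := eval_mono p ha
    rw [hs] at h₁ h₁'
    rw [size_st] at h₁'
    simp only [enc_prod, enc_false, Tr.ser, List.length_cons, List.length_append,
      List.length_nil] at h₁'
    refine run_loop_step .C (S' := st G (enc a') b) (by simp) (by simp; omega) ?_ ?_
    · simp only [bs_C, List.tail_cons, update_bs_C]
      refine (h₁.mono (by omega)).seq ?_
      simp only [enc_prod, enc_false, st, Tr.ser]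
      refine run_pop .A (by simp; omega) (run_pop .A (by simp; omega) ?_)
      simpa [st] using Run.skip (S := st G (enc a') b) (by rw [size_st]; omega)
    · simpa [st] using run_loop_exit (G := G) .C (s := bs (enc a').ser b [] []) (e := fun _ => [])
        (exits := fun o => decide (o = none)) (by simp) (by simp; omega)
  | @next a a₁ a' ha hs _ ih =>
    have hsa : (enc a).ser.length = sz a := rfl
    have h₁ := hc a b
    have h₁' := h₁.size_le.2
    have := eval_mono p ha
    rw [hs] at h₁ h₁'
    rw [size_st] at h₁'
    simp only [enc_prod, enc_true, Tr.ser, List.length_cons, List.length_append,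
      List.length_nil] at h₁'
    refine run_loop_step .C (by simp) (by simp; omega) ?_ ih
    simp only [bs_C, List.tail_cons, update_bs_C]
    refine (h₁.mono (by omega)).seq ?_
    simp only [enc_prod, enc_true, st, Tr.ser]
    refine run_pop .A (by simp; omega) (run_pop .A (by simp; omega) ?_)
    simp only [bs_A, update_bs_A, List.cons_append, List.nil_append, List.tail_cons,
      List.head?_cons, if_true]
    refine run_pop .A (by simp; omega) (run_pop .A (by simp; omega) ?_)
    simpa using run_push (G := G) .C .mark (s := bs (enc a₁).ser b [] []) (fun _ => [])
      (B := p.eval N + N + b.length + 1) (by simp; omega)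

/-- Only the sizes of the values along the loop are restricted. Exponentially many rounds are
allowed, which is what the summation over all paths needs. -/
theorem PS.loop {step : α → Bool × α} (hs : PS E step) {i r : β → α} (hi : PS E i)
    (q : Polynomial ℕ) (h : ∀ x, DW step (q.eval (sz x)) (i x) (r x)) : PS E r := by
  obtain ⟨c, p, hc⟩ := hs
  obtain ⟨s, hs⟩ := hi.size_le
  obtain ⟨d, p', hd⟩ := hi
  refine ⟨d ;; .push (.base .C) .mark ;; loopCmd c, p' + p.comp q + q + s + 1, fun x b => ?_⟩
  simp only [Polynomial.eval_add, Polynomial.eval_comp, Polynomial.eval_one]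
  refine ((hd x b).mono (by omega)).seq (.seq ?_
    ((run_loopCmd hc (h x) b).mono (by omega)))
  have : (enc (i x)).ser.length ≤ s.eval (sz x) := hs x
  simpa [st] using run_push (G := E.G) .C .mark (s := bs (enc (i x)).ser b [] []) (fun _ => [])
    (B := p'.eval (sz x) + p.eval (q.eval (sz x)) + q.eval (sz x) + s.eval (sz x) + 1 + b.length)
    (by simp; omega)

end StackProg

namespace StackProg

variable {E : Ext}
variable {α β γ δ : Type} [Data α] [Data β] [Data γ] [Data δ]

/-! ### Basic data types -/

theorem PS.enc : PS E (fun a : α => enc a) := .of_enc_eq fun _ => rfl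

@[fun_prop]
theorem PS.prodMk {f : α → β} {g : α → γ} (hf : PS E f) (hg : PS E g) :
    PS E (fun a => (f a, g a)) :=
  (PS.node (PS.enc.comp hf) (PS.enc.comp hg)).congr fun _ => rfl

@[fun_prop]
theorem PS.fst {f : α → β × γ} (hf : PS E f) : PS E (fun a => (f a).1) :=
  (PS.left.comp (PS.enc.comp hf)).congr fun _ => rfl

@[fun_prop]
theorem PS.snd {f : α → β × γ} (hf : PS E f) : PS E (fun a => (f a).2) :=
  (PS.right.comp (PS.enc.comp hf)).congr fun _ => rfl

instance Option.data : Data (Option α) := ⟨fun o => o.elim .nil fun a => .node (enc a) .nil⟩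

/-- The tree that represents a list. -/
def encList : List α → Tr
  | [] => .nil
  | a :: l => .node (enc a) (encList l)

instance List.data : Data (List α) := ⟨encList⟩

instance Unit.data : Data Unit := ⟨fun _ => .nil⟩

section

@[simp] theorem enc_nil : enc ([] : List α) = .nil := rfl
@[simp] theorem enc_cons (a : α) (l : List α) : enc (a :: l) = .node (enc a) (enc l) := rfl
@[simp] theorem enc_none : enc (none : Option α) = .nil := rfl
@[simp] theorem enc_some (a : α) : enc (some a) = .node (enc a) .nil := rfl

@[simp] theorem sz_prod (a : α) (b : β) : sz (a, b) = sz a + sz b + 1 := by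
  simp [sz, enc_prod, Tr.ser]
@[simp] theorem sz_true : sz true = 3 := rfl
@[simp] theorem sz_false : sz false = 1 := rfl
@[simp] theorem sz_nil : sz ([] : List α) = 1 := rfl
@[simp] theorem sz_cons (a : α) (l : List α) : sz (a :: l) = sz a + sz l + 1 := by
  simp [sz, Tr.ser]
@[simp] theorem sz_none : sz (none : Option α) = 1 := rfl
@[simp] theorem sz_some (a : α) : sz (some a) = sz a + 2 := by simp [sz, Tr.ser]

theorem sz_bool_le (b : Bool) : sz b ≤ 3 := by cases b <;> simp

theorem one_le_sz (a : α) : 1 ≤ sz a := sz_pos a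

theorem length_le_sz (l : List α) : l.length ≤ sz l := by
  induction l with
  | nil => simp
  | cons a l ih => simp; omega

theorem sz_append (l₁ l₂ : List α) : sz (l₁ ++ l₂) + 1 = sz l₁ + sz l₂ := by
  induction l₁ with
  | nil => simp; omega
  | cons a l ih => simp; omega

theorem sz_reverse (l : List α) : sz l.reverse = sz l := by
  induction l with
  | nil => rfl
  | cons a l ih =>
    have := sz_append l.reverse [a]
    simp at this ⊢
    omega

theorem sz_le_of_mem {a : α} {l : List α} (h : a ∈ l) : sz a ≤ sz l := by
  induction l with
  | nil => simp at h
  | cons b l ih =>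
    rcases List.mem_cons.1 h with rfl | h
    · simp; omega
    · have := ih h
      simp; omega

theorem sz_tail_le (l : List α) : sz l.tail ≤ sz l := by
  cases l <;> simp; omega

end

@[fun_prop]
theorem PS.not {f : α → Bool} (hf : PS E f) : PS E (fun a => !(f a)) :=
  (PS.bcond hf (PS.const false) (PS.const true)).congr fun a => by cases f a <;> rfl

@[fun_prop]
theorem PS.and {f g : α → Bool} (hf : PS E f) (hg : PS E g) : PS E (fun a => f a && g a) :=
  (PS.bcond hf hg (PS.const false)).congr fun a => by cases f a <;> rfl

@[fun_prop]
theorem PS.or {f g : α → Bool} (hf : PS E f) (hg : PS E g) : PS E (fun a => f a || g a) :=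
  (PS.bcond hf (PS.const true) hg).congr fun a => by cases f a <;> rfl

@[fun_prop]
theorem PS.xor {f g : α → Bool} (hf : PS E f) (hg : PS E g) : PS E (fun a => (f a ^^ g a)) :=
  (PS.bcond hf hg.not hg).congr fun a => by cases f a <;> simp

@[fun_prop]
theorem PS.some {f : α → β} (hf : PS E f) : PS E (fun a => some (f a)) :=
  (PS.node (PS.enc.comp hf) (PS.const Tr.nil)).congr fun _ => rfl

@[fun_prop]
theorem PS.isSome {f : α → Option β} (hf : PS E f) : PS E (fun a => (f a).isSome) :=
  (PS.isNode.comp (PS.enc.comp hf)).congr fun a => by cases f a <;> rfl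

@[fun_prop]
theorem PS.getD {f : α → Option β} {g : α → β} (hf : PS E f) (hg : PS E g) :
    PS E (fun a => (f a).getD (g a)) :=
  (PS.bcond hf.isSome (PS.left.comp (PS.enc.comp hf)) (PS.enc.comp hg)).congr fun a => by
    cases f a <;> rfl

@[fun_prop]
theorem PS.cons {f : α → β} {g : α → List β} (hf : PS E f) (hg : PS E g) :
    PS E (fun a => f a :: g a) :=
  (PS.node (PS.enc.comp hf) (PS.enc.comp hg)).congr fun _ => rfl

@[fun_prop]
theorem PS.isEmpty {f : α → List β} (hf : PS E f) : PS E (fun a => (f a).isEmpty) :=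
  (PS.isNode.comp (PS.enc.comp hf)).not.congr fun a => by cases f a <;> rfl

@[fun_prop]
theorem PS.tail {f : α → List β} (hf : PS E f) : PS E (fun a => (f a).tail) :=
  (PS.right.comp (PS.enc.comp hf)).congr fun a => by cases f a <;> rfl

@[fun_prop]
theorem PS.headD {f : α → List β} {g : α → β} (hf : PS E f) (hg : PS E g) :
    PS E (fun a => (f a).headD (g a)) :=
  (PS.bcond hf.isEmpty (PS.enc.comp hg) (PS.left.comp (PS.enc.comp hf))).congr fun a => by
    cases f a <;> rfl

/-! ### Folds -/

/-- One step of the computation of a fold. -/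
def foldStep (f : γ → β → α → β) (d : α) (s : γ × β × List α) : Bool × γ × β × List α :=
  cond s.2.2.isEmpty (false, s) (true, s.1, f s.1 s.2.1 (s.2.2.headD d), s.2.2.tail)

theorem dw_foldStep {f : γ → β → α → β} {d : α} (c : γ) {N : ℕ} (l : List α) (b : β)
    (hN : ∀ l₁ l₂, l = l₁ ++ l₂ → sz c + sz (l₁.foldl (f c) b) + sz l + 2 ≤ N) :
    DW (foldStep f d) N (c, b, l) (c, l.foldl (f c) b, []) := by
  have h₀ := hN [] l rfl
  rw [List.foldl_nil] at h₀
  have hs : sz (c, b, l) ≤ N := by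
    simp
    omega
  induction l generalizing b with
  | nil => exact .exits hs rfl
  | cons a l ih =>
    have h₁ : ∀ l₁ l₂, l = l₁ ++ l₂ → sz c + sz (l₁.foldl (f c) (f c b a)) + sz l + 2 ≤ N := by
      intro l₁ l₂ hl
      have := hN (a :: l₁) l₂ (by rw [hl, List.cons_append])
      rw [List.foldl_cons, sz_cons] at this
      omega
    have h₂ := h₁ [] l rfl
    rw [List.foldl_nil] at h₂
    refine .next (a₁ := (c, f c b a, l)) hs rfl (ih _ h₁ h₂ ?_)
    simp
    omega

/-- A fold is a loop whose state contains the rest of the list, so it suffices to bound the partial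
results. The element `d` is only the default head that makes a step total. -/
theorem PS.foldl_of_le {f : γ → β → α → β} (hf : PS E fun x : γ × β × α => f x.1 x.2.1 x.2.2)
    (d : α) {c : δ → γ} {b : δ → β} {l : δ → List α} (hc : PS E c) (hb : PS E b) (hl : PS E l)
    (q : Polynomial ℕ)
    (hq : ∀ x l₁ l₂, l x = l₁ ++ l₂ → sz (l₁.foldl (f (c x)) (b x)) ≤ q.eval (sz x)) :
    PS E (fun x => (l x).foldl (f (c x)) (b x)) := by
  have hi : PS E fun x => (c x, b x, l x) := by fun_prop
  have hs : PS E (foldStep f d) := by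
    refine PS.bcond (by fun_prop) (by fun_prop) (PS.prodMk (by fun_prop) (PS.prodMk (by fun_prop)
      (PS.prodMk ?_ (by fun_prop))))
    exact hf.comp (f := fun s : γ × β × List α => (s.1, s.2.1, s.2.2.headD d)) (by fun_prop)
  obtain ⟨p, hp⟩ := hi.size_le
  have : PS E fun x => (c x, (l x).foldl (f (c x)) (b x), ([] : List α)) := by
    refine PS.loop hs hi (p + q) fun x => dw_foldStep _ _ _ fun l₁ l₂ h => ?_
    have hx := hp x
    have := hq x l₁ l₂ h
    have := one_le_sz (b x)
    simp only [sz_prod] at hx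
    rw [Polynomial.eval_add]
    omega
  exact this.snd.fst

/-- The accumulator enters the hypothesis with coefficient one, so growth does not compound: a
partial result exceeds the initial value by at most the length of the list times a fixed polynomial
amount. -/
theorem PS.foldl {f : γ → β → α → β} (hf : PS E fun x : γ × β × α => f x.1 x.2.1 x.2.2) (d : α)
    (q : Polynomial ℕ) (hq : ∀ c b a, sz (f c b a) ≤ sz b + q.eval (sz c + sz a))
    {c : δ → γ} {b : δ → β} {l : δ → List α} (hc : PS E c) (hb : PS E b) (hl : PS E l) :
    PS E (fun x => (l x).foldl (f (c x)) (b x)) := by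
  obtain ⟨p, hp⟩ := (hc.prodMk (hb.prodMk hl)).size_le
  refine PS.foldl_of_le hf d hc hb hl (p + p * q.comp p) fun x l₁ l₂ hl => ?_
  have hx := hp x
  have h₁ := sz_append l₁ l₂
  have h₂ := length_le_sz l₁
  have h₃ := one_le_sz l₂
  simp only [sz_prod, hl] at hx
  have h : ∀ l' : List α, ∀ b, (∀ a ∈ l', sz (c x) + sz a ≤ p.eval (sz x)) →
      sz (l'.foldl (f (c x)) b) ≤ sz b + l'.length * q.eval (p.eval (sz x)) := by
    intro l' b hl'
    induction l' generalizing b with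
    | nil => simp
    | cons a l' ih =>
      have h₁ := ih (f (c x) b a) fun a h => hl' a (by simp [h])
      have h₂ := hq (c x) b a
      have h₃ := eval_mono q (hl' a (by simp))
      simp only [List.foldl_cons, List.length_cons, Nat.succ_mul]
      omega
  refine (h l₁ (b x) fun a ha => ?_).trans ?_
  · have := sz_le_of_mem ha
    omega
  · simp only [Polynomial.eval_add, Polynomial.eval_mul, Polynomial.eval_comp]
    exact Nat.add_le_add (by omega) (Nat.mul_le_mul_right _ (by omega))

@[fun_prop]
theorem PS.append {f g : α → List β} (hf : PS E f) (hg : PS E g) :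
    PS E (fun a => f a ++ g a) := by
  -- A fold needs a default element; if the type has none, all lists are empty.
  by_cases hβ : Nonempty β
  · obtain ⟨d⟩ := hβ
    have hr : ∀ {f : α → List β} {g : α → List β}, PS E f → PS E g →
        PS E fun a => (f a).reverse ++ g a := fun {f g} hf hg =>
      (PS.foldl (f := fun (_ : Unit) (b : List β) a => a :: b) (by fun_prop) d
        (Polynomial.X + 1) (fun c b a => by simp; omega) (PS.const ()) hg hf).congr fun x => by
          congr 1
          generalize g x = y
          induction f x generalizing y with
          | nil => rfl
          | cons a l ih => simp [ih]
    exact (hr (hr hf (PS.const [])) hg).congr fun x => by simp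
  · have : IsEmpty β := not_nonempty_iff.1 hβ
    refine (PS.const ([] : List β)).congr fun a => ?_
    rw [Subsingleton.elim [] (f a ++ g a)]

@[fun_prop]
theorem PS.reverse {f : α → List β} (hf : PS E f) : PS E (fun a => (f a).reverse) := by
  by_cases hβ : Nonempty β
  · obtain ⟨d⟩ := hβ
    exact (PS.foldl (f := fun (_ : Unit) (b : List β) a => a :: b) (by fun_prop) d
        (Polynomial.X + 1) (fun c b a => by simp; omega) (PS.const ()) (PS.const []) hf).congr
          fun x => by
            congr 1
            exact (List.foldl_flip_cons_eq_append' ..).trans (by simp)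
  · have : IsEmpty β := not_nonempty_iff.1 hβ
    refine (PS.const ([] : List β)).congr fun a => ?_
    rw [Subsingleton.elim [] (f a).reverse]

theorem PS.map_some {f : α → List β} (d : β) (hf : PS E f) :
    PS E (fun a => (f a).map Option.some) := by
  have : PS E fun a => ((f a).foldl (fun b a => Option.some a :: b) []).reverse :=
    (PS.foldl (f := fun (_ : Unit) (b : List (Option β)) a => Option.some a :: b) (by fun_prop) d
      (Polynomial.X + 3) (fun c b a => by simp; omega) (PS.const ()) (PS.const []) hf).reverse
  refine this.congr fun x => ?_
  congr 1
  suffices ∀ l : List β, ∀ b : List (Option β), l.foldl (fun b a => Option.some a :: b) b =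
      (l.map Option.some).reverse ++ b by rw [this]; simp
  intro l
  induction l with
  | nil => simp
  | cons a l ih => intro b; simp [ih]

/-- One step of the comparison of two words. -/
def eqStep (s : List Bool × Bool) (b : Bool) : List Bool × Bool :=
  (s.1.tail, s.2 && !s.1.isEmpty && !(s.1.headD false ^^ b))

/-- The pair consists of what is left of the second word and whether the symbols have agreed so far.
The words are equal if they have agreed and nothing is left. -/
theorem foldl_eqStep (l r : List Bool) (ok : Bool) :
    ((l.foldl eqStep (r, ok)).2 && (l.foldl eqStep (r, ok)).1.isEmpty) = (ok && decide (l = r)) := by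
  induction l generalizing r ok with
  | nil => cases r <;> simp
  | cons b l ih =>
    rw [List.foldl_cons, eqStep, ih]
    cases r with
    | nil => simp
    | cons c r => cases b <;> cases c <;> simp <;> rfl

@[fun_prop]
theorem PS.decideEqWord {f g : α → List Bool} (hf : PS E f) (hg : PS E g) :
    PS E (fun a => decide (f a = g a)) := by
  have : PS E fun a => (f a).foldl eqStep (g a, true) :=
    PS.foldl (f := fun (_ : Unit) => eqStep) (by unfold eqStep; fun_prop) false 2
      (fun c b a => by
        have h₁ := sz_tail_le b.1
        have h₂ := sz_bool_le ((b.2 && !b.1.isEmpty && !(b.1.headD false ^^ a)))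
        have h₃ := one_le_sz b.2
        have h₄ : sz b = sz b.1 + sz b.2 + 1 := sz_prod _ _
        simp only [eqStep, sz_prod, Polynomial.eval_ofNat]
        omega) (PS.const ()) (by fun_prop) hf
  exact (this.snd.and this.fst.isEmpty).congr fun a => by rw [foldl_eqStep, Bool.true_and]

/-! ### Natural numbers and integers in binary -/

instance Nat.data : Data ℕ := ⟨fun n => enc (encodeNat n)⟩

theorem enc_nat (n : ℕ) : enc n = enc (encodeNat n) := rfl

/-- The successor of a number in binary. -/
def incWord : List Bool → List Bool
  | [] => [true]
  | false :: l => true :: l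
  | true :: l => false :: incWord l

theorem encodePosNum_succ (p : PosNum) : encodePosNum p.succ = incWord (encodePosNum p) := by
  induction p with
  | one => rfl
  | bit0 p _ => rfl
  | bit1 p ih => simp only [PosNum.succ, encodePosNum, incWord, ih]

theorem encodeNat_succ (n : ℕ) : encodeNat (n + 1) = incWord (encodeNat n) := by
  unfold encodeNat
  rw [Nat.cast_succ, Num.add_one]
  cases (n : Num) with
  | zero => rfl
  | pos p => exact encodePosNum_succ p

theorem length_encodeNat (n : ℕ) : (encodeNat n).length = n.size := by
  have h : ∀ p : PosNum, (encodePosNum p).length = p.natSize := by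
    intro p
    induction p with
    | one => rfl
    | bit0 p ih => simp only [encodePosNum, List.length_cons, ih, PosNum.natSize]
    | bit1 p ih => simp only [encodePosNum, List.length_cons, ih, PosNum.natSize]
  have h' : ∀ m : Num, (encodeNum m).length = (m : ℕ).size := by
    intro m
    cases m with
    | zero => simp [encodeNum]
    | pos p => rw [encodeNum, h, PosNum.natSize_to_nat]; rfl
  rw [encodeNat, h', Num.to_of_nat]

theorem encodeNat_injective : Function.Injective encodeNat := fun m n h => by
  rw [← decode_encodeNat m, h, decode_encodeNat]

theorem sz_word_le (l : List Bool) : sz l ≤ 4 * l.length + 1 := by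
  induction l with
  | nil => simp
  | cons b l ih =>
    have := sz_bool_le b
    simp
    omega

theorem le_sz_word (l : List Bool) : 2 * l.length + 1 ≤ sz l := by
  induction l with
  | nil => simp
  | cons b l ih =>
    have := one_le_sz b
    simp
    omega

theorem sz_nat (n : ℕ) : sz n = sz (encodeNat n) := rfl

/-- The size is not monotone, because `true` has a longer code than `false`. But a word of length k
has size between 2k + 1 and 4k + 1, and the binary length is monotone; hence the factor 2. -/
theorem sz_nat_le {m n : ℕ} (h : m ≤ n) : sz m ≤ 2 * sz n := by
  have h₁ := sz_word_le (encodeNat m)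
  have h₂ := le_sz_word (encodeNat n)
  have h₃ := Nat.size_le_size h
  rw [sz_nat, sz_nat]
  rw [length_encodeNat] at h₁ h₂
  omega

@[fun_prop]
theorem PS.encodeNat {f : α → ℕ} (hf : PS E f) : PS E (fun a => encodeNat (f a)) :=
  hf.congr fun _ => rfl

@[fun_prop]
theorem PS.decideEqNat {f g : α → ℕ} (hf : PS E f) (hg : PS E g) :
    PS E (fun a => decide (f a = g a)) :=
  (PS.decideEqWord hf.encodeNat hg.encodeNat).congr fun a => by
    simp only [encodeNat_injective.eq_iff]

/-- One step of the computation of the successor. -/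
def incStep (s : Bool × List Bool) (b : Bool) : Bool × List Bool :=
  (s.1 && b, (s.1 ^^ b) :: s.2)

theorem foldl_incStep (l out : List Bool) (carry : Bool) :
    (cond (l.foldl incStep (carry, out)).1 (true :: (l.foldl incStep (carry, out)).2)
      (l.foldl incStep (carry, out)).2).reverse =
      out.reverse ++ cond carry (incWord l) l := by
  induction l generalizing carry out with
  | nil => cases carry <;> simp [incWord]
  | cons b l ih =>
    rw [List.foldl_cons, incStep, ih]
    cases b <;> cases carry <;> simp [incWord]

theorem PS.incWord {f : α → List Bool} (hf : PS E f) : PS E (fun a => incWord (f a)) := by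
  have : PS E fun a => (f a).foldl incStep (true, []) :=
    PS.foldl (f := fun (_ : Unit) => incStep) (by unfold incStep; fun_prop) false 6
      (fun c b a => by
        have h₁ := sz_bool_le (b.1 && a)
        have h₂ := sz_bool_le (b.1 ^^ a)
        have h₃ := one_le_sz b.1
        have h₄ : sz b = sz b.1 + sz b.2 + 1 := sz_prod _ _
        simp only [incStep, sz_prod, sz_cons, Polynomial.eval_ofNat]
        omega) (PS.const ()) (by fun_prop) hf
  exact (PS.bcond this.fst (PS.cons (PS.const true) this.snd) this.snd).reverse.congr fun a => by
    rw [foldl_incStep]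
    rfl

@[fun_prop]
theorem PS.succ {f : α → ℕ} (hf : PS E f) : PS E (fun a => f a + 1) :=
  (hf.encodeNat.incWord).congr fun a => by
    rw [← encodeNat_succ]
    rfl

/-- One step of the search for the predecessor. -/
def predStep (s : ℕ × ℕ) : Bool × ℕ × ℕ := (!decide (s.2 + 1 = s.1), s.1, cond (decide (s.2 + 1 = s.1)) s.2 (s.2 + 1))

/-- The predecessor is found by counting upwards until the successor of the counter is `n`. This may
take exponentially many rounds in the binary length, but no value exceeds `n`. -/
theorem dw_predStep (n : ℕ) {N : ℕ} (hN : sz n + 2 * sz n + 1 ≤ N) (k m : ℕ) (h : m + k + 1 = n) :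
    DW predStep N (n, m) (n, n - 1) := by
  have hs : sz (n, m) ≤ N := by
    have := sz_nat_le (show m ≤ n by omega)
    simp
    omega
  induction k generalizing m with
  | zero => exact .exits hs (by simp [predStep, ← h])
  | succ k ih =>
    refine .next (a₁ := (n, m + 1)) hs ?_ (ih (m + 1) (by omega) ?_)
    · have : m + 1 ≠ n := by omega
      simp [predStep, this]
    · have := sz_nat_le (show m + 1 ≤ n by omega)
      simp
      omega

@[fun_prop]
theorem PS.pred {f : α → ℕ} (hf : PS E f) : PS E (fun a => f a - 1) := by
  suffices h : PS E (fun n : ℕ => n - 1) from h.comp hf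
  -- For `n = 0` the search would not end, so it is started at `(1, 0)`, where it stops at once with
  -- the result 0.
  have hl : PS E (fun n : ℕ => cond (decide (n = 0)) ((1 : ℕ), 0) (n, n - 1)) := by
    refine PS.loop (step := predStep) (i := fun n => cond (decide (n = 0)) (1, 0) (n, 0))
      (by unfold predStep; fun_prop) (by fun_prop) (3 * Polynomial.X + 20) fun n => ?_
    by_cases hn : n = 0
    · subst hn
      exact dw_predStep 1 (by
        have : sz (1 : ℕ) = 5 := rfl
        simp only [Polynomial.eval_add, Polynomial.eval_mul, Polynomial.eval_ofNat]
        omega) 0 0 rfl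
    · simp only [hn, decide_false, Bool.cond_false]
      refine dw_predStep n ?_ (n - 1) 0 (by omega)
      simp only [Polynomial.eval_add, Polynomial.eval_mul, Polynomial.eval_ofNat, Polynomial.eval_X]
      omega
  refine hl.snd.congr fun n => ?_
  by_cases hn : n = 0 <;> simp [hn]

instance Int.data : Data ℤ := ⟨fun z => enc (decide (z < 0), z.natAbs)⟩

theorem sz_int (z : ℤ) : sz z = sz (decide (z < 0)) + sz z.natAbs + 1 := sz_prod _ _

@[fun_prop]
theorem PS.isNeg {f : α → ℤ} (hf : PS E f) : PS E (fun a => decide (f a < 0)) :=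
  (PS.left.comp (PS.enc.comp hf)).congr fun _ => rfl

@[fun_prop]
theorem PS.natAbs {f : α → ℤ} (hf : PS E f) : PS E (fun a => (f a).natAbs) :=
  (PS.right.comp (PS.enc.comp hf)).congr fun _ => rfl

theorem PS.int {f : α → ℤ} {s : α → Bool} {n : α → ℕ} (hs : PS E s) (hn : PS E n)
    (h : ∀ a, s a = decide (f a < 0)) (h' : ∀ a, n a = (f a).natAbs) : PS E f :=
  (hs.prodMk hn).congr fun a => by
    rw [h, h']
    rfl

@[fun_prop]
theorem PS.add_one {f : α → ℤ} (hf : PS E f) : PS E (fun a => f a + 1) := by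
  refine PS.int (s := fun a => decide (f a < 0) && !decide ((f a).natAbs - 1 = 0))
    (n := fun a => cond (decide (f a < 0)) ((f a).natAbs - 1) ((f a).natAbs + 1))
    (by fun_prop) (by fun_prop) (fun a => ?_) (fun a => ?_)
  · rw [Bool.eq_iff_iff]
    simp
    omega
  · by_cases h : f a < 0 <;> simp [h] <;> omega

@[fun_prop]
theorem PS.sub_one {f : α → ℤ} (hf : PS E f) : PS E (fun a => f a - 1) := by
  refine PS.int (s := fun a => decide (f a < 0) || decide ((f a).natAbs = 0))
    (n := fun a => cond (decide (f a < 0) || decide ((f a).natAbs = 0)) ((f a).natAbs + 1)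
      ((f a).natAbs - 1)) (by fun_prop) (by fun_prop) (fun a => ?_) (fun a => ?_)
  · rw [Bool.eq_iff_iff]
    simp
    omega
  · by_cases h : f a < 0 <;> by_cases h' : f a = 0 <;> simp [h, h'] <;> omega

/-! ### Sums of exponentially many signs -/

/-- The number given by a flag whether it is nonzero, and its sign. -/
def sgn (s : Bool × Bool) : ℤ := cond s.1 (cond s.2 (-1) 1) 0

/-- One step of the computation of a sum. -/
def sumStep (w : γ → ℕ → Bool × Bool) (s : γ × ℕ × ℕ × ℤ) : Bool × γ × ℕ × ℕ × ℤ :=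
  cond (decide (s.2.2.1 = s.2.1)) (false, s)
    (true, s.1, s.2.1, s.2.2.1 + 1, cond (w s.1 s.2.2.1).1
      (cond (w s.1 s.2.2.1).2 (s.2.2.2 - 1) (s.2.2.2 + 1)) s.2.2.2)

/-- A sum of `r` signs has absolute value at most `r`, so the accumulator stays as short as the
counter. In the bound, `n` counts once, the counter and the absolute value twice each by
`sz_nat_le`, and 7 covers the sign and four inner nodes. -/
theorem dw_sumStep (w : γ → ℕ → Bool × Bool) (c : γ) (n : ℕ) {N : ℕ}
    (hN : sz c + 5 * sz n + 7 ≤ N) (k r : ℕ) (hr : r + k = n) :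
    DW (sumStep w) N (c, n, r, ∑ i ∈ Finset.range r, sgn (w c i))
      (c, n, n, ∑ i ∈ Finset.range n, sgn (w c i)) := by
  have hs : ∀ r ≤ n, sz (c, n, r, ∑ i ∈ Finset.range r, sgn (w c i)) ≤ N := by
    intro r hr
    have h₁ : (∑ i ∈ Finset.range r, sgn (w c i)).natAbs ≤ r := by
      induction r with
      | zero => simp
      | succ r ih =>
        have := ih (by omega)
        rw [Finset.sum_range_succ]
        have h : (sgn (w c r)).natAbs ≤ 1 := by
          unfold sgn
          cases (w c r).1 <;> cases (w c r).2 <;> simp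
        omega
    have h₂ := sz_nat_le (h₁.trans hr)
    have h₃ := sz_nat_le hr
    have h₄ := sz_bool_le (decide (∑ i ∈ Finset.range r, sgn (w c i) < 0))
    simp only [sz_prod, sz_int]
    omega
  induction k generalizing r with
  | zero =>
    obtain rfl : r = n := hr
    exact .exits (hs r le_rfl) (by simp [sumStep])
  | succ k ih =>
    refine .next (hs r (by omega)) ?_ (ih (r + 1) (by omega))
    have : r ≠ n := by omega
    simp only [sumStep, this, decide_false, Bool.cond_false, Finset.sum_range_succ, sgn]
    cases (w c r).1 <;> cases (w c r).2 <;> simp [sub_eq_add_neg]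

/-- The number of summands is given in binary, so it may be exponential in the size of the input. -/
theorem PS.sum {w : γ → ℕ → Bool × Bool} (hw : PS E fun x : γ × ℕ => w x.1 x.2) {c : δ → γ}
    {n : δ → ℕ} (hc : PS E c) (hn : PS E n) :
    PS E (fun x => ∑ r ∈ Finset.range (n x), sgn (w (c x) r)) := by
  have hs : PS E (sumStep w) := by
    have : PS E fun s : γ × ℕ × ℕ × ℤ => w s.1 s.2.2.1 :=
      hw.comp (f := fun s : γ × ℕ × ℕ × ℤ => (s.1, s.2.2.1)) (by fun_prop)
    unfold sumStep
    fun_prop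
  obtain ⟨p, hp⟩ := (hc.prodMk hn).size_le
  have : PS E fun x => (c x, n x, n x, ∑ r ∈ Finset.range (n x), sgn (w (c x) r)) := by
    refine PS.loop hs (i := fun x => (c x, n x, 0, 0)) (by fun_prop) (5 * p + 7) fun x => ?_
    have hx := hp x
    simp only [sz_prod] at hx
    refine dw_sumStep w (c x) (n x) ?_ (n x) 0 (by simp)
    simp only [Polynomial.eval_add, Polynomial.eval_mul, Polynomial.eval_ofNat]
    omega
  exact this.snd.snd.snd

end StackProg

namespace StackProg

variable {E : Ext} {α β γ δ : Type} [Data α] [Data β] [Data γ] [Data δ]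

/-! ### The evaluation of circuits by summation over paths -/

/-- Names of wires: numbers in binary. -/
abbrev Wire : Type := List Bool

/-- The value of a wire in the state that results from the zero state by flipping the wires of a
list one by one. -/
def val (log : List Wire) (w : Wire) : Bool := log.foldl (fun v w' => v ^^ decide (w' = w)) false

/-- Whether flipping the wires of the list leaves the zero state unchanged. -/
def isZero (log : List Wire) : Bool := log.foldl (fun ok w => ok && !val log w) true

/-- The effect of a gate on a path. A gate is given by the list of its wires: one for the Hadamard
gate, three for the Toffoli gate, the target being the first, and none for the projection to the
states in which the first wire has the value `1`. The components are the random bits, the flag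
whether the contribution of the path is nonzero, the flag whether it is negative, and the state. -/
def pathStep (s : List Bool × Bool × Bool × List Wire) (g : List Wire) :
    List Bool × Bool × Bool × List Wire :=
  cond g.isEmpty (s.1, s.2.1 && val s.2.2.2 [], s.2.2.1, s.2.2.2)
    (cond g.tail.isEmpty
      (s.1.tail, s.2.1, (s.2.2.1 ^^ (s.1.headD false && val s.2.2.2 (g.headD []))),
        cond (s.1.headD false ^^ val s.2.2.2 (g.headD [])) (g.headD [] :: s.2.2.2) s.2.2.2)
      (s.1, s.2.1, s.2.2.1,
        cond (val s.2.2.2 (g.tail.headD []) && val s.2.2.2 (g.tail.tail.headD []))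
          (g.headD [] :: s.2.2.2) s.2.2.2))

/-- The contribution of the path given by the random bits `r` to the amplitude. -/
def pathSign (c : List (List Wire) × List Wire × List Wire) (r : ℕ) : Bool × Bool :=
  let s := c.1.foldl pathStep (encodeNat r, true, false, c.2.1)
  (s.2.1 && isZero (s.2.2.2 ++ c.2.2), s.2.2.1)

/-- The binary representation of the number of paths. -/
def pathsWord (gs : List (List Wire)) : List Bool :=
  gs.foldl (fun l g => cond (!g.isEmpty && g.tail.isEmpty) (false :: l) l) [true]

/-- The number of Hadamard gates. -/
def hadCount (gs : List (List Wire)) : ℕ :=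
  gs.foldl (fun n g => cond (!g.isEmpty && g.tail.isEmpty) (n + 1) n) 0

/-- The sum of the contributions of all paths. -/
def pathCount (c : List (List Wire) × List Wire × List Wire) : ℤ :=
  ∑ r ∈ Finset.range (2 ^ hadCount c.1), sgn (pathSign c r)

theorem sz_headD_le (l : List α) (d : α) (hd : sz d = 1) : sz (l.headD d) ≤ sz l := by
  cases l with
  | nil => simp [hd]
  | cons a l => simp; omega

@[fun_prop]
theorem PS.val {f : α → List Wire} {g : α → Wire} (hf : PS E f) (hg : PS E g) :
    PS E (fun a => val (f a) (g a)) :=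
  PS.foldl (f := fun (w : Wire) v w' => (v ^^ decide (w' = w))) (by fun_prop) [] 3
    (fun c b a => by
      have := sz_bool_le (b ^^ decide (a = c))
      simp only [Polynomial.eval_ofNat]
      omega) hg (PS.const false) hf

@[fun_prop]
theorem PS.isZero {f : α → List Wire} (hf : PS E f) : PS E (fun a => isZero (f a)) :=
  PS.foldl (f := fun (log : List Wire) ok w => ok && !StackProg.val log w) (by fun_prop) [] 3
    (fun c b a => by
      have := sz_bool_le (b && !StackProg.val c a)
      simp only [Polynomial.eval_ofNat]
      omega) hf (PS.const true) hf

theorem sz_pathStep_le (s : List Bool × Bool × Bool × List Wire) (g : List Wire) :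
    sz (pathStep s g) ≤ sz s + sz g + 5 := by
  obtain ⟨r, al, ng, log⟩ := s
  have h₁ := sz_bool_le (al && val log [])
  have h₂ := sz_bool_le (ng ^^ (r.headD false && val log (g.headD [])))
  have h₃ := sz_headD_le g [] rfl
  have h₄ := one_le_sz al
  have h₅ := one_le_sz ng
  have h₆ := sz_tail_le r
  have h₇ : ∀ b, sz (cond b (g.headD [] :: log) log) ≤ sz log + sz g + 1 := by
    rintro (_ | _) <;> simp only [cond_true, cond_false, sz_cons] <;> omega
  have h₈ := h₇ (r.headD false ^^ val log (g.headD []))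
  have h₉ := h₇ (val log (g.tail.headD []) && val log (g.tail.tail.headD []))
  unfold pathStep
  cases g.isEmpty <;> cases g.tail.isEmpty <;> simp only [sz_prod, cond_true, cond_false] <;> omega

theorem PS.pathSign : PS E fun x : (List (List Wire) × List Wire × List Wire) × ℕ =>
    pathSign x.1 x.2 := by
  have hstep : PS E fun x : Unit × (List Bool × Bool × Bool × List Wire) × List Wire =>
      pathStep x.2.1 x.2.2 := by
    unfold pathStep
    fun_prop
  have : PS E fun x : (List (List Wire) × List Wire × List Wire) × ℕ =>
      x.1.1.foldl pathStep (Computability.encodeNat x.2, true, false, x.1.2.1) :=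
    PS.foldl (f := fun _ : Unit => pathStep) hstep [] (Polynomial.X + 5)
      (fun c b a => by
        have := sz_pathStep_le b a
        simp only [Polynomial.eval_add, Polynomial.eval_X, Polynomial.eval_ofNat]
        omega) (PS.const ()) (by fun_prop) (by fun_prop)
  unfold StackProg.pathSign
  fun_prop

/-- The lowest digit comes first, and zero is the empty word; hence the exception for `n = 0` when a
digit 0 is prepended. -/
theorem encodeNat_bit (n : ℕ) :
    encodeNat (2 * n + 1) = true :: encodeNat n ∧
      (n ≠ 0 → encodeNat (2 * n) = false :: encodeNat n) := by
  induction n with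
  | zero => exact ⟨encodeNat_succ 0, fun h => absurd rfl h⟩
  | succ n ih =>
    have h : encodeNat (2 * (n + 1)) = false :: encodeNat (n + 1) := by
      rw [show 2 * (n + 1) = (2 * n + 1) + 1 by ring, encodeNat_succ, ih.1, encodeNat_succ n]
      rfl
    exact ⟨by rw [encodeNat_succ, h]; rfl, fun _ => h⟩

theorem foldl_pathsWord (gs : List (List Wire)) (l : List Bool) (k n : ℕ)
    (h : l = List.replicate k false ++ encodeNat n) :
    gs.foldl (fun l g => cond (!g.isEmpty && g.tail.isEmpty) (false :: l) l) l =
      List.replicate (gs.foldl (fun n g => cond (!g.isEmpty && g.tail.isEmpty) (n + 1) n) k) false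
        ++ encodeNat n := by
  induction gs generalizing l k with
  | nil => exact h
  | cons g gs ih =>
    rw [List.foldl_cons, List.foldl_cons]
    cases !g.isEmpty && g.tail.isEmpty
    · exact ih l k h
    · exact ih _ (k + 1) (by rw [h]; rfl)

theorem encodeNat_two_pow (k : ℕ) :
    encodeNat (2 ^ k) = List.replicate k false ++ encodeNat 1 := by
  induction k with
  | zero => simp
  | succ k ih =>
    rw [pow_succ, mul_comm, (encodeNat_bit (2 ^ k)).2 (by positivity), ih]
    rfl

/-- Doubling prepends a digit 0, so the number of paths can be written down by a fold over the
gates, without computing a power. -/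
theorem encodeNat_two_pow_hadCount (gs : List (List Wire)) :
    encodeNat (2 ^ hadCount gs) = pathsWord gs := by
  rw [encodeNat_two_pow]
  exact (foldl_pathsWord gs [true] 0 1 rfl).symm

theorem PS.pathsWord : PS E pathsWord :=
  PS.foldl (f := fun (_ : Unit) l (g : List Wire) =>
    cond (!g.isEmpty && g.tail.isEmpty) (false :: l) l) (by fun_prop) [] 2
    (fun c b a => by
      cases (!a.isEmpty && a.tail.isEmpty) <;>
        simp only [sz_cons, sz_false, Polynomial.eval_ofNat, cond_true, cond_false] <;> omega)
    (PS.const ()) (PS.const [true]) PS.id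

theorem sz_incWord_le (l : List Bool) : sz (incWord l) ≤ sz l + 4 := by
  induction l with
  | nil => simp [incWord]
  | cons b l ih => cases b <;> simp [incWord] <;> omega

theorem sz_succ_le (n : ℕ) : sz (n + 1) ≤ sz n + 4 := by
  rw [sz_nat, sz_nat, encodeNat_succ]
  exact sz_incWord_le _

@[fun_prop]
theorem PS.hadCount : PS E hadCount :=
  PS.foldl (f := fun (_ : Unit) n (g : List Wire) =>
    cond (!g.isEmpty && g.tail.isEmpty) (n + 1) n) (by fun_prop) [] 4
    (fun c b a => by
      have := sz_succ_le b
      cases (!a.isEmpty && a.tail.isEmpty) <;>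
        simp only [Polynomial.eval_ofNat, cond_true, cond_false] <;> omega)
    (PS.const ()) (PS.const 0) PS.id

@[fun_prop]
theorem PS.pathCount : PS E pathCount := by
  have hn : PS E fun c : List (List Wire) × List Wire × List Wire =>
      2 ^ StackProg.hadCount c.1 := by
    refine (PS.pathsWord.comp (f := fun c : List (List Wire) × List Wire × List Wire => c.1)
      (by fun_prop)).congr fun c => ?_
    rw [← encodeNat_two_pow_hadCount]
    exact (enc_nat _).symm
  unfold StackProg.pathCount
  exact PS.sum PS.pathSign PS.id hn

/-! ### Parsing -/

/-- One step of splitting a text into words. -/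
def splitStep (s : List Bool × List (List Bool)) (o : Option Bool) : List Bool × List (List Bool) :=
  cond o.isSome (o.getD false :: s.1, s.2) ([], s.1.reverse :: s.2)

/-- The words of a text, each of which is terminated by `none`. -/
def textWords (t : List (Option Bool)) : List (List Bool) := (t.foldl splitStep ([], [])).2.reverse

@[fun_prop]
theorem PS.textWords : PS E textWords := by
  have : PS E fun t : List (Option Bool) => t.foldl splitStep ([], []) :=
    PS.foldl (f := fun _ : Unit => splitStep) (by unfold splitStep; fun_prop) none 4
      (fun c b a => by
        obtain ⟨cur, out⟩ := b
        cases a with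
        | none => simp [splitStep, sz_reverse]; omega
        | some b =>
          have := sz_bool_le b
          simp [splitStep]
          omega) (PS.const ()) (PS.const _) PS.id
  unfold StackProg.textWords
  fun_prop

theorem foldl_splitStep_word (w : List Bool) (cur : List Bool) (out : List (List Bool)) :
    (w.map some).foldl splitStep (cur, out) = (w.reverse ++ cur, out) := by
  induction w generalizing cur with
  | nil => rfl
  | cons b w ih =>
    rw [List.map_cons, List.foldl_cons]
    exact (ih (b :: cur)).trans (by simp)

/-- The text consisting of the given words. -/
def wordsText (ws : List (List Bool)) : List (Option Bool) := ws.flatMap fun w => w.map some ++ [none]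

theorem textWords_wordsText (ws : List (List Bool)) : textWords (wordsText ws) = ws := by
  have : ∀ out, (wordsText ws).foldl splitStep ([], out) = ([], ws.reverse ++ out) := by
    induction ws with
    | nil => intro out; rfl
    | cons w ws ih =>
      intro out
      have h : wordsText (w :: ws) = w.map some ++ none :: wordsText ws := by simp [wordsText]
      rw [h, List.foldl_append, foldl_splitStep_word, List.foldl_cons]
      exact (ih _).trans (by simp)
  simp [textWords, this]

/-- One step of grouping words to gates. -/
def gateStep (s : List Wire × List (List Wire)) (w : List Bool) : List Wire × List (List Wire) :=
  cond s.1.isEmpty (cond (w.headD false) ([w.tail], s.2) ([], [w.tail] :: s.2))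
    (cond s.1.tail.isEmpty (w :: s.1, s.2) ([], (w :: s.1) :: s.2))

/-- The gates given by a list of words. -/
def wordsGates (ws : List (List Bool)) : List (List Wire) := (ws.foldl gateStep ([], [])).2.reverse

@[fun_prop]
theorem PS.wordsGates : PS E wordsGates := by
  have : PS E fun ws : List (List Bool) => ws.foldl gateStep ([], []) :=
    PS.foldl (f := fun _ : Unit => gateStep) (by unfold gateStep; fun_prop) [] (Polynomial.X + 5)
      (fun c b a => by
        obtain ⟨pend, out⟩ := b
        have h₁ := sz_tail_le a
        have h₂ := one_le_sz pend
        unfold gateStep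
        cases pend.isEmpty <;> cases pend.tail.isEmpty <;> cases a.headD false <;>
          simp <;> omega) (PS.const ()) (PS.const _) PS.id
  unfold StackProg.wordsGates
  fun_prop

/-- The word list that describes a gate. -/
def gateWords : List Wire → List (List Bool)
  | [k] => [false :: k]
  | [c, b, a] => [true :: a, b, c]
  | _ => []

/-- In the text the type bit of a gate is glued to the name of its first wire. If it is false, the
gate is complete; otherwise two more words are awaited. Prepending them puts the target of a Toffoli
gate first. -/
theorem wordsGates_gateWords (gs : List (List Wire))
    (h : ∀ g ∈ gs, g.length = 1 ∨ g.length = 3) : wordsGates (gs.flatMap gateWords) = gs := by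
  have : ∀ out, (gs.flatMap gateWords).foldl gateStep ([], out) = ([], gs.reverse ++ out) := by
    induction gs with
    | nil => intro out; rfl
    | cons g gs ih =>
      intro out
      specialize ih fun g hg => h g (by simp [hg])
      rw [List.flatMap_cons, List.foldl_append]
      rcases h g (by simp) with hg | hg
      · obtain ⟨k, rfl⟩ := List.length_eq_one_iff.1 hg
        exact (ih ([k] :: out)).trans (by simp)
      · obtain ⟨c, b, a, rfl⟩ := List.length_eq_three.1 hg
        exact (ih ([c, b, a] :: out)).trans (by simp)
  simp [wordsGates, this]

/-- One step of listing the wires with value `1`. -/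
def onesStep (s : ℕ × List Wire) (b : Bool) : ℕ × List Wire :=
  (s.1 + 1, cond b (encodeNat s.1 :: s.2) s.2)

/-- The wires with value `1` in a basis state. -/
def ones (x : List Bool) : List Wire := (x.foldl onesStep (0, [])).2

/-- The increment depends on the position, which is part of the accumulator, so `PS.foldl` does not
apply. The quadratic bound allows for one name of linear size per position. -/
theorem sz_foldl_onesStep_le (x : List Bool) (k : ℕ) (out : List Wire) :
    sz (x.foldl onesStep (k, out)) ≤
      sz out + (x.length + 1) * (4 * (k + x.length) + 2) := by
  induction x generalizing k out with
  | nil =>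
    have := sz_word_le (encodeNat k)
    rw [length_encodeNat] at this
    have h := Nat.size_le_size (le_refl k)
    have h' : k.size ≤ k := by
      rw [Nat.size_le]
      exact Nat.lt_two_pow_self
    have := sz_nat k
    simp
    omega
  | cons b x ih =>
    have h₁ := ih (k + 1) (cond b (encodeNat k :: out) out)
    have h₂ : sz (cond b (encodeNat k :: out) out) ≤ sz out + (4 * k + 2) := by
      have := sz_word_le (encodeNat k)
      rw [length_encodeNat] at this
      have h' : k.size ≤ k := by
        rw [Nat.size_le]
        exact Nat.lt_two_pow_self
      cases b <;> simp
      omega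
    refine h₁.trans ?_
    simp only [List.length_cons]
    nlinarith

@[fun_prop]
theorem PS.ones : PS E ones := by
  have : PS E fun x : List Bool => x.foldl onesStep (0, []) := by
    refine PS.foldl_of_le (f := fun _ : Unit => onesStep) (by unfold onesStep; fun_prop) false
      (PS.const ()) (PS.const _) PS.id (1 + (Polynomial.X + 1) * (4 * Polynomial.X + 2))
      fun x l₁ l₂ hx => ?_
    refine (sz_foldl_onesStep_le l₁ 0 []).trans ?_
    have h : l₁.length ≤ sz x := by
      have h₁ := length_le_sz x
      rw [hx, List.length_append] at h₁
      rw [hx]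
      omega
    simp only [sz_nil, Polynomial.eval_add, Polynomial.eval_mul, Polynomial.eval_one,
      Polynomial.eval_X, Polynomial.eval_ofNat, Nat.zero_add]
    gcongr
  unfold StackProg.ones
  fun_prop

/-! ### The output -/

/-- The text that describes an integer and a natural number. -/
def resultText (z : ℤ) (e : ℕ) : List (Option Bool) :=
  some (decide (z < 0)) :: wordsText [encodeNat z.natAbs, encodeNat e]

@[fun_prop]
theorem PS.resultText {f : α → ℤ} {g : α → ℕ} (hf : PS E f) (hg : PS E g) :
    PS E (fun a => resultText (f a) (g a)) := by
  have h₁ := PS.map_some false hf.natAbs.encodeNat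
  have h₂ := PS.map_some false hg.encodeNat
  unfold StackProg.resultText
  simp only [wordsText, List.flatMap_cons, List.flatMap_nil]
  fun_prop

/-- The sum of the contributions of all paths, and the exponent of `√2` in the normalization, for
the amplitude problem given by the basis state, the input, the number of qubits, and the gates. -/
def amplitude (ws : List (List Bool)) : ℤ × ℕ :=
  let gs := wordsGates ws.tail.tail.tail
  (pathCount (gs, ones (ws.tail.headD []), ones (ws.headD [])), hadCount gs)

@[fun_prop]
theorem PS.amplitude : PS E amplitude := by
  unfold StackProg.amplitude
  fun_prop

/-- The sum of the contributions of all paths, and the exponent of `2` in the normalization, for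
the acceptance probability of the circuit with gates `gs` on input `x`. -/
def probability (gs : List (List Wire)) (x : List Bool) : ℤ × ℕ :=
  (pathCount (gs ++ [] :: gs.reverse, ones x, ones x), hadCount gs)

end StackProg

namespace StackProg

/-! ### Correctness of the summation over paths -/

/-- The sum of the contributions of all paths that start in the state given by `log`. -/
def pathRec : List (List Wire) → List Wire → List Wire → ℤ
  | [], log, t => cond (isZero (log ++ t)) 1 0
  | g :: gs, log, t =>
    cond g.isEmpty (cond (val log []) (pathRec gs log t) 0)
      (cond g.tail.isEmpty
        (pathRec gs (cond (val log (g.headD [])) (g.headD [] :: log) log) t +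
          cond (val log (g.headD [])) (-1) 1 *
            pathRec gs (cond (!val log (g.headD [])) (g.headD [] :: log) log) t)
        (pathRec gs (cond (val log (g.tail.headD []) && val log (g.tail.tail.headD []))
          (g.headD [] :: log) log) t))

theorem hadCount_cons (g : List Wire) (gs : List (List Wire)) :
    hadCount (g :: gs) = hadCount gs + cond (!g.isEmpty && g.tail.isEmpty) 1 0 := by
  have h : ∀ (gs : List (List Wire)) n k,
      gs.foldl (fun n g => cond (!g.isEmpty && g.tail.isEmpty) (n + 1) n) (n + k) =
      gs.foldl (fun n g => cond (!g.isEmpty && g.tail.isEmpty) (n + 1) n) n + k := by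
    intro gs
    induction gs with
    | nil => intros; rfl
    | cons g gs ih =>
      intro n k
      rw [List.foldl_cons, List.foldl_cons]
      cases (!g.isEmpty && g.tail.isEmpty)
      · exact ih n k
      · simp only [cond_true]
        rw [show n + k + 1 = (n + 1) + k by ring, ih]
  unfold hadCount
  rw [List.foldl_cons]
  cases (!g.isEmpty && g.tail.isEmpty)
  · rfl
  · exact h gs 0 1

theorem sum_range_two_mul {M : Type*} [AddCommMonoid M] (f : ℕ → M) (n : ℕ) :
    ∑ r ∈ Finset.range (2 * n), f r = ∑ r ∈ Finset.range n, (f (2 * r) + f (2 * r + 1)) := by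
  induction n with
  | zero => simp
  | succ n ih =>
    rw [show 2 * (n + 1) = 2 * n + 1 + 1 by ring, Finset.sum_range_succ, Finset.sum_range_succ, ih,
      Finset.sum_range_succ, add_assoc]

/-- The contribution of a path that starts in an arbitrary state. -/
def pathSignFrom (s : List Bool × Bool × Bool × List Wire) (t : List Wire)
    (gs : List (List Wire)) : Bool × Bool :=
  let s' := gs.foldl pathStep s
  (s'.2.1 && isZero (s'.2.2.2 ++ t), s'.2.2.1)

/-- A Hadamard gate reads the lowest digit of `r` and leaves the other digits to the later gates, so
separating even and odd `r` yields the two branches of `pathRec`. The flags are arbitrary since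
earlier gates have already acted; they give the common factor `sgn (al, ng)`. -/
theorem sum_pathSignFrom (gs : List (List Wire)) (al ng : Bool) (log t : List Wire) :
    ∑ r ∈ Finset.range (2 ^ hadCount gs), sgn (pathSignFrom (encodeNat r, al, ng, log) t gs) =
      sgn (al, ng) * pathRec gs log t := by
  induction gs generalizing al ng log with
  | nil =>
    have : hadCount [] = 0 := rfl
    rw [this, pow_zero, Finset.sum_range_one, pathRec, pathSignFrom, List.foldl_nil, sgn, sgn]
    cases al <;> cases ng <;> cases isZero (log ++ t) <;> rfl
  | cons g gs ih =>
    have hcons : ∀ s, pathSignFrom s t (g :: gs) = pathSignFrom (pathStep s g) t gs := fun _ => rfl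
    simp only [hcons]
    rw [hadCount_cons, pathRec]
    unfold pathStep
    cases g.isEmpty with
    | true =>
      simp only [Bool.not_true, Bool.false_and, cond_false, cond_true, add_zero]
      rw [ih]
      cases al <;> cases val log [] <;> simp [sgn]
    | false =>
      cases g.tail.isEmpty with
      | false =>
        simp only [Bool.not_false, Bool.true_and, cond_false, add_zero]
        rw [ih]
      | true =>
        simp only [Bool.not_false, Bool.and_true, cond_false, cond_true]
        rw [pow_succ, mul_comm, sum_range_two_mul, Finset.sum_add_distrib]
        -- This includes `r = 0`, where the word is empty and the defaults of `headD` and `tail`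
        -- supply the missing zeros.
        have h₀ : ∀ r, (encodeNat (2 * r)).headD false = false ∧
            (encodeNat (2 * r)).tail = encodeNat r := by
          intro r
          by_cases hr : r = 0
          · subst hr; exact ⟨rfl, rfl⟩
          · rw [(encodeNat_bit r).2 hr]; exact ⟨rfl, rfl⟩
        simp only [h₀, (encodeNat_bit _).1, List.headD_cons, List.tail_cons, Bool.false_and,
          Bool.xor_false, Bool.false_xor, Bool.true_and, Bool.true_xor]
        rw [ih, ih]
        cases al <;> cases ng <;> cases val log (g.headD []) <;> simp [sgn] <;> ring

theorem pathCount_eq (gs : List (List Wire)) (log t : List Wire) :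
    pathCount (gs, log, t) = pathRec gs log t := by
  have := sum_pathSignFrom gs true false log t
  simp only [sgn, cond_true, cond_false, one_mul] at this
  exact this

/-! ### States as lists of flips -/

/-- The value of a wire is the parity of the number of its occurrences, so a flip may be added at
either end of the list. -/
theorem val_cons (v : Wire) (log : List Wire) (w : Wire) :
    val (v :: log) w = (val log w ^^ decide (v = w)) := by
  have h : ∀ (log : List Wire) (b c : Bool),
      log.foldl (fun v w' => v ^^ decide (w' = w)) (b ^^ c) =
        (log.foldl (fun v w' => v ^^ decide (w' = w)) b ^^ c) := by
    intro log
    induction log with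
    | nil => intros; rfl
    | cons u log ih =>
      intro b c
      rw [List.foldl_cons, List.foldl_cons, ← ih]
      congr 1
      cases b <;> cases c <;> cases decide (u = w) <;> rfl
  exact h log false _

theorem val_append (l₁ l₂ : List Wire) (w : Wire) : val (l₁ ++ l₂) w = (val l₁ w ^^ val l₂ w) := by
  induction l₁ with
  | nil => exact (Bool.false_xor _).symm
  | cons v l ih =>
    rw [List.cons_append, val_cons, val_cons, ih]
    cases val l w <;> cases val l₂ w <;> cases decide (v = w) <;> rfl

theorem isZero_eq_true_iff (log : List Wire) : isZero log = true ↔ ∀ w ∈ log, val log w = false := by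
  have h : ∀ (l : List Wire) (b : Bool), l.foldl (fun ok w => ok && !val log w) b = true ↔
      b = true ∧ ∀ w ∈ l, val log w = false := by
    intro l
    induction l with
    | nil => simp
    | cons w l ih =>
      intro b
      rw [List.foldl_cons, ih]
      simp [and_assoc]
  rw [isZero, h]
  simp

variable {S : ℕ}

/-- The list `log` of flips leads to the basis state `b`. -/
def Rep (log : List Wire) (b : Fin S → Bool) : Prop :=
  (∀ l : Fin S, val log (encodeNat l) = b l) ∧ ∀ w ∈ log, ∃ l : Fin S, w = encodeNat l

theorem encodeNat_fin_eq_iff {k l : Fin S} : encodeNat k = encodeNat l ↔ k = l := by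
  rw [encodeNat_injective.eq_iff, Fin.ext_iff]

/-- Setting qubit `k` to `c` is a flip exactly when it has the other value. Both gates change basis
states in this way. -/
theorem Rep.flip {log : List Wire} {b : Fin S → Bool} (h : Rep log b) (k : Fin S) (c : Bool) :
    Rep (cond (c ^^ b k) (encodeNat k :: log) log) (Function.update b k c) := by
  cases hc : c ^^ b k with
  | false =>
    have : c = b k := by cases c <;> cases hb : b k <;> simp_all
    rw [this, Function.update_eq_self]
    exact h
  | true =>
    refine ⟨fun l => ?_, fun w hw => ?_⟩
    · rw [cond_true, val_cons, h.1]
      by_cases hl : k = l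
      · subst hl
        rw [Function.update_self]
        cases c <;> cases hb : b k <;> simp_all
      · rw [Function.update_of_ne (Ne.symm hl)]
        simp [encodeNat_fin_eq_iff, hl]
    · rcases List.mem_cons.1 hw with rfl | hw
      · exact ⟨k, rfl⟩
      · exact h.2 w hw

/-- Concatenating lists of flips adds the states modulo 2, and the sum vanishes exactly if the
states agree. Testing the wires that occur is enough, since all others are zero in both states. -/
theorem Rep.isZero_append {log t : List Wire} {b b' : Fin S → Bool} (h : Rep log b)
    (h' : Rep t b') : isZero (log ++ t) = decide (b' = b) := by
  rw [Bool.eq_iff_iff, isZero_eq_true_iff, decide_eq_true_iff]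
  constructor
  · intro hz
    funext l
    by_cases hl : encodeNat l ∈ log ++ t
    · have := hz _ hl
      rw [val_append, h.1, h'.1] at this
      cases hb : b l <;> cases hb' : b' l <;> simp_all
    · have h₀ : ∀ l' : List Wire, encodeNat l ∉ l' → val l' (encodeNat l) = false := by
        intro l' hl'
        induction l' with
        | nil => rfl
        | cons v l' ih =>
          simp only [List.mem_cons, not_or] at hl'
          rw [val_cons, ih hl'.2]
          simpa using Ne.symm hl'.1
      rw [List.mem_append, not_or] at hl
      rw [← h.1, ← h'.1, h₀ _ hl.1, h₀ _ hl.2]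
  · rintro rfl w hw
    obtain ⟨l, rfl⟩ : ∃ l : Fin S, w = encodeNat l :=
      (List.mem_append.1 hw).elim (h.2 w) (h'.2 w)
    rw [val_append, h.1, h'.1, Bool.xor_self]

/-- The gates, and the projection to the states with value `1` at the wire `z`, which is denoted by
`none`. -/
noncomputable def opMatrix (z : Fin S) : Option (QGate S) → Matrix (Fin S → Bool) (Fin S → Bool) ℂ
  | none => Matrix.diagonal fun i => if i z = true then 1 else 0
  | some g => g.matrix

/-- The wires of an operation. -/
def opWires : Option (QGate S) → List Wire
  | none => []
  | some (.had k) => [encodeNat k]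
  | some (.toffoli a b c _ _ _) => [encodeNat c, encodeNat b, encodeNat a]

/-- The column of the gate at `b` is supported on the two states that agree with `b` off qubit `k`.
-/
theorem sum_mul_had (k : Fin S) (F : (Fin S → Bool) → ℂ) (b : Fin S → Bool) :
    ∑ j, F j * (QGate.had k).matrix j b =
      F (Function.update b k false) * hadamardMatrix false (b k) +
        F (Function.update b k true) * hadamardMatrix true (b k) := by
  have hne : Function.update b k false ≠ Function.update b k true := fun h => by
    have := congrFun h k
    simp at this
  have hm : ∀ c, (QGate.had k).matrix (Function.update b k c) b = hadamardMatrix c (b k) := by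
    intro c
    have : ∀ l, l ≠ k → Function.update b k c l = b l := fun l hl => Function.update_of_ne hl _ _
    simp only [QGate.matrix, Function.update_self]
    rw [if_pos this]
  rw [Fintype.sum_eq_add _ _ hne, hm, hm]
  rintro j ⟨h₀, h₁⟩
  have : ¬ ∀ l, l ≠ k → j l = b l := fun h => by
    have hj : j = Function.update b k (j k) := by
      funext l
      by_cases hl : l = k
      · subst hl; simp
      · rw [Function.update_of_ne hl, h l hl]
    cases hjk : j k
    · exact h₀ (by rw [← hjk]; exact hj)
    · exact h₁ (by rw [← hjk]; exact hj)
  simp only [QGate.matrix]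
  rw [if_neg this, mul_zero]

/-- The gate permutes the basis states, so its column at `b` has a single entry 1. -/
theorem sum_mul_toffoli (a₁ a₂ k : Fin S) (h₁ h₂ h₃) (F : (Fin S → Bool) → ℂ) (b : Fin S → Bool) :
    ∑ j, F j * (QGate.toffoli a₁ a₂ k h₁ h₂ h₃).matrix j b =
      F (Function.update b k ((b a₁ && b a₂) ^^ b k)) := by
  rw [Fintype.sum_eq_single (Function.update b k ((b a₁ && b a₂) ^^ b k))]
  · have : ∀ l, l ≠ a₁ → l ≠ a₂ → l ≠ k →
        Function.update b k ((b a₁ && b a₂) ^^ b k) l = b l :=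
      fun l _ _ hl => Function.update_of_ne hl _ _
    simp only [QGate.matrix]
    rw [if_pos this, toffoliMatrix, if_pos, mul_one]
    simp [Function.update_of_ne h₂, Function.update_of_ne h₃, Bool.xor_comm]
  · intro j hj
    simp only [QGate.matrix]
    by_cases h : ∀ l, l ≠ a₁ → l ≠ a₂ → l ≠ k → j l = b l
    · rw [if_pos h, toffoliMatrix, if_neg, mul_zero]
      intro he
      simp only [Prod.mk.injEq] at he
      refine hj (funext fun l => ?_)
      by_cases hl : l = k
      · subst hl
        rw [Function.update_self, he.2.2, Bool.xor_comm]
      · rw [Function.update_of_ne hl]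
        by_cases hl₁ : l = a₁
        · rw [hl₁, he.1]
        · by_cases hl₂ : l = a₂
          · rw [hl₂, he.2.1]
          · exact h l hl₁ hl₂ hl
    · rw [if_neg h, mul_zero]

theorem encodeNat_zero : encodeNat 0 = [] := rfl

/-- Induction on the operations, the first one being the rightmost factor of the product. Each
Hadamard gate contributes a factor √2 that cancels the 1/√2 of its entries, so only integers remain.
The wire `z` has number 0 because the projection tests the wire with the empty name, which is
`encodeNat 0`. -/
theorem pathRec_eq (z : Fin S) (hz : (z : ℕ) = 0) (xs : List (Option (QGate S)))
    {log t : List Wire} {b b' : Fin S → Bool} (h : Rep log b) (h' : Rep t b') :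
    (pathRec (xs.map opWires) log t : ℂ) =
      (Real.sqrt 2 : ℂ) ^ hadCount (xs.map opWires) *
        ((xs.map (opMatrix z)).reverse.prod) b' b := by
  have h2 : (Real.sqrt 2 : ℂ) ≠ 0 := by
    rw [Ne, Complex.ofReal_eq_zero]
    positivity
  induction xs generalizing log b with
  | nil =>
    simp only [List.map_nil, pathRec, h.isZero_append h', List.reverse_nil, List.prod_nil,
      Matrix.one_apply]
    rw [show hadCount [] = 0 from rfl]
    by_cases hb : b' = b <;> simp [hb]
  | cons x xs ih =>
    have hprod : (((x :: xs).map (opMatrix z)).reverse.prod) b' b =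
        ∑ j, ((xs.map (opMatrix z)).reverse.prod) b' j * opMatrix z x j b := by
      rw [List.map_cons, List.reverse_cons, List.prod_append, List.prod_singleton, Matrix.mul_apply]
    rw [hprod, List.map_cons, hadCount_cons]
    match x with
    | none =>
      have hv : val log [] = b z := by rw [← h.1 z, hz, encodeNat_zero]
      have hs : ∑ j, ((xs.map (opMatrix z)).reverse.prod) b' j * opMatrix z none j b =
          ((xs.map (opMatrix z)).reverse.prod) b' b * if b z = true then 1 else 0 := by
        rw [Fintype.sum_eq_single b]
        · simp [opMatrix]
        · intro j hj
          simp [opMatrix, Matrix.diagonal_apply_ne _ hj]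
      rw [hs]
      simp only [opWires, pathRec, List.isEmpty_nil, cond_true, hv, Bool.not_true, Bool.false_and,
        cond_false, add_zero]
      cases b z with
      | true => simpa using ih h
      | false => simp
    | some (.had k) =>
      have hv : val log (encodeNat k) = b k := h.1 k
      have h₀ := ih (h.flip k false)
      have h₁ := ih (h.flip k true)
      simp only [opMatrix]
      rw [sum_mul_had]
      simp only [opWires, pathRec, List.isEmpty_cons, List.tail_cons, List.isEmpty_nil, cond_false,
        cond_true, List.headD_cons, hv, Bool.not_false, Bool.and_true]
      simp only [Bool.false_xor, Bool.true_xor] at h₀ h₁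
      push_cast
      rw [h₀, h₁, pow_succ]
      cases b k with
      | true =>
        simp only [hadamardMatrix, Bool.and_true, Bool.false_eq_true, if_false, if_true, cond_true]
        field_simp
        push_cast
        ring
      | false =>
        simp only [hadamardMatrix, Bool.and_false, Bool.false_eq_true, if_false, cond_false]
        field_simp
        push_cast
        ring
    | some (.toffoli a₁ a₂ k h₁ h₂ h₃) =>
      have hf := ih (h.flip k ((b a₁ && b a₂) ^^ b k))
      simp only [opMatrix]
      rw [sum_mul_toffoli]
      simp only [opWires, pathRec, List.isEmpty_cons, List.tail_cons, cond_false,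
        List.headD_cons, h.1, Bool.not_false, Bool.and_false, add_zero]
      rw [Bool.xor_assoc, Bool.xor_self, Bool.xor_false] at hf
      rw [Bool.and_comm (b a₂), hf]

theorem rep_ones (x : List Bool) (hx : x.length ≤ S) :
    Rep (ones x) (fun l : Fin S => x.getD l false) := by
  have h₁ : ∀ (x : List Bool) (k : ℕ) (out : List Wire) (j : ℕ),
      val (x.foldl onesStep (k, out)).2 (encodeNat j) =
        (val out (encodeNat j) ^^ (decide (k ≤ j) && x.getD (j - k) false)) := by
    intro x
    induction x with
    | nil => simp
    | cons b x ih =>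
      intro k out j
      rw [List.foldl_cons, onesStep, ih]
      have hc : val (cond b (encodeNat k :: out) out) (encodeNat j) =
          (val out (encodeNat j) ^^ (decide (k = j) && b)) := by
        cases b
        · simp
        · simp [val_cons, encodeNat_injective.eq_iff]
      simp only [hc]
      rcases lt_trichotomy k j with h | h | h
      · have e : j - k = (j - (k + 1)) + 1 := by omega
        simp [h.ne, show k + 1 ≤ j from h, h.le, e]
      · subst h
        simp
      · simp [h.ne', show ¬ k + 1 ≤ j by omega, show ¬ k ≤ j by omega]
  have h₂ : ∀ (x : List Bool) (k : ℕ) (out : List Wire) (w : Wire),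
      w ∈ (x.foldl onesStep (k, out)).2 → w ∈ out ∨ ∃ j < k + x.length, w = encodeNat j := by
    intro x
    induction x with
    | nil => intro k out w h; exact .inl h
    | cons b x ih =>
      intro k out w h
      rcases ih _ _ w h with h | ⟨j, hj, rfl⟩
      · cases b
        · exact .inl h
        · rcases List.mem_cons.1 h with rfl | h
          · exact .inr ⟨k, by simp, rfl⟩
          · exact .inl h
      · exact .inr ⟨j, by simp; omega, rfl⟩
  refine ⟨fun l => ?_, fun w hw => ?_⟩
  · rw [ones, h₁]
    simp [val]
  · rcases h₂ x 0 [] w hw with h | ⟨j, hj, rfl⟩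
    · simp at h
    · exact ⟨⟨j, by omega⟩, rfl⟩

/-! ### Amplitudes and acceptance probabilities of circuits -/

variable {n : ℕ} (C : QCircuit n) (x : Fin n → Bool)

theorem finalState_eq (i : Fin C.width → Bool) :
    C.finalState x i = C.unitary i (C.initIndex x) := by
  rw [QCircuit.finalState, Matrix.mulVec_single_one]
  rfl

/-- The gates of a circuit as operations. -/
def circuitOps : List (Option (QGate C.width)) := C.gates.map some

theorem prod_circuitOps (z : Fin C.width) :
    ((circuitOps C).map (opMatrix z)).reverse.prod = C.unitary := by
  rw [circuitOps, List.map_map, QCircuit.unitary]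
  rfl

theorem rep_init : Rep (ones (List.ofFn x)) (C.initIndex x) := by
  have h := rep_ones (S := C.width) (List.ofFn x) (by simpa using C.input_le)
  convert h using 1
  funext l
  rw [QCircuit.initIndex]
  by_cases hl : (l : ℕ) < n <;> simp [hl]

theorem rep_ofFn (i : Fin S → Bool) : Rep (ones (List.ofFn i)) i := by
  have h := rep_ones (S := S) (List.ofFn i) (by simp)
  convert h using 1
  funext l
  simp

theorem finalState_eq_pathCount (i : Fin C.width → Bool) :
    C.finalState x i = (pathCount ((circuitOps C).map opWires, ones (List.ofFn x),
      ones (List.ofFn i)) : ℂ) / (Real.sqrt 2 : ℂ) ^ hadCount ((circuitOps C).map opWires) := by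
  have h2 : (Real.sqrt 2 : ℂ) ≠ 0 := by
    rw [Ne, Complex.ofReal_eq_zero]
    positivity
  rw [pathCount_eq, pathRec_eq ⟨0, C.width_pos⟩ rfl _ (rep_init C x) (rep_ofFn i),
    prod_circuitOps, finalState_eq]
  field_simp

theorem hadCount_append (gs gs' : List (List Wire)) :
    hadCount (gs ++ gs') = hadCount gs + hadCount gs' := by
  induction gs with
  | nil => exact (Nat.zero_add _).symm
  | cons g gs ih =>
    rw [List.cons_append, hadCount_cons, hadCount_cons, ih]
    omega

theorem hadCount_reverse (gs : List (List Wire)) : hadCount gs.reverse = hadCount gs := by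
  induction gs with
  | nil => rfl
  | cons g gs ih =>
    rw [List.reverse_cons, hadCount_append, ih, hadCount_cons g gs, hadCount_cons g []]
    rw [show hadCount [] = 0 from rfl, Nat.zero_add]

/-! ### Symmetry of the gates, and the acceptance probability as a matrix entry -/

theorem hadamardMatrix_comm (i j : Bool) : hadamardMatrix i j = hadamardMatrix j i := by
  rw [hadamardMatrix, hadamardMatrix, Bool.and_comm]

theorem toffoliMatrix_comm (i j : Bool × Bool × Bool) : toffoliMatrix i j = toffoliMatrix j i := by
  rw [toffoliMatrix, toffoliMatrix]
  congr 1
  revert i j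
  decide

/-- Needed so that reversing the list of gates transposes the matrix of the circuit. For the Toffoli
gate the reason is that it is an involutive permutation. -/
theorem matrix_transpose (g : QGate S) : g.matrix.transpose = g.matrix := by
  ext i j
  cases g with
  | had k =>
    exact if_congr (forall_congr' fun l => imp_congr_right fun _ => eq_comm)
      (hadamardMatrix_comm _ _) rfl
  | toffoli a b c _ _ _ =>
    exact if_congr (forall_congr' fun l => imp_congr_right fun _ => imp_congr_right fun _ =>
      imp_congr_right fun _ => eq_comm) (toffoliMatrix_comm _ _) rfl

theorem matrix_conj (g : QGate S) (i j : Fin S → Bool) : (starRingEnd ℂ) (g.matrix i j) = g.matrix i j := by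
  cases g with
  | had k =>
    simp only [QGate.matrix, hadamardMatrix]
    split_ifs <;> simp
  | toffoli a b c _ _ _ =>
    simp only [QGate.matrix, toffoliMatrix]
    split_ifs <;> simp

theorem unitary_conj (i j : Fin C.width → Bool) :
    (starRingEnd ℂ) (C.unitary i j) = C.unitary i j := by
  have h : ∀ M ∈ (C.gates.map QGate.matrix).reverse, ∀ i j, (starRingEnd ℂ) (M i j) = M i j := by
    intro M hM
    simp only [List.mem_reverse, List.mem_map] at hM
    obtain ⟨g, -, rfl⟩ := hM
    exact matrix_conj g
  revert i j
  refine List.prod_induction (fun M : Matrix _ _ ℂ => ∀ i j, (starRingEnd ℂ) (M i j) = M i j)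
    (fun M N hM hN i j => ?_) (fun i j => ?_) h
  · simp only [Matrix.mul_apply, map_sum, map_mul, hM, hN]
  · rw [Matrix.one_apply]
    split_ifs <;> simp

/-- Let U be the matrix of the circuit and P the projection to the value 1 of the first qubit. As U
is real, the probability is the entry of Uᵀ P U at the start state, and Uᵀ belongs to the reversed
list of gates. So the sum runs over paths that go forward, pass the projection, and return to the
start. The Hadamard gates occur twice, which turns √2 into 2. -/
theorem acceptProb_eq_pathCount :
    ((C.acceptProb x : ℝ) : ℂ) =
      (pathCount ((circuitOps C).map opWires ++ [] :: ((circuitOps C).map opWires).reverse,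
        ones (List.ofFn x), ones (List.ofFn x)) : ℂ) /
          2 ^ hadCount ((circuitOps C).map opWires) := by
  have h2 : (Real.sqrt 2 : ℂ) ^ 2 = 2 := by
    rw [← Complex.ofReal_pow, Real.sq_sqrt (by norm_num)]
    norm_num
  set z : Fin C.width := ⟨0, C.width_pos⟩ with hz
  set b := C.initIndex x with hb
  have hops : (circuitOps C).map opWires ++ [] :: ((circuitOps C).map opWires).reverse =
      (circuitOps C ++ none :: (circuitOps C).reverse).map opWires := by
    simp [opWires]
  have hh : hadCount ((circuitOps C).map opWires ++ [] :: ((circuitOps C).map opWires).reverse) =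
      2 * hadCount ((circuitOps C).map opWires) := by
    rw [hadCount_append, hadCount_cons, hadCount_reverse]
    simp
    ring
  have hprod : ((circuitOps C ++ none :: (circuitOps C).reverse).map (opMatrix z)).reverse.prod =
      C.unitary.transpose * opMatrix z none * C.unitary := by
    have ht : C.unitary.transpose = ((circuitOps C).map (opMatrix z)).prod := by
      rw [QCircuit.unitary, Matrix.transpose_list_prod, List.map_reverse, List.reverse_reverse,
        List.map_map, circuitOps, List.map_map]
      congr 1
      exact List.map_congr_left fun g _ => matrix_transpose g
    rw [ht, ← prod_circuitOps C z]
    simp [mul_assoc]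
  have hent : (C.unitary.transpose * opMatrix z none * C.unitary) b b = (C.acceptProb x : ℂ) := by
    rw [QCircuit.acceptProb, Matrix.mul_apply]
    push_cast
    refine Finset.sum_congr rfl fun i _ => ?_
    rw [opMatrix, Matrix.mul_diagonal, Matrix.transpose_apply, finalState_eq, ← hb]
    by_cases hi : i z = true
    · have h := Complex.mul_conj' (C.unitary i b)
      rw [unitary_conj, ← Complex.ofReal_pow] at h
      rw [if_pos hi, if_pos hi, mul_one]
      exact h
    · rw [if_neg hi, if_neg hi]
      simp
  rw [pathCount_eq, hops, pathRec_eq z rfl _ (rep_init C x) (rep_init C x), ← hops, hh, hprod, hent,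
    pow_mul, h2]
  field_simp

/-- A matrix product as a sum over paths. -/
theorem sum_paths {ι R : Type*} [Fintype ι] [DecidableEq ι] [CommRing R] {T : ℕ}
    (M : Fin T → Matrix ι ι R) (a b : ι) :
    ∑ p : Fin (T + 1) → ι, (if p 0 = a ∧ p (Fin.last T) = b then
      ∏ j : Fin T, M j (p j.succ) (p j.castSucc) else 0) = (List.ofFn M).reverse.prod b a := by
  induction T generalizing a with
  | zero =>
    simp only [List.ofFn_zero, List.reverse_nil, List.prod_nil, Matrix.one_apply]
    rw [← (Equiv.funUnique (Fin 1) ι).symm.sum_comp, Fintype.sum_eq_single a]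
    · simp [eq_comm]
    · intro i hi
      simp [hi]
  | succ T ih =>
    rw [List.ofFn_succ, List.reverse_cons, List.prod_append, List.prod_singleton, Matrix.mul_apply]
    -- A path is its first state followed by a shorter path `p`. The first state must be `a`, and `p
    -- 0` is the summation index of the last matrix product.
    refine ((Fin.consEquiv fun _ : Fin (T + 2) => ι).sum_comp _).symm.trans ?_
    rw [Fintype.sum_prod_type, Fintype.sum_eq_single a]
    · simp only [← ih, Finset.sum_mul]
      rw [Finset.sum_comm]
      refine Finset.sum_congr rfl fun p _ => ?_
      rw [Fintype.sum_eq_single (p 0)]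
      · simp only [Fin.consEquiv_apply]
        rw [Fin.prod_univ_succ]
        have hl : (Fin.cons a p : Fin (T + 2) → ι) (Fin.last (T + 1)) = p (Fin.last T) := by
          rw [← Fin.succ_last, Fin.cons_succ]
        by_cases hp : p (Fin.last T) = b
        · simp [hl, hp, mul_comm]
        · simp [hl, hp]
      · intro j hj
        rw [if_neg (fun h => hj h.1.symm), zero_mul]
    · intro i hi
      refine Finset.sum_eq_zero fun p _ => ?_
      simp [hi]

theorem finalState_eq_pathSum (i : Fin C.width → Bool) : C.finalState x i = C.pathSum x i := by
  have h : List.ofFn (fun j => (C.gates.get j).matrix) = C.gates.map QGate.matrix := by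
    change List.ofFn (QGate.matrix ∘ C.gates.get) = _
    rw [← List.map_ofFn, List.ofFn_get]
  rw [finalState_eq, QCircuit.unitary, QCircuit.pathSum, ← h]
  exact (sum_paths (fun j => (C.gates.get j).matrix) (C.initIndex x) i).symm

end StackProg

namespace StackProg

/-! ### Input and output -/

section

variable {X : Type} [DecidableEq X] [Fintype X] {G : X → Type} {γ : Type} [Data γ]

/-- Push the symbols of a word onto stack `C`, one after the other. -/
def pushEach (G : X → Type) : List Symb → Cmd (Alph G)
  | [] => .skip
  | s :: w => .push (.base .C) s ;; pushEach G w

theorem run_pushEach (w a b c d : List Symb) (e : ∀ x, List (G x)) {B : ℕ}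
    (hB : w.length + a.length + b.length + c.length + d.length + ∑ x, (e x).length ≤ B) :
    Run (pushEach G w) (mk (bs a b c d) e) (mk (bs a b (w.reverse ++ c) d) e) B := by
  induction w generalizing c with
  | nil => exact .skip (by simpa using hB)
  | cons s w ih =>
    simp only [List.length_cons] at hB
    have h₁ := run_push .C s (s := bs a b c d) e (B := B) (by simp; omega)
    have h₂ := ih (s :: c) (by simp; omega)
    simp only [update_bs_C, bs_C] at h₁
    have h := h₁.seq h₂
    simpa [pushEach] using h

/-- Replace the word on stack `x` by the tree on stack `A` that represents it. -/
def absorb {x : X} (ψ : G x → γ) : Cmd (Alph G) :=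
  .loop (Stk.ext x) (fun o => o = none)
    (fun o => o.elim .skip fun s => pushEach G (.node :: (enc (ψ s)).ser)) ;;
  .push (.base .C) .nil ;; mv G .C .A

theorem sum_update (e : ∀ x, List (G x)) (x : X) (l : List (G x)) :
    ∑ y, (Function.update e x l y).length + (e x).length = ∑ y, (e y).length + l.length :=
  size_update e x l

/-- The prefix code of a list consists of the codes of its entries, each preceded by `node`, and a
final `nil`; so it can be written while the word is read. It is collected on `C` in reverse and then
moved to `A`. `K` bounds the code of one letter. -/
theorem run_absorb {x : X} (ψ : G x → γ) {K : ℕ} (hK : ∀ s, sz (ψ s) ≤ K) (w : List (G x))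
    (b : List Symb) (e : ∀ x, List (G x)) (he : e x = w) {B : ℕ}
    (hB : (K + 1) * w.length + b.length + ∑ x, (e x).length + 1 ≤ B) :
    Run (absorb ψ) (mk (bs [] b [] []) e)
      (mk (bs (enc (w.map ψ)).ser b [] []) (Function.update e x [])) B := by
  have hloop : ∀ (w : List (G x)) (c : List Symb) (e : ∀ x, List (G x)), e x = w →
      (K + 1) * w.length + c.length + b.length + ∑ x, (e x).length + 1 ≤ B →
      Run (.loop (Stk.ext x) (fun o => o = none)
        (fun o => o.elim .skip fun s => pushEach G (.node :: (enc (ψ s)).ser)) ;;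
        .push (.base .C) .nil) (mk (bs [] b c []) e)
        (mk (bs [] b ((enc (w.map ψ)).ser.reverse ++ c) []) (Function.update e x [])) B := by
    intro w
    induction w with
    | nil =>
      intro c e he hB
      have h₁ := Run.loop_exit (k := Stk.ext x) (exits := fun o => o = none)
        (f := fun o => o.elim .skip fun s => pushEach G (.node :: (enc (ψ s)).ser))
        (S := mk (bs [] b c []) e) (B := B) (by simp [he]) (by simp at hB ⊢; omega)
      have hs := sum_update e x []
      have h₂ := run_push .C .nil (s := bs [] b c []) (Function.update e x []) (B := B)
        (by simp at hB hs ⊢; omega)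
      simp only [update_mk_ext, mk_ext, he, List.tail_nil] at h₁
      simp only [update_bs_C, bs_C] at h₂
      exact h₁.seq h₂
    | cons s w ih =>
      intro c e he hB
      have hs := sum_update e x w
      simp only [he, List.length_cons, Nat.mul_succ] at hs hB
      have hk : (enc (ψ s)).ser.length ≤ K := hK s
      have h₁ := run_pushEach (G := G) (.node :: (enc (ψ s)).ser) [] b c [] (Function.update e x w)
        (B := B) (by simp; omega)
      have h₂ := ih ((.node :: (enc (ψ s)).ser).reverse ++ c) (Function.update e x w) (by simp)
        (by simp; omega)
      -- The run obtained by induction is taken apart, so that one round can be put in front of the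
      -- loop while the final push stays outside.
      cases h₂ with
      | seq h₂ h₃ =>
        refine Run.seq (Run.loop_step (by simp [he]) (by simp; omega) ?_ h₂) ?_
        · simpa [he] using h₁
        · simpa [Tr.ser] using h₃
  have h₁ := hloop w [] e he (by simpa using hB)
  have hl : ∀ w : List (G x), (enc (w.map ψ)).ser.length ≤ (K + 1) * w.length + 1 := by
    intro w
    induction w with
    | nil => simp [Tr.ser]
    | cons s w ih =>
      have hk : (enc (ψ s)).ser.length ≤ K := hK s
      simp only [List.map_cons, enc_cons, Tr.ser, List.length_cons, List.length_append,
        Nat.mul_succ]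
      omega
  have hl' := hl w
  have hs := sum_update e x []
  have h₂ := run_mv (G := G) (i := .C) (j := .A) (by decide) (enc (w.map ψ)).ser.reverse []
    (by simpa using Tr.mark_notMem_ser _) (.inl rfl)
    (s := bs [] b (enc (w.map ψ)).ser.reverse []) (by simp) (Function.update e x []) (B := B)
    (by simp at hs ⊢; omega)
  simp only [List.tail_nil, update_bs_C, update_bs_A, List.reverse_reverse, bs_A,
    List.append_nil] at h₁ h₂
  cases h₁ with
  | seq h₁ h₃ => exact h₁.seq (h₃.seq h₂)

/-- Replace the tree on stack `A`, which represents a word, by this word, reversed, on stack `x`. -/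
def emit {x : X} (φ : Option Bool → G x) : Cmd (Alph G) :=
  .loop (Stk.base .A) (fun o => !decide (o = some Symb.node)) fun _ => .pop (.base .A) fun o =>
    if o = some Symb.node then .pop (.base .A) fun o =>
      if o = some Symb.node then
        .pop (.base .A) fun _ => .pop (.base .A) fun _ => .pop (.base .A) fun _ =>
          .push (Stk.ext x) (φ (some true))
      else .pop (.base .A) fun _ => .push (Stk.ext x) (φ (some false))
    else .push (Stk.ext x) (φ none)

theorem run_push_ext (x : X) (y : G x) (s : Base → List Symb) (e : ∀ x, List (G x)) {B : ℕ}
    (hB : size (mk s e) + 1 ≤ B) :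
    Run (.push (Stk.ext x) y) (mk s e) (mk s (Function.update e x (y :: e x))) B := by
  simpa using Run.push (k := (Stk.ext x : Stk X)) (s := y) (S := mk s e) hB

/-- An entry is recognized by its prefix code: `nil` for `none`, `node nil nil` for `some false`,
`node node nil nil nil` for `some true`. Symbols are pushed as they are read, hence the reversal. -/
theorem run_emit {x : X} (φ : Option Bool → G x) (l : List (Option Bool)) (b : List Symb)
    (e : ∀ x, List (G x)) {B : ℕ} (hB : sz l + b.length + ∑ x, (e x).length ≤ B) :
    Run (emit φ) (mk (bs (enc l).ser b [] []) e)
      (mk (bs [] b [] []) (Function.update e x ((l.map φ).reverse ++ e x))) B := by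
  unfold emit
  induction l generalizing e with
  | nil =>
    simpa [Tr.ser] using run_loop_exit (G := G) .A (s := bs (enc ([] : List (Option Bool))).ser b [] [])
      (e := e) (exits := fun o => !decide (o = some Symb.node)) (by simp [Tr.ser])
      (by simp [Tr.ser] at hB ⊢; omega)
  | cons o l ih =>
    have hs := sum_update e x (φ o :: e x)
    have ho := one_le_sz o
    have hsl : (enc l).ser.length = sz l := rfl
    simp only [sz_cons, List.length_cons] at hB hs
    refine run_loop_step .A (S' := mk (bs (enc l).ser b [] []) (Function.update e x (φ o :: e x)))
      (by simp [Tr.ser]) (by simp [Tr.ser]; change sz o + _ + _ + _ + _ ≤ B; omega) ?_ ?_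
    · have h := run_push_ext x (φ o) (bs (enc l).ser b [] []) e (B := B) (by simp; omega)
      match o with
      | none =>
        simp only [sz_none] at hB
        simp only [enc_cons, enc_none, Tr.ser, bs_A, List.tail_cons, update_bs_A, List.cons_append,
          List.nil_append]
        refine run_pop .A (by simp; omega) ?_
        simpa using h
      | some false =>
        simp only [sz_some, sz_false] at hB
        simp only [enc_cons, enc_some, enc_false, Tr.ser, bs_A, List.tail_cons, update_bs_A,
          List.cons_append, List.nil_append]
        refine run_pop .A (by simp; omega) (run_pop .A (by simp; omega) ?_)
        simp only [bs_A, List.tail_cons, update_bs_A]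
        refine run_pop .A (by simp; omega) ?_
        simpa using h
      | some true =>
        simp only [sz_some, sz_true] at hB
        simp only [enc_cons, enc_some, enc_true, Tr.ser, bs_A, List.tail_cons, update_bs_A,
          List.cons_append, List.nil_append]
        refine run_pop .A (by simp; omega) (run_pop .A (by simp; omega) ?_)
        simp only [bs_A, List.tail_cons, update_bs_A]
        refine run_pop .A (by simp; omega) (run_pop .A (by simp; omega)
          (run_pop .A (by simp; omega) ?_))
        simpa using h
    · have := ih (Function.update e x (φ o :: e x)) (by omega)
      simpa using this

end

theorem mk_update_ext {X : Type} [DecidableEq X] {G : X → Type} (x : X) (w : List (G x)) :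
    mk (bs [] [] [] []) (Function.update (fun _ => []) x w) =
      Function.update (fun k => ([] : List (Alph G k))) (Stk.ext x) w := by
  have : (fun k => ([] : List (Alph G k))) = mk (bs [] [] [] []) fun _ => [] := by
    funext k
    rcases k with (_ | _ | _ | _) | _ <;> rfl
  rw [this, update_mk_ext]

/-- Functions on texts computable by stack programs in polynomial space are computable in
polynomial space by Turing machines. -/
theorem nonempty_tm2_of_PS {E : Ext} [∀ x, Fintype (E.G x)] {α β γ αΓ βΓ : Type}
    [Data α] [Data γ] {xi xo : E.X}
    (e₀ : E.G xi ≃ αΓ) (e₁ : E.G xo ≃ βΓ) (ea : α → List αΓ) (eb : β → List βΓ)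
    (f : α → β) (ψ : αΓ → γ) (φ : Option Bool → βΓ) (hψ : ∀ a, enc a = enc ((ea a).map ψ))
    {F : α → List (Option Bool)} (hF : PS E F) (hφ : ∀ a, eb (f a) = (F a).map φ) :
    Nonempty (TM2ComputableInPolySpace ea eb f) := by
  -- The reversed text is computed because `emit` reverses it once more.
  obtain ⟨q, hq⟩ := hF.reverse.size_le
  obtain ⟨c, p, hc⟩ := hF.reverse
  obtain ⟨K, hK⟩ : ∃ K, ∀ s, sz (ψ (e₀ s)) ≤ K :=
    ⟨Finset.univ.sup fun s => sz (ψ (e₀ s)), fun s =>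
      Finset.le_sup (f := fun s => sz (ψ (e₀ s))) (Finset.mem_univ s)⟩
  -- An input symbol takes up to `K + 1` places in the tree and one on the input stack.
  let r : Polynomial ℕ := Polynomial.C (K + 2) * Polynomial.X + 1
  refine nonempty_tm2ComputableInPolySpace ea eb f
    (absorb (fun s => ψ (e₀ s)) ;; c ;; emit fun o => e₁.symm (φ o)) (.ext xi) (.ext xo) e₀ e₁
    (r + p.comp r + q.comp r) fun a => ?_
  have hr : sz a ≤ r.eval (ea a).length := by
    have hl : ∀ w : List αΓ, sz (w.map ψ) ≤ (K + 2) * w.length + 1 := by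
      intro w
      induction w with
      | nil => simp
      | cons s w ih =>
        have := hK (e₀.symm s)
        rw [Equiv.apply_symm_apply] at this
        simp only [List.map_cons, sz_cons, List.length_cons, Nat.mul_succ]
        omega
    have := hl (ea a)
    have ha : sz a = sz ((ea a).map ψ) := by rw [sz, hψ]; rfl
    simp only [r, Polynomial.eval_add, Polynomial.eval_mul, Polynomial.eval_C, Polynomial.eval_X,
      Polynomial.eval_one]
    omega
  have hsum : ∀ (x : E.X) (w : List (E.G x)),
      ∑ y, (Function.update (fun _ => []) x w y : List (E.G y)).length = w.length := by
    intro x w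
    have := sum_update (G := E.G) (fun _ => []) x w
    simpa using this
  simp only [Polynomial.eval_add, Polynomial.eval_comp]
  have h₁ := run_absorb (G := E.G) (x := xi) (fun s => ψ (e₀ s)) hK ((ea a).map e₀.symm) []
    (Function.update (fun _ => []) xi ((ea a).map e₀.symm)) (by simp)
    (B := r.eval (ea a).length + p.eval (r.eval (ea a).length) + q.eval (r.eval (ea a).length)) (by
      rw [hsum]
      simp only [r, Polynomial.eval_add, Polynomial.eval_mul, Polynomial.eval_C, Polynomial.eval_X,
        Polynomial.eval_one, List.length_map, List.length_nil]
      ring_nf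
      omega)
  have h₂ := (hc a []).mono (B' := r.eval (ea a).length + p.eval (r.eval (ea a).length) +
    q.eval (r.eval (ea a).length)) (by
      have := eval_mono p hr
      simp
      omega)
  have h₃ := run_emit (G := E.G) (x := xo) (fun o => e₁.symm (φ o)) (F a).reverse [] (fun _ => [])
    (B := r.eval (ea a).length + p.eval (r.eval (ea a).length) + q.eval (r.eval (ea a).length)) (by
      have := eval_mono q hr
      have := hq a
      simp
      omega)
  have ha : (enc (((ea a).map e₀.symm).map fun s => ψ (e₀ s))) = enc a := by
    rw [hψ, List.map_map]
    congr 2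
    funext s
    simp
  rw [← mk_update_ext, ← mk_update_ext]
  rw [ha, Function.update_idem, Function.update_eq_self_iff.2 rfl] at h₁
  rw [hφ, List.map_map]
  refine h₁.seq (h₂.seq ?_)
  simpa [st, Function.comp_def] using h₃

end StackProg

namespace StackProg

/-! ### Simulation of `TM2` machines by stack programs -/

section

variable {K : Type} {Γ : K → Type} {Λ σ : Type}

/-- The symbols that a statement can push. -/
def pushed : TM2.Stmt Γ Λ σ → Set (Σ k, Γ k)
  | .push k f q => Set.range (fun v => ⟨k, f v⟩) ∪ pushed q
  | .peek _ _ q => pushed q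
  | .pop _ _ q => pushed q
  | .load _ q => pushed q
  | .branch _ q₁ q₂ => pushed q₁ ∪ pushed q₂
  | .goto _ => ∅
  | .halt => ∅

/-- A pushed symbol depends only on the internal state. So a machine pushes finitely many symbols
even if the alphabets of its stacks are infinite, and stack programs, which branch over all symbols,
can simulate it. -/
theorem finite_pushed [Finite σ] : ∀ q : TM2.Stmt Γ Λ σ, (pushed q).Finite
  | .push _ _ q => (Set.finite_range _).union (finite_pushed q)
  | .peek _ _ q => finite_pushed q
  | .pop _ _ q => finite_pushed q
  | .load _ q => finite_pushed q
  | .branch _ q₁ q₂ => (finite_pushed q₁).union (finite_pushed q₂)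
  | .goto _ => Set.finite_empty
  | .halt => Set.finite_empty

/-- A bound on the number of symbols that a statement pushes, its successor label included. -/
def pushes : TM2.Stmt Γ Λ σ → ℕ
  | .push _ _ q => pushes q + 1
  | .peek _ _ q => pushes q
  | .pop _ _ q => pushes q
  | .load _ q => pushes q
  | .branch _ q₁ q₂ => pushes q₁ + pushes q₂
  | .goto _ => 1
  | .halt => 0

/-- The stacks for the simulation of a machine whose symbols belong to `A`: two stacks with the
alphabets `I` and `O`, one for the label and the internal state, and the stacks of the machine. -/
@[reducible] def SimAlph (A : Set (Σ k, Γ k)) (Λ σ I O : Type) : Bool ⊕ Option K → Type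
  | .inl false => I
  | .inl true => O
  | .inr none => Λ × σ
  | .inr (some k) => {s : Γ k // ⟨k, s⟩ ∈ A}

variable {A : Set (Σ k, Γ k)} {I O : Type}

/-- The stack for the label and the internal state. -/
abbrev ctl : Stk (Bool ⊕ Option K) := .ext (.inr none)

/-- The stack that represents a stack of the machine. -/
abbrev tape (k : K) : Stk (Bool ⊕ Option K) := .ext (.inr (some k))

open scoped Classical in
/-- The simulation of a statement. -/
noncomputable def simulate (A : Set (Σ k, Γ k)) (I O : Type) :
    TM2.Stmt Γ Λ σ → σ → Cmd (Alph (SimAlph A Λ σ I O))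
  | .push k f q, v =>
    (if h : ⟨k, f v⟩ ∈ A then .push (tape k) ⟨f v, h⟩ else .skip) ;; simulate A I O q v
  | .peek k f q, v => .pop (tape k) fun o =>
    o.elim .skip (fun s => .push (tape k) s) ;; simulate A I O q (f v (o.map Subtype.val))
  | .pop k f q, v => .pop (tape k) fun o => simulate A I O q (f v (o.map Subtype.val))
  | .load a q, v => simulate A I O q (a v)
  | .branch f q₁ q₂, v => cond (f v) (simulate A I O q₁ v) (simulate A I O q₂ v)
  | .goto f, v => .push ctl (f v, v)
  | .halt, _ => .skip

/-- The simulation of a machine. -/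
noncomputable def simulation (A : Set (Σ k, Γ k)) (I O : Type) (m : Λ → TM2.Stmt Γ Λ σ) (l : Λ)
    (v : σ) : Cmd (Alph (SimAlph A Λ σ I O)) :=
  .push ctl (l, v) ;; .loop ctl (fun o => o = none) fun o =>
    o.elim .skip fun x => simulate A I O (m x.1) x.2

/-- The stacks of a simulation represent a configuration of the machine. -/
structure Represents (e : ∀ x, List (SimAlph A Λ σ I O x)) (c : TM2.Cfg Γ Λ σ) : Prop where
  inl : ∀ b, e (.inl b) = []
  ctl : e (.inr none) = c.l.toList.map fun l => (l, c.var)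
  tape : ∀ k, (e (.inr (some k))).map Subtype.val = c.stk k

variable [DecidableEq K] [Fintype K]

theorem size_update_ext {X : Type} [DecidableEq X] [Fintype X] {G : X → Type}
    (s : Base → List Symb) (e : ∀ x, List (G x)) (x : X) (l : List (G x)) :
    size (mk s (Function.update e x l)) + (e x).length = size (mk s e) + l.length := by
  have := size_update (mk s e) (.ext x) l
  rwa [update_mk_ext] at this

/-- While a statement is executed, the control stack is empty and the internal state is a parameter
of the simulating program; it is stored again only together with the next label. The space grows by
at most `pushes q`, the control symbol included. -/
theorem exists_run_simulate (q : TM2.Stmt Γ Λ σ) (hq : pushed q ⊆ A) (v : σ)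
    (S : ∀ k, List (Γ k)) (s : Base → List Symb) (e : ∀ x, List (SimAlph A Λ σ I O x))
    (h : Represents e ⟨none, v, S⟩) {B : ℕ} (hB : size (mk s e) + pushes q ≤ B) :
    ∃ e', Run (simulate A I O q v) (mk s e) (mk s e') B ∧ Represents e' (TM2.stepAux q v S) ∧
      size (mk s e') ≤ size (mk s e) + pushes q := by
  induction q generalizing v S e with
  | push k f q ih =>
    simp only [pushed, Set.union_subset_iff, pushes] at hq hB
    have hm : ⟨k, f v⟩ ∈ A := hq.1 ⟨v, rfl⟩
    have hs := size_update_ext s e (.inr (some k)) (⟨f v, hm⟩ :: e (.inr (some k)))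
    simp only [List.length_cons] at hs
    obtain ⟨e', h₁, h₂, h₃⟩ := ih hq.2 v (Function.update S k (f v :: S k))
      (Function.update e (.inr (some k)) (⟨f v, hm⟩ :: e (.inr (some k))))
      ⟨fun b => by simpa using h.inl b, by simpa using h.ctl, fun k' => by
        by_cases hk : k' = k
        · subst hk; simpa using h.tape k'
        · rw [Function.update_of_ne (by simpa using hk)]
          exact (h.tape k').trans (Function.update_of_ne hk _ _).symm⟩ (by omega)
    refine ⟨e', ?_, h₂, by simp only [pushes]; omega⟩
    rw [simulate, dif_pos hm]
    exact (run_push_ext (.inr (some k)) ⟨f v, hm⟩ s e (by omega)).seq h₁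
  | peek k f q ih =>
    simp only [pushed, pushes] at hq hB
    obtain ⟨e', h₁, h₂, h₃⟩ := ih hq (f v (S k).head?) S e ⟨h.inl, h.ctl, h.tape⟩ hB
    refine ⟨e', ?_, h₂, h₃⟩
    have ht : (e (.inr (some k))).map Subtype.val = S k := h.tape k
    refine Run.pop (by omega) ?_
    rw [update_mk_ext, mk_ext]
    rw [← ht] at h₁
    have hs := size_update_ext s e (.inr (some k)) (e (.inr (some k))).tail
    rcases he : e (.inr (some k)) with _ | ⟨y, w⟩
    · rw [he] at h₁
      refine Run.seq (.skip (by rw [he] at hs; simp at hs ⊢; omega)) ?_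
      rw [List.tail_nil, Function.update_eq_self_iff.2 he.symm]
      exact h₁
    · rw [he] at h₁
      have hp := run_push_ext (.inr (some k)) y s (Function.update e (.inr (some k)) w)
        (by rw [he] at hs; simp at hs; omega : _ ≤ B)
      have hu : Function.update e (.inr (some k)) (y :: w) = e :=
        Function.update_eq_self_iff.2 he.symm
      rw [Function.update_self, Function.update_idem, hu] at hp
      refine Run.seq hp ?_
      simpa using h₁
  | pop k f q ih =>
    simp only [pushed, pushes] at hq hB
    have hs := size_update_ext s e (.inr (some k)) (e (.inr (some k))).tail
    simp only [List.length_tail] at hs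
    obtain ⟨e', h₁, h₂, h₃⟩ := ih hq (f v (S k).head?) (Function.update S k (S k).tail)
      (Function.update e (.inr (some k)) (e (.inr (some k))).tail)
      ⟨fun b => by simpa using h.inl b, by simpa using h.ctl, fun k' => by
        by_cases hk : k' = k
        · subst hk
          have := h.tape k'
          simp only at this
          simp [← this]
        · rw [Function.update_of_ne (by simpa using hk)]
          exact (h.tape k').trans (Function.update_of_ne hk _ _).symm⟩ (by omega)
    refine ⟨e', ?_, h₂, by simp only [pushes]; omega⟩
    refine Run.pop (by omega) ?_
    rw [update_mk_ext, mk_ext, ← List.head?_map, h.tape k]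
    exact h₁
  | load a q ih => exact ih hq (a v) S e ⟨h.inl, h.ctl, h.tape⟩ hB
  | branch f q₁ q₂ ih₁ ih₂ =>
    simp only [pushed, Set.union_subset_iff, pushes] at hq hB
    simp only [simulate, TM2.stepAux, pushes]
    cases f v
    · obtain ⟨e', h₁, h₂, h₃⟩ := ih₂ hq.2 v S e h (by omega)
      exact ⟨e', h₁, h₂, by omega⟩
    · obtain ⟨e', h₁, h₂, h₃⟩ := ih₁ hq.1 v S e h (by omega)
      exact ⟨e', h₁, h₂, by omega⟩
  | goto f =>
    have hs := size_update_ext s e (.inr none) ((f v, v) :: e (.inr none))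
    have hp := run_push_ext (G := SimAlph A Λ σ I O) (.inr none) (f v, v) s e hB
    refine ⟨_, hp, ⟨fun b => by simpa using h.inl b, ?_, fun k => by simpa using h.tape k⟩, ?_⟩
    · have he : e (.inr none) = [] := h.ctl
      rw [Function.update_self, he]
      rfl
    · simp only [List.length_cons, pushes] at hs ⊢
      omega
  | halt => exact ⟨e, .skip (by omega), h, by omega⟩

/-- Time bounds space: each of the `t` steps adds at most `κ` symbols. The loop ends when the
control stack holds no label, that is, when the machine has halted. -/
theorem exists_run_loop (m : Λ → TM2.Stmt Γ Λ σ) (hA : ∀ l, pushed (m l) ⊆ A) {κ : ℕ}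
    (hκ : ∀ l, pushes (m l) ≤ κ) (s : Base → List Symb) {B : ℕ} {d : TM2.Cfg Γ Λ σ}
    (hd : d.l = none) (t : ℕ) (c : TM2.Cfg Γ Λ σ) (e : ∀ x, List (SimAlph A Λ σ I O x))
    (h : Represents e c) (ht : (flip bind (TM2.step m))^[t] (some c) = some d)
    (hB : size (mk s e) + t * κ ≤ B) :
    ∃ e', Run (.loop ctl (fun o => o = none) fun o =>
        o.elim .skip fun x => simulate A I O (m x.1) x.2) (mk s e) (mk s e') B ∧
      Represents e' d := by
  induction t generalizing c e with
  | zero =>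
    obtain rfl : c = d := by simpa using ht
    have he : e (.inr none) = [] := by rw [h.ctl, hd]; rfl
    refine ⟨e, ?_, h⟩
    have := Run.loop_exit (k := (ctl : Stk (Bool ⊕ Option K))) (exits := fun o => o = none)
      (f := fun o => o.elim .skip fun x => simulate A I O (m x.1) x.2) (S := mk s e) (B := B)
      (by simp [he]) (by omega)
    rwa [update_mk_ext, mk_ext, he, List.tail_nil, Function.update_eq_self_iff.2 he.symm] at this
  | succ t ih =>
    rw [Function.iterate_succ_apply] at ht
    obtain ⟨_ | l, v, S⟩ := c
    -- The machine cannot have halted earlier: a halted configuration has no successor, so `d` would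
    -- not be reached.
    · have : ∀ t, (flip bind (TM2.step m))^[t] (none : Option (TM2.Cfg Γ Λ σ)) = none := by
        intro t
        induction t with
        | zero => rfl
        | succ t ih => rw [Function.iterate_succ_apply]; exact ih
      cases (this t).symm.trans ht
    · have he : e (.inr none) = [(l, v)] := h.ctl
      have hs := size_update_ext s e (.inr none) []
      rw [he] at hs
      simp only [List.length_cons, List.length_nil, Nat.succ_mul] at hs hB
      have hl := hκ l
      obtain ⟨e₁, h₁, h₂, h₃⟩ := exists_run_simulate (m l) (hA l) v S s
        (Function.update e (.inr none) [])
        ⟨fun b => by simpa using h.inl b, by simp, fun k => by simpa using h.tape k⟩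
        (B := B) (by omega)
      obtain ⟨e₂, h₄, h₅⟩ := ih _ e₁ h₂ ht (by omega)
      refine ⟨e₂, .loop_step (by simp [he]) (by omega) ?_ h₄, h₅⟩
      rw [update_mk_ext, mk_ext, he]
      exact h₁

theorem exists_run_simulation (m : Λ → TM2.Stmt Γ Λ σ) (hA : ∀ l, pushed (m l) ⊆ A) {κ : ℕ}
    (hκ : ∀ l, pushes (m l) ≤ κ) (s : Base → List Symb) {B : ℕ} {d : TM2.Cfg Γ Λ σ}
    (hd : d.l = none) (t : ℕ) (l : Λ) (v : σ) (S : ∀ k, List (Γ k))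
    (e : ∀ x, List (SimAlph A Λ σ I O x)) (h : Represents e ⟨none, v, S⟩)
    (ht : (flip bind (TM2.step m))^[t] (some ⟨some l, v, S⟩) = some d)
    (hB : size (mk s e) + t * κ + 1 ≤ B) :
    ∃ e', Run (simulation A I O m l v) (mk s e) (mk s e') B ∧ Represents e' d := by
  have hp := run_push_ext (G := SimAlph A Λ σ I O) (.inr none) (l, v) s e (B := B)
    (by omega)
  have hs := size_update_ext s e (.inr none) ((l, v) :: e (.inr none))
  simp only [List.length_cons] at hs
  obtain ⟨e', h₁, h₂⟩ := exists_run_loop m hA hκ s (B := B) hd t ⟨some l, v, S⟩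
    (Function.update e (.inr none) ((l, v) :: e (.inr none)))
    ⟨fun b => by simpa using h.inl b, by
      have he : e (.inr none) = [] := h.ctl
      rw [Function.update_self, he]
      rfl, fun k => by simpa using h.tape k⟩ ht (by omega)
  exact ⟨e', hp.seq h₁, h₂⟩

/-- In the final configuration only the output stack is nonempty. Once its word has been turned into
a tree, all further stacks are empty again, as `PS` requires. -/
theorem run_simulation {γ : Type} [Data γ] (m : Λ → TM2.Stmt Γ Λ σ)
    (hA : ∀ l, pushed (m l) ⊆ A) {κ : ℕ} (hκ : ∀ l, pushes (m l) ≤ κ) {k₀ k₁ : K} (t : ℕ) (l : Λ)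
    (v v' : σ) (u : List (SimAlph A Λ σ I O (.inr (some k₀)))) (out : List (Γ k₁))
    (ht : (flip bind (TM2.step m))^[t]
      (some ⟨some l, v, Function.update (fun _ => []) k₀ (u.map Subtype.val)⟩) =
        some ⟨none, v', Function.update (fun _ => []) k₁ out⟩)
    (ψ : Γ k₁ → γ) {N : ℕ} (hN : ∀ s : SimAlph A Λ σ I O (.inr (some k₁)), sz (ψ s.1) ≤ N)
    (b : List Symb) {R B : ℕ} (hR : u.length + t * κ + 1 ≤ R)
    (hB : (N + 1) * R + R + b.length + 1 ≤ B) :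
    Run (simulation A I O m l v ;; absorb (x := .inr (some k₁)) fun y => ψ y.1)
      (mk (bs [] b [] []) (Function.update (fun _ => []) (.inr (some k₀)) u))
      (mk (bs (enc (out.map ψ)).ser b [] []) fun _ => []) B := by
  have hs₀ := sum_update (G := SimAlph A Λ σ I O) (fun _ => []) (.inr (some k₀)) u
  simp only [List.length_nil, Finset.sum_const_zero, Nat.zero_add, Nat.add_zero] at hs₀
  obtain ⟨e₁, h₃, h₄⟩ := exists_run_simulation m hA hκ (bs [] b [] []) rfl t l v _
    (Function.update (fun _ => []) (.inr (some k₀)) u)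
    ⟨fun _ => rfl, rfl, fun k => by
      by_cases hk : k = k₀
      · subst hk; simp
      · rw [Function.update_of_ne (by simpa using hk)]
        exact (Function.update_of_ne hk _ fun _ => []).symm⟩ ht (B := R + b.length) (by
      simp only [size_mk, List.length_nil]
      omega)
  have hs₁ := h₃.size_le.2
  simp only [size_mk, List.length_nil] at hs₁
  have hw : (e₁ (.inr (some k₁))).map (fun y => ψ y.1) = out.map ψ := by
    have : (e₁ (.inr (some k₁))).map Subtype.val = out :=
      (h₄.tape k₁).trans (Function.update_self _ _ fun _ => [])
    rw [← this, List.map_map]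
    rfl
  have hwl : (e₁ (.inr (some k₁))).length ≤ R := by
    have := Finset.single_le_sum (f := fun x => (e₁ x).length) (fun _ _ => Nat.zero_le _)
      (Finset.mem_univ (.inr (some k₁)))
    omega
  have h₅ := run_absorb (fun y => ψ y.1) hN (e₁ (.inr (some k₁))) b e₁ rfl (B := B) (by
    have := Nat.mul_le_mul_left (N + 1) hwl
    omega)
  have he : Function.update e₁ (.inr (some k₁)) [] = fun _ => [] := by
    funext y
    rcases y with y | _ | k
    · simpa using h₄.inl y
    · simpa using h₄.ctl
    · by_cases hk : k = k₁
      · subst hk; simp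
      · rw [Function.update_of_ne (by simpa using hk)]
        exact List.map_eq_nil_iff.1 ((h₄.tape k).trans (Function.update_of_ne hk _ fun _ => []))
  rw [hw, he] at h₅
  exact (h₃.mono (by omega)).seq h₅

end

/-! ### Polynomial-time machines as subroutines -/

/-- The symbols that can occur on the stacks of a machine. -/
def symbols (tm : FinTM2) : Set (Σ k, tm.Γ k) :=
  (⋃ l, pushed (tm.m l)) ∪ Set.range fun s : tm.Γ tm.k₀ => ⟨tm.k₀, s⟩

theorem finite_symbols (tm : FinTM2) : (symbols tm).Finite := by
  have := tm.ΛFin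
  have := tm.σFin
  have := tm.Γk₀Fin
  exact (Set.finite_iUnion fun l => finite_pushed _).union (Set.finite_range _)

/-- The stacks for the simulation of a machine. -/
@[reducible] def simExt (tm : FinTM2) (I O : Type) : Ext :=
  letI := tm.kFin
  { X := Bool ⊕ Option tm.K, G := SimAlph (symbols tm) tm.Λ tm.σ I O }

noncomputable instance simExt.fintype (tm : FinTM2) (I O : Type) [Fintype I] [Fintype O] :
    ∀ x, Fintype ((simExt tm I O).G x) := fun x => by
  have := tm.ΛFin
  have := tm.σFin
  have : ∀ x, Finite (SimAlph (symbols tm) tm.Λ tm.σ I O x) := by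
    rintro ((_ | _) | _ | k)
    · exact inferInstanceAs (Finite I)
    · exact inferInstanceAs (Finite O)
    · exact inferInstanceAs (Finite (tm.Λ × tm.σ))
    · have := (finite_symbols tm).to_subtype
      exact Finite.of_injective (β := symbols tm)
        (fun s : {s : tm.Γ k // ⟨k, s⟩ ∈ symbols tm} => ⟨⟨k, s.1⟩, s.2⟩)
        fun s t h => Subtype.ext (by simpa using h)
  exact @Fintype.ofFinite _ (this x)

/-- Functions computable in polynomial time by a machine are computable in polynomial space by
stack programs. -/
theorem ps_of_polyTime {α β ι γ αΓ βΓ I O : Type} [Data ι] [Data γ] [Fintype I] [Fintype O]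
    {ea : α → List αΓ} {eb : β → List βΓ} {f : α → β} (h : TM2ComputableInPolyTime ea eb f)
    (ψ : βΓ → γ) (φ : Option Bool → αΓ) {g : ι → α} {F : ι → List (Option Bool)}
    (hF : PS (simExt h.tm I O) F) (hφ : ∀ x, ea (g x) = (F x).map φ) :
    PS (simExt h.tm I O) fun x => (eb (f (g x))).map ψ := by
  let _ := h.tm.kFin
  have := h.tm.ΛFin
  -- Input symbols belong to `symbols` by its second part, whether or not the machine ever pushes
  -- them.
  let φ' : Option Bool → SimAlph (symbols h.tm) h.tm.Λ h.tm.σ I O (.inr (some h.tm.k₀)) := fun o =>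
    ⟨h.inputAlphabet.symm (φ o), .inr ⟨_, rfl⟩⟩
  obtain ⟨q, hq⟩ := hF.reverse.size_le
  obtain ⟨c, p, hc⟩ := hF.reverse
  obtain ⟨κ, hκ⟩ : ∃ κ, ∀ l, pushes (h.tm.m l) ≤ κ :=
    ⟨Finset.univ.sup fun l => pushes (h.tm.m l), fun l =>
      Finset.le_sup (f := fun l => pushes (h.tm.m l)) (Finset.mem_univ l)⟩
  let _ := simExt.fintype h.tm I O (.inr (some h.tm.k₁))
  obtain ⟨N, hN⟩ : ∃ N, ∀ s : (simExt h.tm I O).G (.inr (some h.tm.k₁)),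
      sz (ψ (h.outputAlphabet s.1)) ≤ N :=
    ⟨Finset.univ.sup fun s : (simExt h.tm I O).G (.inr (some h.tm.k₁)) =>
      sz (ψ (h.outputAlphabet s.1)), fun s => Finset.le_sup
        (f := fun s : (simExt h.tm I O).G (.inr (some h.tm.k₁)) =>
          sz (ψ (h.outputAlphabet s.1))) (Finset.mem_univ s)⟩
  -- The input has length at most `q`, each step within the time bound adds at most `κ` symbols, and
  -- one place is for the initial control symbol.
  let r : Polynomial ℕ := q + h.time.comp q * Polynomial.C κ + 1
  refine ⟨c ;; emit (x := .inr (some h.tm.k₀)) φ' ;; simulation (symbols h.tm) I O h.tm.m h.tm.main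
    h.tm.initialState ;; absorb (G := SimAlph (symbols h.tm) h.tm.Λ h.tm.σ I O)
      (x := .inr (some h.tm.k₁)) fun y => ψ (h.outputAlphabet y.1),
    p + q + Polynomial.C (N + 2) * r + 1, fun x b => ?_⟩
  set B := (p + q + Polynomial.C (N + 2) * r + 1).eval (sz x) + b.length with hB
  simp only [Polynomial.eval_add, Polynomial.eval_mul, Polynomial.eval_C, Polynomial.eval_one] at hB
  set R := r.eval (sz x) with hR
  simp only [r, Polynomial.eval_add, Polynomial.eval_mul, Polynomial.eval_C, Polynomial.eval_one,
    Polynomial.eval_comp] at hR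
  have hRB : (N + 2) * R = (N + 1) * R + R := by ring
  have hqx := hq x
  have hlen : (F x).length ≤ q.eval (sz x) := by
    have := length_le_sz (F x)
    rw [sz_reverse] at hqx
    omega
  have h₁ := (hc x b).mono (B' := B) (by omega)
  have h₂ := run_emit (G := (simExt h.tm I O).G) (x := .inr (some h.tm.k₀)) φ' (F x).reverse b (fun _ => []) (B := B) (by
    simp only [List.length_nil, Finset.sum_const_zero]
    omega)
  rw [List.map_reverse, List.reverse_reverse, List.append_nil] at h₂
  obtain ⟨⟨t, ht⟩, htm⟩ := h.outputsFun (g x)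
  have hu : ((F x).map φ').map Subtype.val = (ea (g x)).map h.inputAlphabet.symm := by
    rw [hφ]
    exact List.map_map.trans (List.map_map (f := φ) (g := h.inputAlphabet.symm)).symm
  have hi : initList h.tm ((ea (g x)).map h.inputAlphabet.symm) =
      TM2.Cfg.mk (some h.tm.main) h.tm.initialState (Function.update (fun _ => []) h.tm.k₀
        (((F x).map φ').map Subtype.val)) := by
    rw [hu]
    exact congrArg (TM2.Cfg.mk (some h.tm.main) h.tm.initialState) (dite_eq_update h.tm.k₀ _)
  have ho : haltList h.tm ((eb (f (g x))).map h.outputAlphabet.symm) =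
      TM2.Cfg.mk none h.tm.initialState
        (Function.update (fun _ => []) h.tm.k₁ ((eb (f (g x))).map h.outputAlphabet.symm)) :=
    congrArg (TM2.Cfg.mk none h.tm.initialState) (dite_eq_update h.tm.k₁ _)
  have htime : t * κ ≤ h.time.eval (q.eval (sz x)) * κ := by
    refine Nat.mul_le_mul_right κ (htm.trans (eval_mono _ ?_))
    rw [hφ, List.length_map]
    exact hlen
  have h₃ := run_simulation (A := symbols h.tm) (I := I) (O := O) h.tm.m
    (fun l => (Set.subset_iUnion (fun l => pushed (h.tm.m l)) l).trans Set.subset_union_left) hκ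
    t h.tm.main h.tm.initialState h.tm.initialState ((F x).map φ')
    ((eb (f (g x))).map h.outputAlphabet.symm)
    ((congrArg (fun c => (flip bind (TM2.step h.tm.m))^[t] (some c)) hi).symm.trans
      (ht.trans (congrArg some ho))) (fun y => ψ (h.outputAlphabet y)) hN b (R := R) (B := B)
    (by rw [List.length_map]; omega) (by omega)
  rw [List.map_map] at h₃
  have hψ : (eb (f (g x))).map ((fun y => ψ (h.outputAlphabet y)) ∘ h.outputAlphabet.symm) =
      (eb (f (g x))).map ψ := by
    congr 1
    funext y
    simp
  rw [hψ] at h₃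
  exact h₁.seq (h₂.seq h₃)

end StackProg

namespace StackProg

/-! ### Texts over the standard alphabet -/

/-- Symbols of the standard alphabet as symbols of texts. -/
def bitOf : Γ' → Option Bool
  | .bit b => some b
  | _ => none

/-- Symbols of texts as symbols of the standard alphabet. -/
def symbolOf : Option Bool → Γ'
  | some b => .bit b
  | none => .comma

theorem encBits_eq (l : List Bool) : encBits l = (l.map some).map symbolOf := by
  rw [List.map_map]; rfl

@[simp] theorem map_bitOf_encBits (l : List Bool) : (encBits l).map bitOf = l.map some := by
  rw [encBits, List.map_map]; rfl

theorem wordsText_cons (w : List Bool) (ws : List (List Bool)) :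
    wordsText (w :: ws) = w.map some ++ none :: wordsText ws := by
  simp [wordsText]

theorem wordsText_flatMap {α : Type} (f : α → List (List Bool)) (l : List α) :
    wordsText (l.flatMap f) = l.flatMap fun a => wordsText (f a) :=
  List.flatMap_assoc

theorem encIntNat_eq (z : ℤ × ℕ) : encIntNat z = (resultText z.1 z.2).map symbolOf := by
  simp [encIntNat, resultText, encNat, encBits_eq, wordsText, symbolOf]

theorem map_bitOf_gate {S : ℕ} (g : QGate S) :
    g.enc.map bitOf = wordsText (gateWords (opWires (some g))) := by
  cases g <;> simp [QGate.enc, encNat, opWires, gateWords, wordsText, bitOf]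

/-- The gates of a circuit, given by their wires. -/
def wireLists {n : ℕ} (C : QCircuit n) : List (List Wire) := (circuitOps C).map opWires

theorem flatMap_gateWords {n : ℕ} (C : QCircuit n) :
    (wireLists C).flatMap gateWords = C.gates.flatMap fun g => gateWords (opWires (some g)) := by
  rw [wireLists, circuitOps, List.map_map, List.flatMap_map]
  rfl

theorem wordsGates_flatMap {n : ℕ} (C : QCircuit n) :
    wordsGates (C.gates.flatMap fun g => gateWords (opWires (some g))) = wireLists C := by
  rw [← flatMap_gateWords]
  refine wordsGates_gateWords _ fun g hg => ?_
  simp only [wireLists, circuitOps, List.map_map, List.mem_map] at hg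
  obtain ⟨g, -, rfl⟩ := hg
  cases g <;> simp [opWires]

theorem map_bitOf_circuit {n : ℕ} (C : QCircuit n) :
    C.enc.map bitOf = wordsText (encodeNat C.width ::
      C.gates.flatMap fun g => gateWords (opWires (some g))) := by
  rw [wordsText_cons, wordsText_flatMap, QCircuit.enc, List.map_append, List.map_flatMap]
  simp only [map_bitOf_gate]
  simp [encNat, bitOf]

/-! ### Amplitudes and acceptance probabilities of given circuits -/

instance AmplitudeInput.data : Data AmplitudeInput := ⟨fun a => enc (a.enc.map bitOf)⟩

instance CircuitInput.data : Data CircuitInput := ⟨fun a => enc (a.enc.map bitOf)⟩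

/-- Two stacks with the standard alphabet. -/
abbrev ioExt : Ext := { X := Bool, G := fun _ => Γ' }

theorem exactInPolySpace_amplitude :
    ExactInPolySpace (Real.sqrt 2) AmplitudeInput.enc fun a => a.circuit.finalState a.x a.i := by
  have hF : PS ioExt fun a : AmplitudeInput =>
      resultText (amplitude (textWords (a.enc.map bitOf))).1
        (amplitude (textWords (a.enc.map bitOf))).2 := by
    have h : PS ioExt fun a : AmplitudeInput => a.enc.map bitOf := .of_enc_eq fun _ => rfl
    fun_prop
  refine ⟨fun a => amplitude (textWords (a.enc.map bitOf)),
    nonempty_tm2_of_PS (E := ioExt) (xi := false) (xo := true) (.refl _) (.refl _) _ _ _ bitOf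
      symbolOf (fun _ => rfl) hF fun _ => encIntNat_eq _, fun a => ?_⟩
  have ht : a.enc.map bitOf = wordsText (List.ofFn a.i :: List.ofFn a.x ::
      encodeNat a.circuit.width ::
        a.circuit.gates.flatMap fun g => gateWords (opWires (some g))) := by
    rw [wordsText_cons, wordsText_cons, ← map_bitOf_circuit]
    simp [AmplitudeInput.enc, bitOf]
  beta_reduce
  rw [ht, textWords_wordsText, finalState_eq_pathCount]
  simp only [amplitude, List.tail_cons, wordsGates_flatMap]
  push_cast
  rfl

theorem acceptProb_eq_probability {n : ℕ} (C : QCircuit n) (x : Fin n → Bool) :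
    C.acceptProb x = ((probability (wireLists C) (List.ofFn x)).1 : ℝ) /
      2 ^ (probability (wireLists C) (List.ofFn x)).2 := by
  have := acceptProb_eq_pathCount C x
  exact_mod_cast this

theorem exactInPolySpace_acceptProb :
    ExactInPolySpace 2 CircuitInput.enc fun a => ((a.circuit.acceptProb a.x : ℝ) : ℂ) := by
  have hF : PS ioExt fun a : CircuitInput =>
      resultText (probability (wordsGates (textWords (a.enc.map bitOf)).tail.tail)
          ((textWords (a.enc.map bitOf)).headD [])).1
        (probability (wordsGates (textWords (a.enc.map bitOf)).tail.tail)
          ((textWords (a.enc.map bitOf)).headD [])).2 := by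
    have h : PS ioExt fun a : CircuitInput => a.enc.map bitOf := .of_enc_eq fun _ => rfl
    fun_prop
  refine ⟨fun a => probability (wordsGates (textWords (a.enc.map bitOf)).tail.tail)
      ((textWords (a.enc.map bitOf)).headD []),
    nonempty_tm2_of_PS (E := ioExt) (xi := false) (xo := true) (.refl _) (.refl _) _ _ _ bitOf
      symbolOf (fun _ => rfl) hF fun _ => encIntNat_eq _, fun a => ?_⟩
  have ht : a.enc.map bitOf = wordsText (List.ofFn a.x :: encodeNat a.circuit.width ::
        a.circuit.gates.flatMap fun g => gateWords (opWires (some g))) := by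
    rw [wordsText_cons, ← map_bitOf_circuit]
    simp [CircuitInput.enc, bitOf]
  beta_reduce
  rw [ht, textWords_wordsText, acceptProb_eq_probability]
  simp only [List.tail_cons, wordsGates_flatMap]
  rfl

/-! ### Uniform families -/

theorem PS.replicate {E : Ext} {α : Type} [Data α] {f : α → List Bool} (hf : PS E f) :
    PS E fun a => List.replicate (f a).length true := by
  have h : PS E fun a => (f a).foldl (fun l _ => true :: l) [] :=
    PS.foldl (f := fun (_ : Unit) l (_ : Bool) => true :: l) (by fun_prop) false 4
      (fun c b a => by simp; omega) (PS.const ()) (PS.const []) hf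
  have h' : ∀ (w l : List Bool), w.foldl (fun l _ => true :: l) l =
      List.replicate w.length true ++ l := by
    intro w
    induction w with
    | nil => intro l; rfl
    | cons b w ih =>
      intro l
      rw [List.foldl_cons, ih, List.length_cons, List.replicate_succ', List.append_assoc]
      rfl
  simpa only [h', List.append_nil] using h

/-- The text that describes a gate, empty if there is no gate. -/
def gateText {S : ℕ} (g : Option (QGate S)) : List (Option Bool) :=
  (g.elim [] QGate.enc).map bitOf

/-- One step of collecting the descriptions of the gates for an input. -/
def collectStep (C : ∀ n, QCircuit n) (s : List Bool × ℕ × List (Option Bool)) :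
    Bool × List Bool × ℕ × List (Option Bool) :=
  (!(gateText (C s.1.length).gates[s.2.1]?).isEmpty, s.1, s.2.1 + 1,
    s.2.2 ++ gateText (C s.1.length).gates[s.2.1]?)

theorem gateText_isEmpty {S : ℕ} (g : QGate S) : (gateText (some g)).isEmpty = false := by
  cases g <;> rfl

/-- No gate has an empty description, so the loop stops exactly when the gates are exhausted. The
last round still increases the counter, whence the final value `length + 1`. -/
theorem dw_collectStep (C : ∀ n, QCircuit n) (w : List Bool) {M N : ℕ}
    (hM : ∀ j ≤ (C w.length).gates.length, sz (gateText (C w.length).gates[j]?) ≤ M)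
    (hN : sz w + 2 * sz ((C w.length).gates.length + 1) +
      ((C w.length).gates.length + 1) * M + 3 ≤ N) (k j : ℕ) (text : List (Option Bool))
    (hj : j + k = (C w.length).gates.length) (ht : sz text ≤ j * M + 1) :
    DW (collectStep C) N (w, j, text) (w, (C w.length).gates.length + 1,
      text ++ ((C w.length).gates.drop j).flatMap fun g => gateText (some g)) := by
  have hsz : sz (w, j, text) ≤ N := by
    have h₁ : sz j ≤ 2 * sz ((C w.length).gates.length + 1) := sz_nat_le (by omega)
    have h₂ : j * M ≤ ((C w.length).gates.length + 1) * M := Nat.mul_le_mul_right M (by omega)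
    simp only [sz_prod]
    omega
  induction k generalizing j text with
  | zero =>
    obtain rfl : j = (C w.length).gates.length := by omega
    refine .exits hsz ?_
    simp [collectStep, gateText]
  | succ k ih =>
    have hlt : j < (C w.length).gates.length := by omega
    have hg := hM j hlt.le
    have ha := sz_append text (gateText (C w.length).gates[j]?)
    rw [List.getElem?_eq_getElem hlt] at hg ha
    have ht' : sz (text ++ gateText (some (C w.length).gates[j])) ≤ (j + 1) * M + 1 := by
      rw [Nat.succ_mul]
      omega
    refine .next (a₁ := (w, j + 1, text ++ gateText (some (C w.length).gates[j]))) hsz ?_ ?_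
    · simp [collectStep, List.getElem?_eq_getElem hlt, gateText_isEmpty]
    · rw [List.drop_eq_getElem_cons hlt, List.flatMap_cons, ← List.append_assoc]
      refine ih (j + 1) _ (by omega) ht' ?_
      have h₁ : sz (j + 1) ≤ 2 * sz ((C w.length).gates.length + 1) := sz_nat_le (by omega)
      have h₂ : (j + 1) * M ≤ ((C w.length).gates.length + 1) * M :=
        Nat.mul_le_mul_right M (by omega)
      simp only [sz_prod]
      omega

theorem sz_nat_le_linear (n : ℕ) : sz n ≤ 4 * n + 1 := by
  have h := sz_word_le (encodeNat n)
  have h' : n.size ≤ n := Nat.size_le.2 Nat.lt_two_pow_self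
  rw [length_encodeNat] at h
  rw [sz_nat]
  omega

theorem ps_wireLists {C : ∀ n, QCircuit n} {p : Polynomial ℕ}
    (hp : ∀ n, (C n).gates.length ≤ p.eval n) {E : Ext}
    (h : PS E fun s : List Bool × ℕ => gateText (C s.1.length).gates[s.2]?) :
    PS E fun w : List Bool => wireLists (C w.length) := by
  obtain ⟨q, hq⟩ := h.size_le
  have hstep : PS E (collectStep C) := by
    have h' : PS E fun s : List Bool × ℕ × List (Option Bool) =>
        gateText (C s.1.length).gates[s.2.1]? :=
      h.comp (f := fun s : List Bool × ℕ × List (Option Bool) => (s.1, s.2.1)) (by fun_prop)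
    unfold collectStep
    fun_prop
  have hloop : PS E fun w : List Bool => (w, (C w.length).gates.length + 1,
      (C w.length).gates.flatMap fun g => gateText (some g)) := by
    refine PS.loop (i := fun w => (w, 0, [])) hstep (by fun_prop)
      -- The summands bound the input, the counter, the collected text, in which each description is
      -- bounded by `q` at the size of its query, and the remaining nodes.
      (Polynomial.X + 2 * (4 * (p + 1) + 1) +
        (p + 1) * q.comp (Polynomial.X + (4 * p + 1) + 1) + 3) fun w => ?_
    have hw : (C w.length).gates.length ≤ p.eval (sz w) :=
      (hp _).trans (eval_mono p (length_le_sz w))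
    refine dw_collectStep C w (M := q.eval (sz w + (4 * p.eval (sz w) + 1) + 1)) (fun j hj => ?_)
      ?_ _ 0 [] (Nat.zero_add _) (by simp)
    · refine (hq (w, j)).trans (eval_mono q ?_)
      have := sz_nat_le_linear j
      simp only [sz_prod]
      omega
    · have h₁ := sz_nat_le_linear ((C w.length).gates.length + 1)
      have h₂ := Nat.mul_le_mul_right (q.eval (sz w + (4 * p.eval (sz w) + 1) + 1))
        (Nat.succ_le_succ hw)
      simp only [Polynomial.eval_add, Polynomial.eval_mul, Polynomial.eval_comp,
        Polynomial.eval_X, Polynomial.eval_ofNat, Polynomial.eval_one]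
      simp only [Nat.succ_eq_add_one] at h₂
      omega
  have h' : PS E fun w : List Bool => wordsGates (textWords
      ((C w.length).gates.flatMap fun g => gateText (some g))) := by
    have := hloop.snd.snd
    fun_prop
  refine h'.congr fun w => ?_
  have : ∀ g : QGate (C w.length).width,
      gateText (some g) = wordsText (gateWords (opWires (some g))) := map_bitOf_gate
  simp only [this]
  rw [← wordsText_flatMap, textWords_wordsText, wordsGates_flatMap]

/-- The machine that generates the family determines the additional stacks. The output alphabet is
left open, since it is the standard one for probabilities and `Bool` for decisions. -/
theorem exists_ps_wireLists {C : ∀ n, QCircuit n} (hC : IsUniformPolySize C) (O : Type)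
    [Fintype O] : ∃ tm, PS (simExt tm Bool O) fun w : List Bool => wireLists (C w.length) := by
  obtain ⟨⟨p, hp⟩, ⟨h⟩⟩ := hC
  refine ⟨h.tm, ps_wireLists hp ?_⟩
  refine ps_of_polyTime h bitOf symbolOf (g := fun s : List Bool × ℕ => (s.1.length, s.2))
    (F := fun s => (List.replicate s.1.length true).map some ++
      none :: (encodeNat s.2).map some) ?_ fun s => ?_
  · have h₁ := PS.map_some (E := simExt h.tm Bool O) false
      (PS.replicate (f := fun s : List Bool × ℕ => s.1) (by fun_prop))
    have h₂ := PS.map_some (E := simExt h.tm Bool O) false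
      (f := fun s : List Bool × ℕ => encodeNat s.2) (by fun_prop)
    fun_prop
  · simp [encUnaryBinary, encBits_eq, symbolOf]

theorem exactInPolySpace_uniform {C : ∀ n, QCircuit n} (hC : IsUniformPolySize C) :
    ExactInPolySpace 2 (fun w : List Bool => w)
      fun w => (((C w.length).acceptProb w.get : ℝ) : ℂ) := by
  obtain ⟨tm, h⟩ := exists_ps_wireLists hC Γ'
  have hF : PS (simExt tm Bool Γ') fun w : List Bool =>
      resultText (probability (wireLists (C w.length)) w).1
        (probability (wireLists (C w.length)) w).2 := by
    fun_prop
  refine ⟨fun w => probability (wireLists (C w.length)) w,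
    nonempty_tm2_of_PS (E := simExt tm Bool Γ') (xi := .inl false) (xo := .inl true) (.refl _)
      (.refl _) _ _ _ id symbolOf (fun w => by simp) hF fun _ => encIntNat_eq _, fun w => ?_⟩
  beta_reduce
  rw [acceptProb_eq_probability, List.ofFn_get]

/-! ### Bounded-error quantum polynomial time -/

/-- Instead of counting down the exponent, one symbol is dropped for each Hadamard gate. -/
theorem PS.drop_hadCount {E : Ext} {α : Type} [Data α] {f : α → List (List Wire)}
    {g : α → List Bool} (hf : PS E f) (hg : PS E g) :
    PS E fun a => (g a).drop (StackProg.hadCount (f a)) := by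
  have h : PS E fun a => (f a).foldl
      (fun l g => cond (!g.isEmpty && g.tail.isEmpty) l.tail l) (g a) :=
    PS.foldl (f := fun (_ : Unit) l (g : List Wire) =>
      cond (!g.isEmpty && g.tail.isEmpty) l.tail l) (by fun_prop) [] 0
      (fun c b a => by
        have := sz_tail_le b
        cases (!a.isEmpty && a.tail.isEmpty) <;> simp only [cond_true, cond_false] <;> omega)
      (PS.const ()) hg hf
  have h' : ∀ (gs : List (List Wire)) (l : List Bool) (k : ℕ),
      gs.foldl (fun l g => cond (!g.isEmpty && g.tail.isEmpty) l.tail l) (l.drop k) =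
        l.drop (gs.foldl (fun n g => cond (!g.isEmpty && g.tail.isEmpty) (n + 1) n) k) := by
    intro gs
    induction gs with
    | nil => intro l k; rfl
    | cons g gs ih =>
      intro l k
      rw [List.foldl_cons, List.foldl_cons]
      cases !g.isEmpty && g.tail.isEmpty
      · exact ih l k
      · have := ih l (k + 1)
        rw [← List.tail_drop] at this
        exact this
  have h'' : ∀ a, (f a).foldl
      (fun l g => cond (!g.isEmpty && g.tail.isEmpty) l.tail l) (g a) =
        (g a).drop (StackProg.hadCount (f a)) := fun a => h' (f a) (g a) 0
  simpa only [h''] using h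

/-- Whether the quotient of `z` and `2 ^ e` is at least `1 / 2`. -/
def atLeastHalf (z : ℤ) (e : ℕ) : Bool :=
  !(encodeNat z.natAbs).isEmpty && !((false :: encodeNat z.natAbs).drop e).isEmpty

/-- For `z ≠ 0` the inequality says that `e` is at most the binary length of `|z|`. Dropping `e`
symbols from the word lengthened by one symbol tests this. Zero is excluded separately, because the
length test alone would accept it for `e = 0`. -/
theorem atLeastHalf_iff (z : ℤ) (e : ℕ) :
    atLeastHalf z e = true ↔ 0 < z.natAbs ∧ 2 ^ e ≤ 2 * z.natAbs := by
  have h₁ : (encodeNat z.natAbs).isEmpty = false ↔ 0 < z.natAbs := by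
    rw [List.isEmpty_eq_false_iff, ← List.length_pos_iff, length_encodeNat, Nat.size_pos]
  have h₂ : ((false :: encodeNat z.natAbs).drop e).isEmpty = false ↔ e ≤ z.natAbs.size := by
    rw [List.isEmpty_eq_false_iff, ← List.length_pos_iff, List.length_drop, List.length_cons,
      length_encodeNat]
    omega
  rw [atLeastHalf, Bool.and_eq_true, Bool.not_eq_true', Bool.not_eq_true', h₁, h₂]
  refine and_congr_right fun hz => ?_
  cases e with
  | zero => simp; omega
  | succ e => rw [Nat.succ_le_iff, Nat.lt_size, pow_succ]; omega

theorem acceptProb_nonneg {n : ℕ} (C : QCircuit n) (x : Fin n → Bool) : 0 ≤ C.acceptProb x :=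
  Finset.sum_nonneg fun _ _ => by split_ifs <;> positivity

open scoped Classical in
theorem bqp_subset_pspace : BQP ⊆ PSPACE := by
  rintro L ⟨C, hC, hL⟩
  obtain ⟨tm, h⟩ := exists_ps_wireLists hC Bool
  have hF : PS (simExt tm Bool Bool) fun w : List Bool =>
      [some (atLeastHalf (probability (wireLists (C w.length)) w).1
        (probability (wireLists (C w.length)) w).2)] := by
    have hz : PS (simExt tm Bool Bool) fun w : List Bool =>
        encodeNat (probability (wireLists (C w.length)) w).1.natAbs := by fun_prop
    have hd := PS.drop_hadCount h ((PS.const false).cons hz)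
    unfold atLeastHalf
    change PS _ fun w : List Bool => [some (!(encodeNat (probability _ w).1.natAbs).isEmpty &&
      !((false :: encodeNat (probability _ w).1.natAbs).drop (hadCount _)).isEmpty)]
    fun_prop
  refine nonempty_tm2_of_PS (E := simExt tm Bool Bool) (xi := .inl false) (xo := .inl true)
    (.refl _) (.refl _) _ _ _ id (fun o => o.getD false) (fun w => by simp) hF fun w => ?_
  rw [List.map_singleton, Option.getD_some]
  change [_] = [_]
  congr 1
  have hp := acceptProb_eq_probability (C w.length) w.get
  rw [List.ofFn_get] at hp
  set z := (probability (wireLists (C w.length)) w).1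
  set e := (probability (wireLists (C w.length)) w).2
  have hpos : (0 : ℝ) < 2 ^ e := by positivity
  have hz : 0 ≤ z := by
    have := acceptProb_nonneg (C w.length) w.get
    rw [hp, le_div_iff₀ hpos, zero_mul] at this
    exact_mod_cast this
  obtain ⟨m, hm⟩ := Int.eq_ofNat_of_zero_le hz
  rw [hm, Int.cast_natCast] at hp
  have hiff := atLeastHalf_iff z e
  rw [hm, Int.natAbs_natCast] at hiff
  rw [hm, Bool.eq_iff_iff, hiff, decide_eq_true_iff]
  obtain ⟨h₁, h₂⟩ := hL w
  rw [hp] at h₁ h₂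
  -- The probability is `m / 2 ^ e`. If it is at least 2/3, then `2 ^ e ≤ 2 * m` and `m` is
  -- positive; if it were at most 1/3 while `2 ^ e ≤ 2 * m`, then `m` would be 0.
  constructor
  · intro hw
    have := h₁ hw
    rw [div_le_div_iff₀ (by norm_num) hpos] at this
    have : 2 * 2 ^ e ≤ m * 3 := by exact_mod_cast this
    have : 0 < 2 ^ e := by positivity
    omega
  · rintro ⟨h₃, h₄⟩
    by_contra hw
    have := h₂ hw
    rw [div_le_div_iff₀ hpos (by norm_num)] at this
    have : m * 3 ≤ 1 * 2 ^ e := by exact_mod_cast this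
    omega

end StackProg

theorem mainTheorem4 :
    -- every amplitude is the sum over paths of intermediate basis states
    (∀ (n : ℕ) (C : QCircuit n) (x : Fin n → Bool) (i : Fin C.width → Bool),
      C.finalState x i = C.pathSum x i) ∧
    -- amplitudes, given a circuit, an input and a basis state
    ExactInPolySpace (Real.sqrt 2) AmplitudeInput.enc
      (fun a => a.circuit.finalState a.x a.i) ∧
    -- acceptance probabilities, given a circuit and an input
    ExactInPolySpace 2 CircuitInput.enc
      (fun a => ((a.circuit.acceptProb a.x : ℝ) : ℂ)) ∧
    -- acceptance probabilities of a uniform polynomial-size family, given an input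
    (∀ C : ∀ n : ℕ, QCircuit n, IsUniformPolySize C →
      ExactInPolySpace 2 (fun w : List Bool => w)
        (fun w => (((C w.length).acceptProb w.get : ℝ) : ℂ))) ∧
    BQP ⊆ PSPACE := by
  exact ⟨fun n C x i => StackProg.finalState_eq_pathSum C x i,
    StackProg.exactInPolySpace_amplitude, StackProg.exactInPolySpace_acceptProb,
    fun _ hC => StackProg.exactInPolySpace_uniform hC, StackProg.bqp_subset_pspace⟩
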